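/- **Setting.** Let $\mathcal U=\bigoplus_{1\le i,j\le r}\mathcal U_{ij}$ be a $T$-algebra of rank $r$: a finite-dimensional real (not necessarily associative) algebra with a linear involution $x\mapsto x^\star$ such that $(xy)^\star=y^\star x^\star$, $\mathcal U_{ij}^\star=\mathcal U_{ji}$, $\mathcal U_{ij}\,\mathcal U_{jk}\subset\mathcal U_{ik}$, $\mathcal U_{ij}\,\mathcal U_{lk}=\{0\}$ for $j\ne l$, $\mathcal U_{ii}=\mathbb R c_i$ with $c_i\neq0$, and $c_ix=x=xc_j$ for $x\in\mathcal U_{ij}$. Write $x_{ij}$ for the component of $x$ in $\mathcal U_{ij}$, $\varrho(\lambda c_i)=\lambda$, $\operatorname{tr}x=\sum_i\varrho(x_{ii})$, $\mathcal T=\bigoplus_{i\le j}\mathcal U_{ij}$, and assume: $\operatorname{tr}(xy)=\operatorname{tr}(yx)$; $\operatorname{tr}(x(yz))=\operatorname{tr}((xy)z)$; $\operatorname{tr}(xx^\star)>0$ for $x\ne0$; $t(uw)=(tu)w$ and $t(uu^\star)=(tu)u^\star$ for $t,u,w\in\mathcal T$. Put $m_i=\sum_{j>i}\dim\mathcal U_{ij}$,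 $n_i=\sum_{j<i}\dim\mathcal U_{ji}$, $\tau_i=1+\frac12(m_i+n_i)$, and $H=\{t\in\mathcal T:\varrho(t_{ii})>0,\ i=1,\dots,r\}$. Let $V=\{x\in\mathcal U:x^\star=x\}$ be the Euclidean space with inner product $(x|y)=\operatorname{tr}(xy^\star)$ (extended complex-bilinearly to $V+iV$), $\Omega=\{tt^\star:t\in H\}\subset V$ the associated homogeneous cone, $\Omega^*=\{t^\star t:t\in H\}$ its dual cone, and $T_\Omega=V+i\Omega$. The element $t\in H$ in $y=tt^\star$, resp. $\xi=t^\star t$, is unique; put $Q_j(y)=\varrho(t_{jj})^2$, resp. $Q_j^*(\xi)=\varrho(t_{jj})^2$, and for $\alpha\in\mathbb R^r$, $Q^\alpha=\prod_jQ_j^{\alpha_j}$ on $\Omega$ and $(Q^*)^\alpha=\prod_j(Q_j^*)^{\alpha_j}$ on $\Omega^*$. Let $\rho\in\mathbb R^r$ be an $\Omega$-integral vector, i.e. $\rho_j>0$ for all $j$ and $(Q^*)^\rho$ coincides on $\Omega^*$ with a polynomial. Let $\Box$ be the differential operator with constant coefficients such that $\Box\,[e^{i(z|\xi)}]=(Q^*)^\rho(\xi)\,e^{i(z|\xi)}$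 for $\xi\in\Omega^*$, acting on holomorphic functions on $T_\Omega$, and let $\Box^k$ be its $k$-fold composition, $k$ a nonnegative integer. For $\nu\in\mathbb R^r$ and $1\le p,q\le\infty$, let $A^{p,q}_\nu(T_\Omega)$ be the space of holomorphic functions $f$ on $T_\Omega$ for which $$\|f\|_{A^{p,q}_\nu}=\Big(\int_\Omega\|f(\cdot+iy)\|_{L^p(V)}^q\,Q^{\nu-\tau}(y)\,dy\Big)^{1/q}<\infty\quad(q<\infty),\qquad \|f\|_{A^{p,\infty}_\nu}=\operatorname*{ess\,sup}_{y\in\Omega}\|f(\cdot+iy)\|_{L^p(V)}<\infty .$$ **Proposition.** Let $1\le p\le\infty$, let $k$ be a nonnegative integer, and let $\nu\in\mathbb R^r$ with $\nu_j>\frac{m_j}2$ for $j=1,\dots,r$. (a) If $1\le q<\infty$, then $\Box^k$ is bounded from $A^{p,q}_\nu(T_\Omega)$ to $A^{p,q}_{\nu+kq\rho}(T_\Omega)$: there is a constant $C$ such that for every $f\in A^{p,q}_\nu(T_\Omega)$, $\Box^kf\in A^{p,q}_{\nu+kq\rho}(T_\Omega)$ and $\|\Box^kf\|_{A^{p,q}_{\nu+kq\rho}}\le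 C\,\|f\|_{A^{p,q}_\nu}$. (b) If $q=\infty$, the same holds with the target norm $\operatorname{ess\,sup}_{y\in\Omega}Q^{k\rho}(y)\,\|g(\cdot+iy)\|_{L^p(V)}$: there is a constant $C$ such that for every $f\in A^{p,\infty}_\nu(T_\Omega)$, $\Box^kf$ is holomorphic on $T_\Omega$ and $$\operatorname*{ess\,sup}_{y\in\Omega}Q^{k\rho}(y)\,\|\Box^kf(\cdot+iy)\|_{L^p(V)}\le C\operatorname*{ess\,sup}_{y\in\Omega}\|f(\cdot+iy)\|_{L^p(V)} .$$ -/

import Mathlib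

open MeasureTheory
open scoped ENNReal NNReal

noncomputable section

/-- A (real, not necessarily associative) matrix algebra of rank `r` with involution `star`:
`U` is the direct sum of subspaces `U i j` with `U i j * U j k ⊆ U i k` and `U i j * U l k = 0` for
`j ≠ l`, the involution maps `U i j` to `U j i`, every `U i i` is identified with the field of real
numbers by `rho i`, and `c i := (rho i)⁻¹ 1` is a left unit of every `U i j` and a right unit of
every `U j i` (so that `c i * c i = c i` and `U i i = ℝ (c i)`). -/
structure MatrixAlg (r : ℕ) (U : Type*) [NonUnitalNonAssocRing U] [Module ℝ U]
    [IsScalarTower ℝ U U] [SMulCommClass ℝ U U] [StarRing U] [StarModule ℝ U] where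
  comp : Fin r → Fin r → Submodule ℝ U
  isInternal : DirectSum.IsInternal (fun p : Fin r × Fin r => comp p.1 p.2)
  mul_mem : ∀ {i j k : Fin r} {x y : U}, x ∈ comp i j → y ∈ comp j k → x * y ∈ comp i k
  mul_zero_of_ne : ∀ {i j l k : Fin r} {x y : U}, j ≠ l → x ∈ comp i j → y ∈ comp l k → x * y = 0
  star_mem : ∀ {i j : Fin r} {x : U}, x ∈ comp i j → star x ∈ comp j i
  rho : (i : Fin r) → comp i i ≃ₗ[ℝ] ℝ
  c_mul : ∀ {i j : Fin r} {x : U}, x ∈ comp i j → ((rho i).symm 1 : U) * x = x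
  mul_c : ∀ {i j : Fin r} {x : U}, x ∈ comp i j → x * ((rho j).symm 1 : U) = x

namespace MatrixAlg

variable {r : ℕ} {U : Type*} [NonUnitalNonAssocRing U] [Module ℝ U]
  [IsScalarTower ℝ U U] [SMulCommClass ℝ U U] [StarRing U] [StarModule ℝ U]

/-- The identification of the direct sum of the `U i j` with `U`. -/
def decomp (A : MatrixAlg r U) :
    DirectSum (Fin r × Fin r) (fun p => A.comp p.1 p.2) ≃ₗ[ℝ] U :=
  LinearEquiv.ofBijective (DirectSum.coeLinearMap fun p : Fin r × Fin r => A.comp p.1 p.2)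
    A.isInternal

/-- The component `x i j` of `x` in `U i j`. -/
def entry (A : MatrixAlg r U) (i j : Fin r) : U →ₗ[ℝ] A.comp i j :=
  (DirectSum.component ℝ (Fin r × Fin r) (fun p => A.comp p.1 p.2) (i, j)) ∘ₗ
    A.decomp.symm.toLinearMap

/-- The real number `ρ (x i i)`. -/
def diag (A : MatrixAlg r U) (i : Fin r) : U →ₗ[ℝ] ℝ :=
  (A.rho i).toLinearMap ∘ₗ A.entry i i

/-- The trace `∑ i, ρ (x i i)`. -/
def tr (A : MatrixAlg r U) : U →ₗ[ℝ] ℝ := ∑ i, A.diag i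

/-- The upper triangular elements. -/
def upper (A : MatrixAlg r U) : Set U := {t | ∀ i j : Fin r, j < i → (A.entry i j t : U) = 0}

/-- The upper triangular elements with positive diagonal. -/
def H (A : MatrixAlg r U) : Set U := {t | t ∈ A.upper ∧ ∀ i, 0 < A.diag i t}

theorem decomp_apply (A : MatrixAlg r U)
    (v : DirectSum (Fin r × Fin r) (fun p => A.comp p.1 p.2)) :
    A.decomp v = DirectSum.coeLinearMap (fun p : Fin r × Fin r => A.comp p.1 p.2) v := rfl

theorem entry_of_mem (A : MatrixAlg r U) {i j : Fin r} {x : U} (hx : x ∈ A.comp i j)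
    (k l : Fin r) : (A.entry k l x : U) = if (i, j) = (k, l) then x else 0 := by
  have h : A.decomp.symm x =
      DirectSum.lof ℝ (Fin r × Fin r) (fun p => A.comp p.1 p.2) (i, j) ⟨x, hx⟩ := by
    rw [LinearEquiv.symm_apply_eq, decomp_apply, DirectSum.coeLinearMap_lof]
  simp only [entry, LinearMap.comp_apply, LinearEquiv.coe_coe, h]
  by_cases hp : (i, j) = (k, l)
  · obtain ⟨rfl, rfl⟩ := Prod.mk.inj hp
    simp [DirectSum.component.lof_self]
  · rw [DirectSum.component.of, dif_neg hp, if_neg hp]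
    rfl

theorem sum_entry (A : MatrixAlg r U) (x : U) :
    ∑ i, ∑ j, (A.entry i j x : U) = x := by
  classical
  have h := A.decomp.apply_symm_apply x
  rw [decomp_apply, DirectSum.coeLinearMap_eq_dfinsuppSum, DFinsupp.sum_eq_sum_fintype _ (by simp)]
    at h
  rw [← Fintype.sum_prod_type']
  exact h

theorem entry_star (A : MatrixAlg r U) (i j : Fin r) (x : U) :
    (A.entry i j (star x) : U) = star (A.entry j i x : U) := by
  conv_lhs => rw [← A.sum_entry x]
  simp only [star_sum, map_sum, Submodule.coe_sum,
    fun k l => A.entry_of_mem (A.star_mem (A.entry k l x).2) i j]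
  rw [Finset.sum_eq_single j, Finset.sum_eq_single i] <;> simp +contextual

theorem entry_mul (A : MatrixAlg r U) (i l : Fin r) (x y : U) :
    (A.entry i l (x * y) : U) = ∑ j, (A.entry i j x : U) * (A.entry j l y : U) := by
  have h : ∀ a b c d, (A.entry i l ((A.entry a b x : U) * (A.entry c d y : U)) : U) =
      if b = c ∧ a = i ∧ d = l then (A.entry a b x : U) * (A.entry c d y : U) else 0 := by
    intro a b c d
    by_cases hbc : b = c
    · subst hbc
      rw [A.entry_of_mem (A.mul_mem (A.entry a b x).2 (A.entry b d y).2)]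
      simp
    · rw [A.mul_zero_of_ne hbc (A.entry a b x).2 (A.entry c d y).2]
      simp [hbc]
  conv_lhs => rw [← A.sum_entry x, ← A.sum_entry y]
  simp only [Finset.sum_mul, Finset.mul_sum, map_sum, Submodule.coe_sum, h]
  simp only [ite_and]
  simp

theorem entry_diag (A : MatrixAlg r U) (i : Fin r) (x : U) :
    (A.entry i i x : U) = A.diag i x • ((A.rho i).symm 1 : U) := by
  rw [← Submodule.coe_smul, ← map_smul]
  simp [diag]

theorem star_unit (A : MatrixAlg r U) (i : Fin r) :
    star ((A.rho i).symm 1 : U) = ((A.rho i).symm 1 : U) := by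
  set c : U := ((A.rho i).symm 1 : U) with hc
  have hm : c ∈ A.comp i i := ((A.rho i).symm 1).2
  have h1 : c * star c = star c := A.c_mul (A.star_mem hm)
  have h2 := congrArg star h1
  rw [star_mul, star_star] at h2
  rw [← h1, h2]

theorem entry_diag_star (A : MatrixAlg r U) (i : Fin r) (x : U) :
    star (A.entry i i x : U) = A.diag i x • ((A.rho i).symm 1 : U) := by
  rw [entry_diag, star_smul, star_unit, star_trivial]

theorem unit_ne_zero (A : MatrixAlg r U) (i : Fin r) : ((A.rho i).symm 1 : U) ≠ 0 := by
  simp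

theorem pos_eq (A : MatrixAlg r U) {i : Fin r} {a d : ℝ} (ha : 0 < a) (hd : 0 < d)
    (h : a • a • ((A.rho i).symm 1 : U) = d • d • ((A.rho i).symm 1 : U)) : a = d := by
  rw [smul_smul, smul_smul] at h
  have := smul_left_injective ℝ (A.unit_ne_zero i) h
  nlinarith [mul_self_inj_of_nonneg ha.le hd.le |>.1 this]

/-- The decomposition `y = t t⋆` with `t ∈ H` is unique. -/
theorem H_unique (A : MatrixAlg r U) {s t : U} (hs : s ∈ A.H) (ht : t ∈ A.H)
    (h : s * star s = t * star t) : s = t := by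
  have key : ∀ j : Fin r, ∀ i, (A.entry i j s : U) = A.entry i j t := by
    intro j
    induction j using WellFoundedGT.induction with
    | ind j ih =>
      have eq : ∀ i, (A.entry i j s : U) * star (A.entry j j s : U) =
          (A.entry i j t : U) * star (A.entry j j t : U) := by
        intro i
        have h' := congrArg (fun x => (A.entry i j x : U)) h
        simp only [entry_mul, entry_star] at h'
        rw [← Finset.add_sum_erase _ _ (Finset.mem_univ j),
          ← Finset.add_sum_erase _ _ (Finset.mem_univ j)] at h'
        have hsum : ∑ k ∈ Finset.univ.erase j, (A.entry i k s : U) * star (A.entry j k s : U) =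
            ∑ k ∈ Finset.univ.erase j, (A.entry i k t : U) * star (A.entry j k t : U) := by
          refine Finset.sum_congr rfl fun k hk => ?_
          rcases lt_or_gt_of_ne (Finset.ne_of_mem_erase hk) with hlt | hgt
          · rw [hs.1 j k hlt, ht.1 j k hlt]; simp
          · rw [ih k hgt, ih k hgt]
        rw [hsum] at h'
        exact add_right_cancel h'
      have hd : A.diag j s = A.diag j t := by
        have := eq j
        rw [entry_diag_star, entry_diag_star, mul_smul_comm, mul_smul_comm,
          A.mul_c (A.entry j j s).2, A.mul_c (A.entry j j t).2, entry_diag, entry_diag] at this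
        exact A.pos_eq (hs.2 j) (ht.2 j) this
      intro i
      have := eq i
      rw [entry_diag_star, entry_diag_star, mul_smul_comm, mul_smul_comm,
        A.mul_c (A.entry i j s).2, A.mul_c (A.entry i j t).2, hd] at this
      exact smul_right_injective U (ht.2 j).ne' this
  rw [← A.sum_entry s, ← A.sum_entry t]
  simp only [key]

/-- The decomposition `ξ = t⋆ t` with `t ∈ H` is unique. -/
theorem H_star_unique (A : MatrixAlg r U) {s t : U} (hs : s ∈ A.H) (ht : t ∈ A.H)
    (h : star s * s = star t * t) : s = t := by
  have key : ∀ i : Fin r, ∀ j, (A.entry i j s : U) = A.entry i j t := by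
    intro i
    induction i using WellFoundedLT.induction with
    | ind i ih =>
      have eq : ∀ j, star (A.entry i i s : U) * (A.entry i j s : U) =
          star (A.entry i i t : U) * (A.entry i j t : U) := by
        intro j
        have h' := congrArg (fun x => (A.entry i j x : U)) h
        simp only [entry_mul, entry_star] at h'
        rw [← Finset.add_sum_erase _ _ (Finset.mem_univ i),
          ← Finset.add_sum_erase _ _ (Finset.mem_univ i)] at h'
        have hsum : ∑ k ∈ Finset.univ.erase i, star (A.entry k i s : U) * (A.entry k j s : U) =
            ∑ k ∈ Finset.univ.erase i, star (A.entry k i t : U) * (A.entry k j t : U) := by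
          refine Finset.sum_congr rfl fun k hk => ?_
          rcases lt_or_gt_of_ne (Finset.ne_of_mem_erase hk) with hlt | hgt
          · rw [ih k hlt, ih k hlt]
          · rw [hs.1 k i hgt, ht.1 k i hgt]; simp
        rw [hsum] at h'
        exact add_right_cancel h'
      have hd : A.diag i s = A.diag i t := by
        have := eq i
        rw [entry_diag_star, entry_diag_star, smul_mul_assoc, smul_mul_assoc,
          A.c_mul (A.entry i i s).2, A.c_mul (A.entry i i t).2, entry_diag, entry_diag] at this
        exact A.pos_eq (hs.2 i) (ht.2 i) this
      intro j
      have := eq j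
      rw [entry_diag_star, entry_diag_star, smul_mul_assoc, smul_mul_assoc,
        A.c_mul (A.entry i j s).2, A.c_mul (A.entry i j t).2, hd] at this
      exact smul_right_injective U (ht.2 i).ne' this
  rw [← A.sum_entry s, ← A.sum_entry t]
  simp only [key]

end MatrixAlg

/-- A T-algebra of rank `r` (Vinberg's axioms, for the trace `∑ i, ρ (x i i)`). -/
structure TAlgebra (r : ℕ) (U : Type*) [NonUnitalNonAssocRing U] [Module ℝ U]
    [IsScalarTower ℝ U U] [SMulCommClass ℝ U U] [StarRing U] [StarModule ℝ U]
    extends MatrixAlg r U where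
  tr_mul_comm : ∀ x y : U, toMatrixAlg.tr (x * y) = toMatrixAlg.tr (y * x)
  tr_mul_assoc : ∀ x y z : U, toMatrixAlg.tr (x * (y * z)) = toMatrixAlg.tr ((x * y) * z)
  tr_mul_star_pos : ∀ x : U, x ≠ 0 → 0 < toMatrixAlg.tr (x * star x)
  upper_assoc : ∀ {t u w : U}, t ∈ toMatrixAlg.upper → u ∈ toMatrixAlg.upper →
    w ∈ toMatrixAlg.upper → t * (u * w) = (t * u) * w
  upper_mul_star : ∀ {t u : U}, t ∈ toMatrixAlg.upper → u ∈ toMatrixAlg.upper →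
    t * (u * star u) = (t * u) * star u

namespace TAlgebra

variable {r n : ℕ} {U : Type*} [NonUnitalNonAssocRing U] [Module ℝ U]
  [IsScalarTower ℝ U U] [SMulCommClass ℝ U U] [StarRing U] [StarModule ℝ U]

/-- `m i`, the sum over `j > i` of `dim (U i j)`. -/
def m (T : TAlgebra r U) (i : Fin r) : ℕ := ∑ j ∈ Finset.Ioi i, Module.finrank ℝ (T.comp i j)

/-- `n i`, the sum over `j < i` of `dim (U j i)`. -/
def lowerDim (T : TAlgebra r U) (i : Fin r) : ℕ :=
  ∑ j ∈ Finset.Iio i, Module.finrank ℝ (T.comp j i)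

/-- `τ i = 1 + (m i + n i) / 2`. -/
def tau (T : TAlgebra r U) (i : Fin r) : ℝ := 1 + ((T.m i : ℝ) + (T.lowerDim i : ℝ)) / 2

/-- The homogeneous cone `Ω = {s s⋆ : s ∈ H}`. -/
def cone (T : TAlgebra r U) : Set U := {y | ∃ s ∈ T.H, s * star s = y}

/-- The dual cone `Ω⋆ = {t⋆ t : t ∈ H}`. -/
def dualCone (T : TAlgebra r U) : Set U := {ξ | ∃ t ∈ T.H, star t * t = ξ}

open Classical in
/-- `Q j (y) = ρ (t j j) ^ 2` for `y = t t⋆ ∈ Ω`, `t ∈ H` (and `0` off the cone). -/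
def Q (T : TAlgebra r U) (j : Fin r) (y : U) : ℝ :=
  if h : y ∈ T.cone then T.diag j h.choose ^ 2 else 0

open Classical in
/-- `Q⋆ j (ξ) = ρ (t j j) ^ 2` for `ξ = t⋆ t ∈ Ω⋆`, `t ∈ H` (and `0` off the dual cone). -/
def Qstar (T : TAlgebra r U) (j : Fin r) (ξ : U) : ℝ :=
  if h : ξ ∈ T.dualCone then T.diag j h.choose ^ 2 else 0

/-- `Q j` is well defined. -/
theorem Q_mul_star (T : TAlgebra r U) (j : Fin r) {t : U} (ht : t ∈ T.H) :
    T.Q j (t * star t) = T.diag j t ^ 2 := by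
  have h : t * star t ∈ T.cone := ⟨t, ht, rfl⟩
  rw [Q, dif_pos h, T.H_unique h.choose_spec.1 ht h.choose_spec.2]

/-- `Q⋆ j` is well defined. -/
theorem Qstar_star_mul (T : TAlgebra r U) (j : Fin r) {t : U} (ht : t ∈ T.H) :
    T.Qstar j (star t * t) = T.diag j t ^ 2 := by
  have h : star t * t ∈ T.dualCone := ⟨t, ht, rfl⟩
  rw [Qstar, dif_pos h, T.H_star_unique h.choose_spec.1 ht h.choose_spec.2]

/-- The compound power `Q ^ α`. -/
def Qpow (T : TAlgebra r U) (α : Fin r → ℝ) (y : U) : ℝ := ∏ j, T.Q j y ^ α j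

/-- The compound power `(Q⋆) ^ α`. -/
def QstarPow (T : TAlgebra r U) (α : Fin r → ℝ) (ξ : U) : ℝ := ∏ j, T.Qstar j ξ ^ α j

/-- A basis of the space `V` of Hermitian elements is orthonormal for `(x | y) = tr (x y⋆)`. Such a
basis identifies `V` with `Fin n → ℝ` and its complexification with `Fin n → ℂ`. -/
def IsOrthonormal (T : TAlgebra r U) (b : Module.Basis (Fin n) ℝ (selfAdjoint.submodule ℝ U)) :
    Prop :=
  ∀ i j, T.tr ((b i : U) * star (b j : U)) = if i = j then 1 else 0

/-- The element of `V` with coordinates `x`. -/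
def vec (b : Module.Basis (Fin n) ℝ (selfAdjoint.submodule ℝ U)) (x : Fin n → ℝ) : U :=
  ((∑ j, x j • b j : selfAdjoint.submodule ℝ U) : U)

/-- The cone `Ω` in coordinates. -/
def coneSet (T : TAlgebra r U) (b : Module.Basis (Fin n) ℝ (selfAdjoint.submodule ℝ U)) :
    Set (Fin n → ℝ) := {y | vec b y ∈ T.cone}

/-- The tube domain `V + i Ω` in coordinates. -/
def tube (T : TAlgebra r U) (b : Module.Basis (Fin n) ℝ (selfAdjoint.submodule ℝ U)) :
    Set (Fin n → ℂ) := {z | (fun j => (z j).im) ∈ T.coneSet b}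

/-- The point `x + i y`. -/
def cpt (x y : Fin n → ℝ) : Fin n → ℂ := fun j => (x j : ℂ) + (y j : ℂ) * Complex.I

/-- The measure `Q ^ (ν - τ) (y) dy` on the cone. -/
def coneMeasure (T : TAlgebra r U) (b : Module.Basis (Fin n) ℝ (selfAdjoint.submodule ℝ U))
    (ν : Fin r → ℝ) : Measure (Fin n → ℝ) :=
  (volume.restrict (T.coneSet b)).withDensity
    (fun y => ENNReal.ofReal (T.Qpow (fun j => ν j - T.tau j) (vec b y)))

/-- The mixed norm of `L^{p,q}_ν (T_Ω)`: the `L^q` norm, for `Q ^ (ν - τ) (y) dy` on `Ω`, of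
`y ↦ ‖f (· + i y)‖_p`. -/
def mixedNorm (T : TAlgebra r U) (b : Module.Basis (Fin n) ℝ (selfAdjoint.submodule ℝ U))
    (p q : ℝ≥0∞) (ν : Fin r → ℝ) (f : (Fin n → ℂ) → ℂ) : ℝ≥0∞ :=
  eLpNorm (fun y : Fin n → ℝ => eLpNorm (fun x : Fin n → ℝ => f (cpt x y)) p volume) q
    (T.coneMeasure b ν)

/-- The weighted mixed norm Bergman space `A^{p,q}_ν (T_Ω)`. -/
def bergman (T : TAlgebra r U) (b : Module.Basis (Fin n) ℝ (selfAdjoint.submodule ℝ U))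
    (p q : ℝ≥0∞) (ν : Fin r → ℝ) : Set ((Fin n → ℂ) → ℂ) :=
  {f | DifferentiableOn ℂ f (T.tube b) ∧ T.mixedNorm b p q ν f < ∞}

/-- The function `x + i y ↦ Q ^ κ (y) f (x + i y)`. -/
def weightMul (T : TAlgebra r U) (b : Module.Basis (Fin n) ℝ (selfAdjoint.submodule ℝ U))
    (κ : Fin r → ℝ) (f : (Fin n → ℂ) → ℂ) : (Fin n → ℂ) → ℂ :=
  fun z => (T.Qpow κ (vec b (fun j => (z j).im)) : ℂ) * f z

/-- `ρ` is an `Ω`-integral vector: its entries are positive and `(Q⋆) ^ ρ` is (on `Ω⋆`) a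
polynomial. -/
def IsIntegralVector (T : TAlgebra r U) (b : Module.Basis (Fin n) ℝ (selfAdjoint.submodule ℝ U))
    (ρ : Fin r → ℝ) : Prop :=
  (∀ j, 0 < ρ j) ∧ ∃ P : MvPolynomial (Fin n) ℝ, ∀ ξ : Fin n → ℝ, vec b ξ ∈ T.dualCone →
    MvPolynomial.eval ξ P = T.QstarPow ρ (vec b ξ)

end TAlgebra

/-- The complex partial derivative `∂ f / ∂ z_j`. -/
def partialDeriv {n : ℕ} (j : Fin n) (f : (Fin n → ℂ) → ℂ) : (Fin n → ℂ) → ℂ :=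
  fun z => fderiv ℂ f z (Pi.single j 1)

/-- The iterated partial derivative `∂ ^ α f`, `α` a multi-index. -/
def multiDeriv {n : ℕ} (α : Fin n →₀ ℕ) (f : (Fin n → ℂ) → ℂ) : (Fin n → ℂ) → ℂ :=
  (List.finRange n).foldr (fun j g => (partialDeriv j)^[α j] g) f

/-- The differential operator `P (-i ∂)` with constant coefficients and symbol `P`. -/
def symbolOp {n : ℕ} (P : MvPolynomial (Fin n) ℝ) (f : (Fin n → ℂ) → ℂ) : (Fin n → ℂ) → ℂ :=
  fun z => ∑ α ∈ P.support,
    ((P.coeff α : ℝ) : ℂ) * (-Complex.I) ^ (∑ j, α j) * multiDeriv α f z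

/-- Exponentials are eigenfunctions of `P (-i ∂)`. -/
theorem symbolOp_exp {n : ℕ} (P : MvPolynomial (Fin n) ℝ) (ξ : Fin n → ℝ) (z : Fin n → ℂ) :
    symbolOp P (fun z => Complex.exp (Complex.I * ∑ j, z j * ξ j)) z =
      (MvPolynomial.eval ξ P : ℂ) * Complex.exp (Complex.I * ∑ j, z j * ξ j) := by
  set E : (Fin n → ℂ) → ℂ := fun z => Complex.exp (Complex.I * ∑ j, z j * ξ j) with hE
  have h1 : ∀ (j : Fin n) (c : ℂ), partialDeriv j (fun z => c * E z) =
      fun z => (Complex.I * ξ j * c) * E z := by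
    intro j c
    funext w
    have hd : HasFDerivAt (fun z : Fin n → ℂ => Complex.I * ∑ j, z j * (ξ j : ℂ))
        (Complex.I • ∑ j, (ξ j : ℂ) • ContinuousLinearMap.proj (R := ℂ) (φ := fun _ : Fin n => ℂ) j)
        w := by
      apply HasFDerivAt.const_mul
      apply HasFDerivAt.fun_sum
      intro i _
      exact (hasFDerivAt_apply i w).mul_const _
    have := (hd.cexp.const_mul c).fderiv
    simp only [partialDeriv, hE]
    rw [this]
    simp [Pi.single_apply]
    ring
  have h2 : ∀ (j : Fin n) (a : ℕ) (c : ℂ), (partialDeriv j)^[a] (fun z => c * E z) =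
      fun z => ((Complex.I * ξ j) ^ a * c) * E z := by
    intro j a
    induction a with
    | zero => intro c; simp
    | succ a ih => intro c; rw [Function.iterate_succ_apply, h1, ih]; funext w; ring
  have h3 : ∀ (α : Fin n →₀ ℕ) (l : List (Fin n)),
      l.foldr (fun j g => (partialDeriv j)^[α j] g) E =
        fun z => (l.map fun j => (Complex.I * ξ j) ^ α j).prod * E z := by
    intro α l
    induction l with
    | nil => funext w; simp
    | cons a l ih => rw [List.foldr_cons, ih, h2]; funext w; simp
  have h4 : ∀ α : Fin n →₀ ℕ, multiDeriv α E z =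
      (Complex.I ^ (∑ j, α j) * ∏ j, (ξ j : ℂ) ^ α j) * E z := by
    intro α
    have : ((List.finRange n).map fun j => (Complex.I * (ξ j : ℂ)) ^ α j).prod =
        ∏ j, (Complex.I * (ξ j : ℂ)) ^ α j := by
      rw [Fin.prod_univ_def]
    rw [multiDeriv, h3, this]
    simp only [mul_pow, Finset.prod_mul_distrib, Finset.prod_pow_eq_pow_sum]
  change ∑ α ∈ P.support, _ * multiDeriv α E z = _ * E z
  rw [MvPolynomial.eval_eq']
  push_cast
  rw [Finset.sum_mul]
  refine Finset.sum_congr rfl fun α _ => ?_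
  rw [h4]
  have hI : (-Complex.I) ^ (∑ j, α j) * Complex.I ^ (∑ j, α j) = 1 := by
    rw [← mul_pow]; simp
  linear_combination ((P.coeff α : ℝ) : ℂ) * (∏ j, (ξ j : ℂ) ^ α j) * E z * hI

namespace TAlgebra

variable {r n : ℕ} {U : Type*} [NonUnitalNonAssocRing U] [Module ℝ U]
  [IsScalarTower ℝ U U] [SMulCommClass ℝ U U] [StarRing U] [StarModule ℝ U]

/-- The Box operator: the differential operator with constant coefficients whose symbol is the
polynomial `(Q⋆) ^ ρ`, that is, `Box e^{i(z|ξ)} = (Q⋆) ^ ρ (ξ) e^{i(z|ξ)}` (see `box_exp`). -/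
def box (T : TAlgebra r U) (b : Module.Basis (Fin n) ℝ (selfAdjoint.submodule ℝ U))
    {ρ : Fin r → ℝ} (hρ : T.IsIntegralVector b ρ) (f : (Fin n → ℂ) → ℂ) : (Fin n → ℂ) → ℂ :=
  symbolOp hρ.2.choose f

/-- The defining property of the Box operator. -/
theorem box_exp (T : TAlgebra r U) (b : Module.Basis (Fin n) ℝ (selfAdjoint.submodule ℝ U))
    {ρ : Fin r → ℝ} (hρ : T.IsIntegralVector b ρ) (ξ : Fin n → ℝ) (hξ : vec b ξ ∈ T.dualCone)
    (z : Fin n → ℂ) :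
    T.box b hρ (fun z => Complex.exp (Complex.I * ∑ j, z j * ξ j)) z =
      (T.QstarPow ρ (vec b ξ) : ℂ) * Complex.exp (Complex.I * ∑ j, z j * ξ j) := by
  rw [← hρ.2.choose_spec ξ hξ]
  exact symbolOp_exp _ _ _

end TAlgebra

end

/-! The proof moves a local estimate at one point of `Ω` to every other point by homogeneity. Each
`y = t t⋆` gives a linear automorphism `A_y` of the cone (`trans`), induced by `u u⋆ ↦ (t u)(t u)⋆`.
It sends the base point `e`, which is the unit of the algebra, to `y`. Its transpose sends `s⋆ s` to
`(s t)⋆ (s t)`, so the symbol of `Box` satisfies `P(A_yᵀ ξ) = Q^ρ(y) P(ξ)` on the dual cone. The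
dual cone has interior points, so this is an identity of polynomials (`compTranspose_trans`). Hence
`Box^k (f ∘ A_y) = Q^ρ(y)^k (Box^k f) ∘ A_y` on the tube (`box_iterate_comp_cmul`).

Near `e` only Cauchy's formula is needed. On a circle in a real direction `v`, the point `x + i y +
e^{iθ} v` has real part `x + cos θ v` and imaginary part `y + sin θ v`. The real shift does not
change `L^p` norms, so Minkowski's inequality turns the Cauchy and mean value formulas into
inequalities between slice norms. Derivatives are thus controlled by a supremum over a larger ball,
and the supremum by an average (`volume_ball_mul_sliceNorm_le`). Applied to `f ∘ A_y`, this gives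
for all `y` in `Ω`, with one constant, `Q^ρ(y)^k ‖Box^k f(· + i y)‖_p ≤ C ∫_{B(e,δ)} ‖f(· + i A_y
v)‖_p dv` (`exists_sliceNorm_box_le`). The factor `|det A_y|^{-1/p}` from the change of variable in
`x` occurs on both sides and cancels.

For `q = ∞` this is already the claim. For `q < ∞`, Jensen's inequality brings the power `q` inside
the average, and it remains to bound the averaging operator on weighted `L¹`. If `x = A_y v`, then
`A_x = A_y A_v`, while `Q^α` and the determinant are multiplicative. With `v` in a compact ball the
weights at `x` and `y` are therefore comparable, and the set of `y` that reach a given `x` has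
volume `O(|det A_x|)`. Tonelli's theorem then concludes (`lintegral_kernel_le`). -/

noncomputable section

set_option linter.unusedSectionVars false

/-! ### Holomorphic functions of several variables: Cauchy formula and symmetry of derivatives -/

section SeveralComplexVariables

open Set Metric Filter Topology

/-- The Cauchy formula for a directional derivative. -/
theorem fderiv_apply_eq_integral {E : Type*} [NormedAddCommGroup E] [NormedSpace ℂ E]
    {D : Set E} (hD : IsOpen D) {f : E → ℂ} (hf : DifferentiableOn ℂ f D) {z v : E}
    (hv : ∀ w : ℂ, ‖w‖ ≤ 1 → z + w • v ∈ D) :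
    fderiv ℂ f z v = (2 * Real.pi : ℂ)⁻¹ *
      ∫ θ in (0 : ℝ)..2 * Real.pi, (circleMap 0 1 θ)⁻¹ * f (z + circleMap 0 1 θ • v) := by
  have hz : z ∈ D := by simpa using hv 0 (by simp)
  have hline : ∀ w : ℂ, HasDerivAt (fun w : ℂ => z + w • v) v w := fun w => by
    simpa using ((hasDerivAt_id w).smul_const v).const_add z
  have hdiff : DifferentiableOn ℂ (fun w : ℂ => f (z + w • v)) (closedBall 0 1) := by
    intro w hw
    have hw' : z + w • v ∈ D := hv w (by simpa using hw)
    exact ((hf.differentiableAt (hD.mem_nhds hw')).comp w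
      (hline w).differentiableAt).differentiableWithinAt
  have hder : deriv (fun w : ℂ => f (z + w • v)) 0 = fderiv ℂ f z v := by
    have h0 : HasFDerivAt f (fderiv ℂ f z) (z + (0 : ℂ) • v) := by
      simpa using (hf.differentiableAt (hD.mem_nhds hz)).hasFDerivAt
    exact (h0.comp_hasDerivAt (0 : ℂ) (hline 0)).deriv
  have key := hdiff.deriv_eq_smul_circleIntegral one_pos
  rw [hder, circleIntegral] at key
  have hint : ∀ θ : ℝ, deriv (circleMap 0 1) θ • (1 / (circleMap 0 1 θ - 0) ^ 2) •
      f (z + circleMap 0 1 θ • v) =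
      Complex.I * ((circleMap 0 1 θ)⁻¹ * f (z + circleMap 0 1 θ • v)) := by
    intro θ
    have : circleMap 0 1 θ ≠ 0 := circleMap_ne_center one_ne_zero
    simp only [deriv_circleMap, smul_eq_mul, sub_zero]
    field_simp
  rw [intervalIntegral.integral_congr (fun θ _ => hint θ), smul_eq_mul,
    intervalIntegral.integral_const_mul] at key
  have hpi : (Real.pi : ℂ) ≠ 0 := by exact_mod_cast Real.pi_ne_zero
  have hI := Complex.I_ne_zero
  rw [eq_inv_mul_iff_mul_eq₀ (by simp [hpi])]
  apply mul_left_cancel₀ hI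
  rw [key]
  ring

/-- Cauchy's estimate on the complex line through `z` in each direction. It supplies the dominating
constant for differentiating under the circle integral. -/
theorem norm_fderiv_le_of_forall_closedBall {E : Type*} [NormedAddCommGroup E] [NormedSpace ℂ E]
    {D : Set E} (hD : IsOpen D) {f : E → ℂ} (hf : DifferentiableOn ℂ f D) {z : E} {r M : ℝ}
    (hr : 0 < r) (hM : 0 ≤ M) (hz : closedBall z r ⊆ D) (hb : ∀ w ∈ closedBall z r, ‖f w‖ ≤ M) :
    ‖fderiv ℂ f z‖ ≤ M / r := by
  refine ContinuousLinearMap.opNorm_le_bound _ (by positivity) fun x => ?_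
  rcases eq_or_ne x 0 with rfl | hx
  · simp
  have hx' : 0 < ‖x‖ := norm_pos_iff.2 hx
  set v : E := ((r / ‖x‖ : ℝ) : ℂ) • x with hv
  have hvn : ‖v‖ = r := by
    rw [hv, norm_smul, Complex.norm_real, Real.norm_of_nonneg (by positivity)]
    field_simp
  have hmem : ∀ w : ℂ, ‖w‖ ≤ 1 → z + w • v ∈ closedBall z r := fun w hw => by
    simp only [mem_closedBall, dist_self_add_left, norm_smul, hvn]
    nlinarith
  have h1 := Complex.norm_deriv_le_of_forall_mem_sphere_norm_le (f := fun w : ℂ => f (z + w • v))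
    (c := 0) (R := 1) (C := M) one_pos ?_ ?_
  · have hder : deriv (fun w : ℂ => f (z + w • v)) 0 = fderiv ℂ f z v := by
      have h0 : HasFDerivAt f (fderiv ℂ f z) (z + (0 : ℂ) • v) := by
        simpa using (hf.differentiableAt
          (hD.mem_nhds (hz (mem_closedBall_self hr.le)))).hasFDerivAt
      have hline : HasDerivAt (fun w : ℂ => z + w • v) v 0 := by
        simpa using ((hasDerivAt_id (0 : ℂ)).smul_const v).const_add z
      exact (h0.comp_hasDerivAt (0 : ℂ) hline).deriv
    rw [hder, hv, map_smul, norm_smul, Complex.norm_real,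
      Real.norm_of_nonneg (by positivity), div_one] at h1
    calc ‖fderiv ℂ f z x‖ = (r / ‖x‖ * ‖fderiv ℂ f z x‖) * (‖x‖ / r) := by field_simp
      _ ≤ M * (‖x‖ / r) := by gcongr
      _ = M / r * ‖x‖ := by ring
  · have : DifferentiableOn ℂ (fun w : ℂ => f (z + w • v)) (closedBall 0 1) := by
      intro w hw
      have hw' : z + w • v ∈ D := hz (hmem w (by simpa using hw))
      exact ((hf.differentiableAt (hD.mem_nhds hw')).comp w
        (by fun_prop)).differentiableWithinAt
    exact (this.mono closure_ball_subset_closedBall).diffContOnCl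
  · intro w hw
    exact hb _ (hmem w (by simpa using (mem_sphere_iff_norm.1 hw).le))

/-- Directional derivatives of holomorphic functions are holomorphic. -/
theorem differentiableOn_fderiv_apply {n : ℕ} {D : Set (Fin n → ℂ)} (hD : IsOpen D)
    {f : (Fin n → ℂ) → ℂ} (hf : DifferentiableOn ℂ f D) (v : Fin n → ℂ) :
    DifferentiableOn ℂ (fun z => fderiv ℂ f z v) D := by
  intro z₀ hz₀
  obtain ⟨R, hR, hRD⟩ := Metric.nhds_basis_closedBall.mem_iff.1 (hD.mem_nhds hz₀)
  -- One third each for the centre `z`, the displacement along the circle, and the ball on which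
  -- Cauchy's estimate is applied.
  set r : ℝ := R / 3 with hr
  have hrpos : 0 < r := by positivity
  obtain ⟨M, hM⟩ := (isCompact_closedBall z₀ R).exists_bound_of_continuousOn
    (hf.continuousOn.mono hRD)
  have hM0 : 0 ≤ M := (norm_nonneg _).trans (hM z₀ (mem_closedBall_self hR.le))
  -- The direction is rescaled to length at most `r`; the `+ 1` covers `v = 0`.
  set c : ℝ := r / (‖v‖ + 1) with hc
  have hcpos : 0 < c := by positivity
  set v' : Fin n → ℂ := (c : ℂ) • v with hv'
  have hv'n : ‖v'‖ ≤ r := by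
    rw [hv', norm_smul, Complex.norm_real, Real.norm_of_nonneg hcpos.le, hc, div_mul_eq_mul_div,
      div_le_iff₀ (by positivity)]
    nlinarith [norm_nonneg v]
  have hsub : ∀ z ∈ ball z₀ r, ∀ w : ℂ, ‖w‖ ≤ 1 → closedBall (z + w • v') r ⊆ closedBall z₀ R := by
    intro z hz w hw
    apply closedBall_subset_closedBall'
    have h1 : dist (z + w • v') z ≤ r := by
      rw [dist_self_add_left, norm_smul]; nlinarith [norm_nonneg v', norm_nonneg w]
    have h2 := dist_triangle (z + w • v') z z₀
    have h3 := mem_ball.1 hz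
    linarith
  have hmem : ∀ z ∈ ball z₀ r, ∀ w : ℂ, ‖w‖ ≤ 1 → z + w • v' ∈ D := fun z hz w hw =>
    hRD (hsub z hz w hw (mem_closedBall_self hrpos.le))
  have hformula : ∀ z ∈ ball z₀ r, fderiv ℂ f z v = (c : ℂ)⁻¹ * ((2 * Real.pi : ℂ)⁻¹ *
      ∫ θ in (0 : ℝ)..2 * Real.pi, (circleMap 0 1 θ)⁻¹ * f (z + circleMap 0 1 θ • v')) := by
    intro z hz
    rw [← fderiv_apply_eq_integral hD hf (hmem z hz), hv', map_smul, smul_eq_mul,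
      inv_mul_cancel_left₀ (by exact_mod_cast hcpos.ne')]
  have hcirc : ∀ θ : ℝ, ‖circleMap 0 1 θ‖ ≤ 1 := fun θ => by simp
  have hcont : ∀ z ∈ ball z₀ r,
      Continuous fun θ : ℝ => (circleMap 0 1 θ)⁻¹ * f (z + circleMap 0 1 θ • v') := by
    intro z hz
    refine Continuous.mul ((continuous_circleMap 0 1).inv₀ fun θ =>
      circleMap_ne_center one_ne_zero) ?_
    refine hf.continuousOn.comp_continuous (by fun_prop) fun θ => hmem z hz _ (hcirc θ)
  have hmain : HasFDerivAt (fun z => ∫ θ in (0 : ℝ)..2 * Real.pi,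
      (circleMap 0 1 θ)⁻¹ * f (z + circleMap 0 1 θ • v'))
      (∫ θ in (0 : ℝ)..2 * Real.pi,
        (circleMap 0 1 θ)⁻¹ • fderiv ℂ f (z₀ + circleMap 0 1 θ • v')) z₀ := by
    refine intervalIntegral.hasFDerivAt_integral_of_dominated_of_fderiv_le
      (F' := fun z θ => (circleMap 0 1 θ)⁻¹ • fderiv ℂ f (z + circleMap 0 1 θ • v'))
      (bound := fun _ => M / r) (ball_mem_nhds z₀ hrpos) ?_ ?_ ?_ ?_ ?_ ?_
    · filter_upwards [ball_mem_nhds z₀ hrpos] with z hz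
      exact (hcont z hz).aestronglyMeasurable
    · exact (hcont z₀ (mem_ball_self hrpos)).intervalIntegrable _ _
    · refine Measurable.aestronglyMeasurable ?_
      refine Measurable.smul (continuous_circleMap 0 1).measurable.inv ?_
      exact (measurable_fderiv ℂ f).comp (by fun_prop)
    · refine ae_of_all _ fun θ _ z hz => ?_
      rw [norm_smul, norm_inv, norm_circleMap_zero, abs_one, inv_one, one_mul]
      exact norm_fderiv_le_of_forall_closedBall hD hf hrpos hM0
        ((hsub z hz _ (hcirc θ)).trans hRD) fun w hw => hM w (hsub z hz _ (hcirc θ) hw)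
    · exact intervalIntegrable_const
    · refine ae_of_all _ fun θ _ z hz => ?_
      have h1 : HasFDerivAt f (fderiv ℂ f (z + circleMap 0 1 θ • v')) (z + circleMap 0 1 θ • v') :=
        (hf.differentiableAt (hD.mem_nhds (hmem z hz _ (hcirc θ)))).hasFDerivAt
      have h2 : HasFDerivAt (fun z : Fin n → ℂ => z + circleMap 0 1 θ • v')
          (ContinuousLinearMap.id ℂ _) z := (hasFDerivAt_id z).add_const _
      have h3 := h1.comp z h2
      rw [ContinuousLinearMap.comp_id] at h3
      exact h3.const_mul _
  have hev : (fun z => fderiv ℂ f z v) =ᶠ[𝓝 z₀] fun z => (c : ℂ)⁻¹ * ((2 * Real.pi : ℂ)⁻¹ *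
      ∫ θ in (0 : ℝ)..2 * Real.pi, (circleMap 0 1 θ)⁻¹ * f (z + circleMap 0 1 θ • v')) := by
    filter_upwards [ball_mem_nhds z₀ hrpos] with z hz using hformula z hz
  exact (((hmain.differentiableAt.const_mul _).const_mul _).congr_of_eventuallyEq
    hev).differentiableWithinAt

theorem differentiableOn_partialDeriv {n : ℕ} {D : Set (Fin n → ℂ)} (hD : IsOpen D)
    {f : (Fin n → ℂ) → ℂ} (hf : DifferentiableOn ℂ f D) (j : Fin n) :
    DifferentiableOn ℂ (partialDeriv j f) D := differentiableOn_fderiv_apply hD hf _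

/-- Differential operators act here on functions defined everywhere, while identities hold only on
`D`. Openness of `D` makes such identities stable under differentiation. -/
theorem partialDeriv_congr {n : ℕ} {D : Set (Fin n → ℂ)} (hD : IsOpen D)
    {f g : (Fin n → ℂ) → ℂ} (hfg : EqOn f g D) (j : Fin n) :
    EqOn (partialDeriv j f) (partialDeriv j g) D := fun z hz => by
  have : f =ᶠ[𝓝 z] g := by filter_upwards [hD.mem_nhds hz] with w hw using hfg hw
  simp only [partialDeriv, this.fderiv_eq]

theorem fderiv_eq_sum_partialDeriv {n : ℕ} (f : (Fin n → ℂ) → ℂ) (z v : Fin n → ℂ) :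
    fderiv ℂ f z v = ∑ i, v i * partialDeriv i f z := by
  conv_lhs => rw [pi_eq_sum_univ' v]
  simp only [map_sum, map_smul, smul_eq_mul, partialDeriv]

theorem differentiableOn_fderiv {n : ℕ} {D : Set (Fin n → ℂ)} (hD : IsOpen D)
    {f : (Fin n → ℂ) → ℂ} (hf : DifferentiableOn ℂ f D) :
    DifferentiableOn ℂ (fderiv ℂ f) D := by
  have : fderiv ℂ f = fun z => ∑ i, partialDeriv i f z •
      (ContinuousLinearMap.proj (R := ℂ) (φ := fun _ : Fin n => ℂ) i) := by
    funext z
    ext v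
    rw [fderiv_eq_sum_partialDeriv]
    simp [mul_comm]
  rw [this]
  exact DifferentiableOn.fun_sum fun i _ => (differentiableOn_partialDeriv hD hf i).smul_const _

/-- Partial derivatives of holomorphic functions commute. -/
theorem partialDeriv_comm {n : ℕ} {D : Set (Fin n → ℂ)} (hD : IsOpen D)
    {f : (Fin n → ℂ) → ℂ} (hf : DifferentiableOn ℂ f D) (i j : Fin n) :
    EqOn (partialDeriv i (partialDeriv j f)) (partialDeriv j (partialDeriv i f)) D := by
  intro z hz
  have h1 : ∀ᶠ w in 𝓝 z, HasFDerivAt f (fderiv ℂ f w) w := by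
    filter_upwards [hD.mem_nhds hz] with w hw
    exact (hf.differentiableAt (hD.mem_nhds hw)).hasFDerivAt
  have h2 := ((differentiableOn_fderiv hD hf).differentiableAt (hD.mem_nhds hz)).hasFDerivAt
  have h3 := second_derivative_symmetric_of_eventually h1 h2
  have h4 : ∀ a b : Fin n, partialDeriv a (partialDeriv b f) z =
      fderiv ℂ (fderiv ℂ f) z (Pi.single a 1) (Pi.single b 1) := by
    intro a b
    have := (h2.clm_apply (hasFDerivAt_const (Pi.single b (1 : ℂ)) z)).fderiv
    change fderiv ℂ (fun y => fderiv ℂ f y (Pi.single b 1)) z (Pi.single a 1) = _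
    rw [this]
    simp
  rw [h4, h4, h3]

end SeveralComplexVariables

/-! ### Calculus of constant coefficient operators and their symbols -/

section SymbolCalculus

open Set

variable {n : ℕ} {D : Set (Fin n → ℂ)} {f g : (Fin n → ℂ) → ℂ}

theorem differentiableOn_iterate_partialDeriv (hD : IsOpen D) (hf : DifferentiableOn ℂ f D)
    (j : Fin n) (k : ℕ) : DifferentiableOn ℂ ((partialDeriv j)^[k] f) D := by
  induction k with
  | zero => exact hf
  | succ k ih =>
    rw [Function.iterate_succ_apply']
    exact differentiableOn_partialDeriv hD ih j

theorem iterate_partialDeriv_congr (hD : IsOpen D) (hfg : EqOn f g D) (j : Fin n) (k : ℕ) :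
    EqOn ((partialDeriv j)^[k] f) ((partialDeriv j)^[k] g) D := by
  induction k with
  | zero => exact hfg
  | succ k ih =>
    rw [Function.iterate_succ_apply', Function.iterate_succ_apply']
    exact partialDeriv_congr hD ih j

theorem iterate_partialDeriv_comm (hD : IsOpen D) (hf : DifferentiableOn ℂ f D) (i j : Fin n)
    (k : ℕ) : EqOn (partialDeriv i ((partialDeriv j)^[k] f))
      ((partialDeriv j)^[k] (partialDeriv i f)) D := by
  induction k with
  | zero => exact fun _ _ => rfl
  | succ k ih =>
    rw [Function.iterate_succ_apply', Function.iterate_succ_apply']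
    exact (partialDeriv_comm hD (differentiableOn_iterate_partialDeriv hD hf j k) i j).trans
      (partialDeriv_congr hD ih j)

/-- The operator `∂ ^ α`, restricted to the variables in a list. -/
def listDeriv (α : Fin n →₀ ℕ) (l : List (Fin n)) (f : (Fin n → ℂ) → ℂ) : (Fin n → ℂ) → ℂ :=
  l.foldr (fun j g => (partialDeriv j)^[α j] g) f

theorem listDeriv_cons (α : Fin n →₀ ℕ) (a : Fin n) (l : List (Fin n)) (f : (Fin n → ℂ) → ℂ) :
    listDeriv α (a :: l) f = (partialDeriv a)^[α a] (listDeriv α l f) := rfl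

theorem differentiableOn_listDeriv (hD : IsOpen D) (hf : DifferentiableOn ℂ f D)
    (α : Fin n →₀ ℕ) (l : List (Fin n)) : DifferentiableOn ℂ (listDeriv α l f) D := by
  induction l with
  | nil => exact hf
  | cons a l ih => exact differentiableOn_iterate_partialDeriv hD ih a _

theorem listDeriv_congr (hD : IsOpen D) (hfg : EqOn f g D) (α : Fin n →₀ ℕ) (l : List (Fin n)) :
    EqOn (listDeriv α l f) (listDeriv α l g) D := by
  induction l with
  | nil => exact hfg
  | cons a l ih => exact iterate_partialDeriv_congr hD ih a _

theorem listDeriv_partialDeriv (hD : IsOpen D) (hf : DifferentiableOn ℂ f D)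
    (α : Fin n →₀ ℕ) (l : List (Fin n)) (j : Fin n) :
    EqOn (partialDeriv j (listDeriv α l f)) (listDeriv α l (partialDeriv j f)) D := by
  induction l with
  | nil => exact fun _ _ => rfl
  | cons a l ih =>
    rw [listDeriv_cons, listDeriv_cons]
    exact (iterate_partialDeriv_comm hD (differentiableOn_listDeriv hD hf α l) j a _).trans
      (iterate_partialDeriv_congr hD ih a _)

theorem listDeriv_add_single_of_notMem (α : Fin n →₀ ℕ) (l : List (Fin n)) {j : Fin n}
    (hj : j ∉ l) (f : (Fin n → ℂ) → ℂ) :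
    listDeriv (α + Finsupp.single j 1) l f = listDeriv α l f := by
  induction l with
  | nil => rfl
  | cons a l ih =>
    rw [List.mem_cons, not_or] at hj
    rw [listDeriv_cons, listDeriv_cons, ih hj.2, Finsupp.add_apply,
      Finsupp.single_eq_of_ne (Ne.symm hj.1), add_zero]

/-- The extra derivative appears at the position of `j` in the list and is commuted past the
derivatives applied before it. Absence of repetitions ensures that it appears only once. -/
theorem listDeriv_add_single (hD : IsOpen D) (hf : DifferentiableOn ℂ f D)
    (α : Fin n →₀ ℕ) (l : List (Fin n)) (hl : l.Nodup) {j : Fin n} (hj : j ∈ l) :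
    EqOn (listDeriv (α + Finsupp.single j 1) l f) (listDeriv α l (partialDeriv j f)) D := by
  induction l with
  | nil => simp at hj
  | cons a l ih =>
    rw [List.nodup_cons] at hl
    rw [listDeriv_cons, listDeriv_cons]
    by_cases haj : a = j
    · subst haj
      rw [listDeriv_add_single_of_notMem α l hl.1, Finsupp.add_apply, Finsupp.single_eq_same,
        Function.iterate_succ_apply]
      exact iterate_partialDeriv_congr hD (listDeriv_partialDeriv hD hf α l a) a _
    · have hj' : j ∈ l := by
        rcases List.mem_cons.1 hj with h | h
        · exact absurd h.symm haj
        · exact h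
      rw [Finsupp.add_apply, Finsupp.single_eq_of_ne haj, add_zero]
      exact iterate_partialDeriv_congr hD (ih hl.2 hj') a _

theorem differentiableOn_multiDeriv (hD : IsOpen D) (hf : DifferentiableOn ℂ f D)
    (α : Fin n →₀ ℕ) : DifferentiableOn ℂ (multiDeriv α f) D :=
  differentiableOn_listDeriv hD hf α _

theorem multiDeriv_congr (hD : IsOpen D) (hfg : EqOn f g D) (α : Fin n →₀ ℕ) :
    EqOn (multiDeriv α f) (multiDeriv α g) D := listDeriv_congr hD hfg α _

theorem multiDeriv_add_single (hD : IsOpen D) (hf : DifferentiableOn ℂ f D)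
    (α : Fin n →₀ ℕ) (j : Fin n) :
    EqOn (multiDeriv (α + Finsupp.single j 1) f) (multiDeriv α (partialDeriv j f)) D :=
  listDeriv_add_single hD hf α _ (List.nodup_finRange n) (List.mem_finRange j)

theorem multiDeriv_zero (f : (Fin n → ℂ) → ℂ) : multiDeriv 0 f = f := by
  have : ∀ l : List (Fin n), listDeriv 0 l f = f := fun l => by
    induction l with
    | nil => rfl
    | cons a l ih => rw [listDeriv_cons, ih]; rfl
  exact this _

theorem differentiableOn_symbolOp (hD : IsOpen D) (hf : DifferentiableOn ℂ f D)
    (P : MvPolynomial (Fin n) ℝ) : DifferentiableOn ℂ (symbolOp P f) D :=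
  DifferentiableOn.fun_sum fun α _ => (differentiableOn_multiDeriv hD hf α).const_mul _

theorem symbolOp_congr (hD : IsOpen D) (hfg : EqOn f g D) (P : MvPolynomial (Fin n) ℝ) :
    EqOn (symbolOp P f) (symbolOp P g) D := fun z hz =>
  Finset.sum_congr rfl fun α _ => by rw [multiDeriv_congr hD hfg α hz]

theorem symbolOp_eq_sum_of_subset (P : MvPolynomial (Fin n) ℝ) {S : Finset (Fin n →₀ ℕ)}
    (hS : P.support ⊆ S) (f : (Fin n → ℂ) → ℂ) (z : Fin n → ℂ) :
    symbolOp P f z = ∑ α ∈ S,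
      ((P.coeff α : ℝ) : ℂ) * (-Complex.I) ^ (∑ j, α j) * multiDeriv α f z := by
  refine Finset.sum_subset hS fun α _ hα => ?_
  rw [MvPolynomial.notMem_support_iff.1 hα]
  simp

theorem symbolOp_monomial (α : Fin n →₀ ℕ) (c : ℝ) (f : (Fin n → ℂ) → ℂ) (z : Fin n → ℂ) :
    symbolOp (MvPolynomial.monomial α c) f z =
      (c : ℂ) * (-Complex.I) ^ (∑ j, α j) * multiDeriv α f z := by
  rw [symbolOp_eq_sum_of_subset _ MvPolynomial.support_monomial_subset]
  simp

theorem symbolOp_add (P R : MvPolynomial (Fin n) ℝ) (f : (Fin n → ℂ) → ℂ) (z : Fin n → ℂ) :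
    symbolOp (P + R) f z = symbolOp P f z + symbolOp R f z := by
  classical
  rw [symbolOp_eq_sum_of_subset (P + R) MvPolynomial.support_add,
    symbolOp_eq_sum_of_subset P Finset.subset_union_left,
    symbolOp_eq_sum_of_subset R Finset.subset_union_right, ← Finset.sum_add_distrib]
  refine Finset.sum_congr rfl fun α _ => ?_
  rw [MvPolynomial.coeff_add]
  push_cast
  ring

theorem symbolOp_zero (f : (Fin n → ℂ) → ℂ) (z : Fin n → ℂ) :
    symbolOp (0 : MvPolynomial (Fin n) ℝ) f z = 0 := by
  simp [symbolOp]

theorem symbolOp_sum {ι : Type*} (s : Finset ι) (P : ι → MvPolynomial (Fin n) ℝ)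
    (f : (Fin n → ℂ) → ℂ) (z : Fin n → ℂ) :
    symbolOp (∑ i ∈ s, P i) f z = ∑ i ∈ s, symbolOp (P i) f z := by
  classical
  induction s using Finset.induction_on with
  | empty => simp [symbolOp_zero]
  | insert a s ha ih => rw [Finset.sum_insert ha, Finset.sum_insert ha, symbolOp_add, ih]

theorem symbolOp_C_mul (c : ℝ) (P : MvPolynomial (Fin n) ℝ) (f : (Fin n → ℂ) → ℂ)
    (z : Fin n → ℂ) : symbolOp (MvPolynomial.C c * P) f z = c * symbolOp P f z := by
  induction P using MvPolynomial.induction_on' with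
  | monomial α a =>
    rw [MvPolynomial.C_mul_monomial, symbolOp_monomial, symbolOp_monomial]
    push_cast
    ring
  | add p q hp hq => rw [mul_add, symbolOp_add, symbolOp_add, hp, hq, mul_add]

/-- Multiplying the symbol by a variable amounts to applying `-i ∂_j` to the function first. This is
the inductive step of every later identity proved by induction on the polynomial, with the function
left arbitrary. -/
theorem symbolOp_mul_X (hD : IsOpen D) (hf : DifferentiableOn ℂ f D)
    (P : MvPolynomial (Fin n) ℝ) (j : Fin n) {z : Fin n → ℂ} (hz : z ∈ D) :
    symbolOp (P * MvPolynomial.X j) f z = -Complex.I * symbolOp P (partialDeriv j f) z := by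
  induction P using MvPolynomial.induction_on' with
  | monomial α a =>
    rw [MvPolynomial.X, MvPolynomial.monomial_mul, mul_one, symbolOp_monomial, symbolOp_monomial,
      multiDeriv_add_single hD hf α j hz]
    have : ∑ i, (α + Finsupp.single j 1 : Fin n →₀ ℕ) i = (∑ i, α i) + 1 := by
      simp only [Finsupp.add_apply, Finset.sum_add_distrib, Finsupp.single_apply]
      simp
    rw [this, pow_succ]
    ring
  | add p q hp hq => rw [add_mul, symbolOp_add, symbolOp_add, hp, hq, mul_add]

theorem partialDeriv_add (hD : IsOpen D) (hf : DifferentiableOn ℂ f D)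
    (hg : DifferentiableOn ℂ g D) (j : Fin n) :
    EqOn (partialDeriv j (f + g)) (partialDeriv j f + partialDeriv j g) D := fun z hz => by
  simp only [partialDeriv, Pi.add_apply]
  rw [fderiv_add (hf.differentiableAt (hD.mem_nhds hz)) (hg.differentiableAt (hD.mem_nhds hz))]
  rfl

theorem partialDeriv_const_smul (c : ℂ) (f : (Fin n → ℂ) → ℂ) (j : Fin n) :
    partialDeriv j (c • f) = c • partialDeriv j f := by
  funext z
  simp only [partialDeriv, Pi.smul_apply]
  rw [fderiv_const_smul_field]
  rfl

theorem symbolOp_add_fun (hD : IsOpen D) (hf : DifferentiableOn ℂ f D)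
    (hg : DifferentiableOn ℂ g D) (P : MvPolynomial (Fin n) ℝ) :
    EqOn (symbolOp P (f + g)) (symbolOp P f + symbolOp P g) D := by
  induction P using MvPolynomial.induction_on generalizing f g with
  | C a =>
    intro z _
    rw [Pi.add_apply, MvPolynomial.C_apply]
    simp only [symbolOp_monomial, multiDeriv_zero, Pi.add_apply]
    ring
  | add p q hp hq =>
    intro z hz
    rw [Pi.add_apply, symbolOp_add, symbolOp_add, symbolOp_add, hp hf hg hz, hq hf hg hz]
    simp only [Pi.add_apply]
    ring
  | mul_X p j hp =>
    intro z hz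
    have hf' := differentiableOn_partialDeriv hD hf j
    have hg' := differentiableOn_partialDeriv hD hg j
    rw [Pi.add_apply, symbolOp_mul_X hD (hf.add hg) _ _ hz, symbolOp_mul_X hD hf _ _ hz,
      symbolOp_mul_X hD hg _ _ hz, symbolOp_congr hD (partialDeriv_add hD hf hg j) p hz,
      hp hf' hg' hz, Pi.add_apply]
    ring

theorem symbolOp_const_smul (hD : IsOpen D) (hf : DifferentiableOn ℂ f D) (c : ℂ)
    (P : MvPolynomial (Fin n) ℝ) : EqOn (symbolOp P (c • f)) (c • symbolOp P f) D := by
  induction P using MvPolynomial.induction_on generalizing f with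
  | C a =>
    intro z _
    rw [Pi.smul_apply, MvPolynomial.C_apply]
    simp only [symbolOp_monomial, multiDeriv_zero, Pi.smul_apply, smul_eq_mul]
    ring
  | add p q hp hq =>
    intro z hz
    rw [Pi.smul_apply, symbolOp_add, symbolOp_add, hp hf hz, hq hf hz]
    simp only [Pi.smul_apply, smul_eq_mul]
    ring
  | mul_X p j hp =>
    intro z hz
    rw [Pi.smul_apply, symbolOp_mul_X hD (hf.const_smul c) _ _ hz, symbolOp_mul_X hD hf _ _ hz,
      partialDeriv_const_smul, hp (differentiableOn_partialDeriv hD hf j) hz, Pi.smul_apply]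
    simp only [smul_eq_mul]
    ring

theorem symbolOp_sum_fun (hD : IsOpen D) {ι : Type*} (s : Finset ι)
    {F : ι → (Fin n → ℂ) → ℂ} (hF : ∀ i, DifferentiableOn ℂ (F i) D)
    (P : MvPolynomial (Fin n) ℝ) {z : Fin n → ℂ} (hz : z ∈ D) :
    symbolOp P (∑ i ∈ s, F i) z = ∑ i ∈ s, symbolOp P (F i) z := by
  classical
  induction s using Finset.induction_on with
  | empty =>
    -- The zero function is `0 • 0`, so homogeneity gives the empty sum.
    have := symbolOp_const_smul hD (differentiableOn_const (0 : ℂ)) 0 P hz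
    simp only [zero_smul, Pi.zero_apply] at this
    simpa using this
  | insert a s ha ih =>
    rw [Finset.sum_insert ha, Finset.sum_insert ha, ← ih]
    exact symbolOp_add_fun hD (hF a) (DifferentiableOn.sum fun i _ => hF i) P hz

/-- The action of a real matrix on complex vectors. -/
def cmul (M : Matrix (Fin n) (Fin n) ℝ) (z : Fin n → ℂ) : Fin n → ℂ :=
  (M.map Complex.ofReal).mulVec z

theorem cmul_apply (M : Matrix (Fin n) (Fin n) ℝ) (z : Fin n → ℂ) (i : Fin n) :
    cmul M z i = ∑ j, (M i j : ℂ) * z j := rfl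

theorem differentiable_cmul (M : Matrix (Fin n) (Fin n) ℝ) : Differentiable ℂ (cmul M) := by
  rw [differentiable_pi]
  intro i
  simp only [cmul_apply]
  fun_prop

theorem partialDeriv_comp_cmul {D' : Set (Fin n → ℂ)} (hD' : IsOpen D')
    (hf : DifferentiableOn ℂ f D') (M : Matrix (Fin n) (Fin n) ℝ) (j : Fin n) {z : Fin n → ℂ}
    (hz : cmul M z ∈ D') :
    partialDeriv j (f ∘ cmul M) z = ∑ i, (M i j : ℂ) * partialDeriv i f (cmul M z) := by
  have h1 : HasFDerivAt (cmul M)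
      (LinearMap.toContinuousLinearMap ((M.map Complex.ofReal).mulVecLin)) z :=
    (LinearMap.toContinuousLinearMap ((M.map Complex.ofReal).mulVecLin)).hasFDerivAt
  have h2 := ((hf.differentiableAt (hD'.mem_nhds hz)).hasFDerivAt.comp z h1).fderiv
  rw [partialDeriv, h2]
  change fderiv ℂ f (cmul M z) ((M.map Complex.ofReal).mulVec (Pi.single j 1)) = _
  rw [fderiv_eq_sum_partialDeriv]
  simp

/-- The polynomial `P ∘ Mᵀ`. -/
def compTranspose (M : Matrix (Fin n) (Fin n) ℝ) (P : MvPolynomial (Fin n) ℝ) :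
    MvPolynomial (Fin n) ℝ :=
  MvPolynomial.bind₁ (fun j => ∑ i, MvPolynomial.C (M i j) * MvPolynomial.X i) P

theorem eval_compTranspose (M : Matrix (Fin n) (Fin n) ℝ) (P : MvPolynomial (Fin n) ℝ)
    (ξ : Fin n → ℝ) :
    MvPolynomial.eval ξ (compTranspose M P) = MvPolynomial.eval (M.transpose.mulVec ξ) P := by
  rw [compTranspose, MvPolynomial.eval, MvPolynomial.eval₂Hom_bind₁]
  congr 2
  funext j
  simp [Matrix.mulVec, dotProduct]

/-- The linear change of variables in a differential operator with constant coefficients. -/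
theorem symbolOp_comp_cmul {D' : Set (Fin n → ℂ)} (hD : IsOpen D) (hD' : IsOpen D')
    (hf : DifferentiableOn ℂ f D') {M : Matrix (Fin n) (Fin n) ℝ} (hM : MapsTo (cmul M) D D')
    (P : MvPolynomial (Fin n) ℝ) {z : Fin n → ℂ} (hz : z ∈ D) :
    symbolOp P (f ∘ cmul M) z = symbolOp (compTranspose M P) f (cmul M z) := by
  have hcomp : ∀ {h : (Fin n → ℂ) → ℂ}, DifferentiableOn ℂ h D' →
      DifferentiableOn ℂ (h ∘ cmul M) D := fun hh =>
    hh.comp (differentiable_cmul M).differentiableOn hM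
  induction P using MvPolynomial.induction_on generalizing f with
  | C a =>
    rw [compTranspose, MvPolynomial.bind₁_C_right, MvPolynomial.C_apply]
    simp only [symbolOp_monomial, multiDeriv_zero, Function.comp]
  | add p q hp hq =>
    have hadd : compTranspose M (p + q) = compTranspose M p + compTranspose M q := map_add _ _ _
    rw [symbolOp_add, hp hf, hq hf, hadd, symbolOp_add]
  | mul_X p j hp =>
    -- Chain rule: `∂_j (f ∘ M) = ∑ i, M i j (∂_i f) ∘ M`, which matches the substitution of `∑ i, M
    -- i j X_i` for `X_j` in the symbol.
    have h1 : EqOn (partialDeriv j (f ∘ cmul M))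
        (∑ i, (M i j : ℂ) • (partialDeriv i f ∘ cmul M)) D := fun w hw => by
      rw [partialDeriv_comp_cmul hD' hf M j (hM hw)]
      simp
    have h2 := fun i => hcomp (differentiableOn_partialDeriv hD' hf i)
    rw [symbolOp_mul_X hD (hcomp hf) _ _ hz, symbolOp_congr hD h1 p hz,
      symbolOp_sum_fun hD _ (fun i => (h2 i).const_smul _) p hz]
    have h3 : compTranspose M (p * MvPolynomial.X j) =
        ∑ i, MvPolynomial.C (M i j) * (compTranspose M p * MvPolynomial.X i) := by
      simp only [compTranspose, map_mul, MvPolynomial.bind₁_X_right, Finset.mul_sum]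
      refine Finset.sum_congr rfl fun i _ => by ring
    rw [h3, symbolOp_sum, Finset.mul_sum]
    refine Finset.sum_congr rfl fun i _ => ?_
    rw [symbolOp_const_smul hD (h2 i) _ p hz, symbolOp_C_mul, symbolOp_mul_X hD' hf _ _ (hM hz),
      Pi.smul_apply, hp (differentiableOn_partialDeriv hD' hf i), smul_eq_mul]
    ring

end SymbolCalculus

/-! ### Triangular elements with positive diagonal -/

namespace MatrixAlg

variable {r : ℕ} {U : Type*} [NonUnitalNonAssocRing U] [Module ℝ U]
  [IsScalarTower ℝ U U] [SMulCommClass ℝ U U] [StarRing U] [StarModule ℝ U]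

theorem ext_entry (A : MatrixAlg r U) {x y : U}
    (h : ∀ i j, (A.entry i j x : U) = A.entry i j y) : x = y := by
  rw [← A.sum_entry x, ← A.sum_entry y]
  simp only [h]

theorem entry_sum (A : MatrixAlg r U) (y : Fin r → Fin r → U) (hy : ∀ i j, y i j ∈ A.comp i j)
    (k l : Fin r) : (A.entry k l (∑ i, ∑ j, y i j) : U) = y k l := by
  simp only [map_sum, Submodule.coe_sum, fun i j => A.entry_of_mem (hy i j) k l]
  rw [Finset.sum_eq_single k, Finset.sum_eq_single l] <;> simp +contextual

/-- The subspace of upper triangular elements. -/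
def upperSubmodule (A : MatrixAlg r U) : Submodule ℝ U where
  carrier := A.upper
  add_mem' := fun {x y} hx hy i j hij => by
    rw [map_add, Submodule.coe_add, hx i j hij, hy i j hij, add_zero]
  zero_mem' := fun i j _ => by simp
  smul_mem' := fun c x hx i j hij => by
    rw [map_smul, Submodule.coe_smul, hx i j hij, smul_zero]

theorem add_mem_upper (A : MatrixAlg r U) {x y : U} (hx : x ∈ A.upper) (hy : y ∈ A.upper) :
    x + y ∈ A.upper := A.upperSubmodule.add_mem hx hy

theorem mul_mem_upper (A : MatrixAlg r U) {x y : U} (hx : x ∈ A.upper) (hy : y ∈ A.upper) :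
    x * y ∈ A.upper := fun i j hij => by
  rw [entry_mul]
  refine Finset.sum_eq_zero fun k _ => ?_
  rcases lt_or_ge k i with h | h
  · rw [hx i k h, zero_mul]
  · rw [hy k j (hij.trans_le h), mul_zero]

/-- The unit element. -/
def one (A : MatrixAlg r U) : U := ∑ i, ((A.rho i).symm 1 : U)

theorem one_mul (A : MatrixAlg r U) (x : U) : A.one * x = x := by
  conv_lhs => rw [← A.sum_entry x]
  conv_rhs => rw [← A.sum_entry x]
  rw [one, Finset.sum_mul]
  refine Finset.sum_congr rfl fun i _ => ?_
  simp only [Finset.mul_sum]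
  rw [Finset.sum_eq_single i]
  · exact Finset.sum_congr rfl fun j _ => A.c_mul (A.entry i j x).2
  · intro k _ hk
    exact Finset.sum_eq_zero fun j _ =>
      A.mul_zero_of_ne hk.symm ((A.rho i).symm 1).2 (A.entry k j x).2
  · simp

theorem star_one (A : MatrixAlg r U) : star A.one = A.one := by
  simp only [one, star_sum, star_unit]

theorem mul_one (A : MatrixAlg r U) (x : U) : x * A.one = x := by
  rw [← star_star (x * A.one), star_mul, star_one, one_mul, star_star]

theorem entry_one (A : MatrixAlg r U) (i j : Fin r) :
    (A.entry i j A.one : U) = if i = j then ((A.rho i).symm 1 : U) else 0 := by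
  simp only [one, map_sum, Submodule.coe_sum,
    fun k => A.entry_of_mem ((A.rho k).symm 1).2 i j]
  rw [Finset.sum_eq_single i]
  · by_cases h : i = j <;> simp [h]
  · intro k _ hk
    simp [hk]
  · simp

theorem diag_one (A : MatrixAlg r U) (i : Fin r) : A.diag i A.one = 1 := by
  have h := A.entry_diag i A.one
  rw [entry_one, if_pos rfl] at h
  have := smul_left_injective ℝ (A.unit_ne_zero i) ((one_smul ℝ _).trans h)
  exact this.symm

theorem one_mem_H (A : MatrixAlg r U) : A.one ∈ A.H :=
  ⟨fun i j hij => by rw [entry_one, if_neg hij.ne'], fun i => by rw [diag_one]; exact one_pos⟩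

theorem diag_mul (A : MatrixAlg r U) {s t : U} (hs : s ∈ A.upper) (ht : t ∈ A.upper)
    (i : Fin r) : A.diag i (s * t) = A.diag i s * A.diag i t := by
  have h := A.entry_mul i i s t
  rw [Finset.sum_eq_single i] at h
  · rw [entry_diag, entry_diag, entry_diag, smul_mul_assoc, mul_smul_comm,
      A.c_mul ((A.rho i).symm 1).2, smul_smul] at h
    exact smul_left_injective ℝ (A.unit_ne_zero i) h
  · intro k _ hk
    rcases lt_or_gt_of_ne hk with h | h
    · rw [hs i k h, zero_mul]
    · rw [ht k i h, mul_zero]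
  · simp

theorem mul_mem_H (A : MatrixAlg r U) {s t : U} (hs : s ∈ A.H) (ht : t ∈ A.H) : s * t ∈ A.H :=
  ⟨A.mul_mem_upper hs.1 ht.1, fun i => by
    rw [A.diag_mul hs.1 ht.1]; exact mul_pos (hs.2 i) (ht.2 i)⟩

/-- Back substitution from the last row upwards, dividing by the positive diagonal entries of `s`.
The element `x` need not be triangular. -/
theorem eq_zero_of_mul_eq_zero (A : MatrixAlg r U) {s : U} (hs : s ∈ A.H) {x : U}
    (h : s * x = 0) : x = 0 := by
  have key : ∀ i j, (A.entry i j x : U) = 0 := by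
    intro i
    induction i using WellFoundedGT.induction with
    | ind i ih =>
      intro j
      have h1 := A.entry_mul i j s x
      rw [h, Finset.sum_eq_single i] at h1
      · rw [entry_diag, smul_mul_assoc, A.c_mul (A.entry i j x).2, map_zero,
          Submodule.coe_zero] at h1
        exact (smul_eq_zero.1 h1.symm).resolve_left (hs.2 i).ne'
      · intro k _ hk
        rcases lt_or_gt_of_ne hk with hk | hk
        · rw [hs.1 i k hk, zero_mul]
        · rw [ih k hk, mul_zero]
      · simp
  exact A.ext_entry fun i j => by rw [key]; simp

/-- The entries of `half`. -/
def halfEntry (A : MatrixAlg r U) (i j : Fin r) : U →ₗ[ℝ] U :=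
  (if i < j then (1 : ℝ) else if i = j then 1 / 2 else 0) •
    ((A.comp i j).subtype ∘ₗ A.entry i j)

/-- The upper triangular part of `x`, with the diagonal halved. -/
def half (A : MatrixAlg r U) : U →ₗ[ℝ] U := ∑ i, ∑ j, A.halfEntry i j

theorem entry_half (A : MatrixAlg r U) (i j : Fin r) (x : U) :
    (A.entry i j (A.half x) : U) =
      (if i < j then (1 : ℝ) else if i = j then 1 / 2 else 0) • (A.entry i j x : U) := by
  have : A.half x = ∑ i, ∑ j, A.halfEntry i j x := by
    simp [half, LinearMap.sum_apply]
  rw [this, entry_sum]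
  · rfl
  · intro i j
    exact (A.comp i j).smul_mem _ (A.entry i j x).2

theorem half_mem_upper (A : MatrixAlg r U) (x : U) : A.half x ∈ A.upper := fun i j hij => by
  rw [entry_half, if_neg hij.not_gt, if_neg hij.ne', zero_smul]

/-- Every Hermitian `x` is `a + a⋆ = a 1⋆ + 1 a⋆` with `a` upper triangular. Hermitian elements thus
become polarized squares, and `u ↦ u u⋆` has surjective derivative at the unit. -/
theorem half_add_star (A : MatrixAlg r U) {x : U} (hx : star x = x) :
    A.half x + star (A.half x) = x := by
  refine A.ext_entry fun i j => ?_
  have hxij : star (A.entry j i x : U) = A.entry i j x := by rw [← entry_star, hx]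
  rw [map_add, Submodule.coe_add, entry_star, entry_half, entry_half, star_smul, hxij,
    star_trivial, ← add_smul]
  rcases lt_trichotomy i j with h | h | h
  · simp [h, h.not_gt, h.ne']
  · subst h; norm_num
  · simp [h, h.not_gt, h.ne']

end MatrixAlg

/-! ### The linear action of the triangular group on Hermitian elements -/

namespace TAlgebra

open MatrixAlg

variable {r n : ℕ} {U : Type*} [NonUnitalNonAssocRing U] [Module ℝ U]
  [IsScalarTower ℝ U U] [SMulCommClass ℝ U U] [StarRing U] [StarModule ℝ U]

/-- Left multiplication by `s` is injective on the finite-dimensional space of triangular elements,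
hence surjective. The right inverse is also a left inverse by associativity and cancellation. -/
theorem exists_inv [FiniteDimensional ℝ U] (T : TAlgebra r U) {s : U} (hs : s ∈ T.H) :
    ∃ s' ∈ T.H, s * s' = T.one ∧ s' * s = T.one := by
  have hmaps : ∀ x ∈ T.upperSubmodule, LinearMap.mulLeft ℝ s x ∈ T.upperSubmodule :=
    fun x hx => T.mul_mem_upper hs.1 hx
  have hinj : Function.Injective ((LinearMap.mulLeft ℝ s).restrict hmaps) := by
    rw [injective_iff_map_eq_zero]
    intro x hx
    apply Subtype.ext
    exact T.eq_zero_of_mul_eq_zero hs (congrArg Subtype.val hx)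
  obtain ⟨⟨s', hs'⟩, h⟩ := LinearMap.injective_iff_surjective.1 hinj ⟨T.one, T.one_mem_H.1⟩
  have h1 : s * s' = T.one := congrArg Subtype.val h
  refine ⟨s', ⟨hs', fun i => ?_⟩, h1, ?_⟩
  · have := T.diag_mul hs.1 hs' i
    rw [h1, diag_one] at this
    exact pos_of_mul_pos_right (this ▸ one_pos) (hs.2 i).le
  · have : s * (s' * s - T.one) = 0 := by
      rw [mul_sub, T.upper_assoc hs.1 hs' hs.1, h1, T.one_mul, T.mul_one, sub_self]
    exact sub_eq_zero.1 (T.eq_zero_of_mul_eq_zero hs this)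

/-- Polarization of the axiom `t (u u⋆) = (t u) u⋆`, read at `u + w`. -/
theorem upper_mul_polar (T : TAlgebra r U) {t u w : U} (ht : t ∈ T.upper) (hu : u ∈ T.upper)
    (hw : w ∈ T.upper) :
    t * (u * star w + w * star u) = (t * u) * star w + (t * w) * star u := by
  have h1 := T.upper_mul_star ht (T.add_mem_upper hu hw)
  have h2 := T.upper_mul_star ht hu
  have h3 := T.upper_mul_star ht hw
  simp only [star_add, mul_add, add_mul] at h1 ⊢
  rw [h2, h3] at h1
  have : t * (u * star w) + t * (w * star u) - (t * u * star w + t * w * star u) = 0 := by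
    rw [← sub_eq_zero] at h1
    rw [← h1]
    abel
  exact sub_eq_zero.1 this

/-- The linear operator on Hermitian elements with `u u⋆ ↦ (s u) (s u)⋆`. -/
def act (T : TAlgebra r U) (s : U) : U →ₗ[ℝ] U where
  -- The expected image of `u w⋆ + w u⋆` is `(s u)(s w)⋆ + (s w)(s u)⋆`; the formula is the case `u
  -- = half x`, `w = 1`.
  toFun x := (s * T.half x) * star s + s * star (s * T.half x)
  map_add' x y := by
    simp only [map_add, mul_add, add_mul, star_add]
    abel
  map_smul' c x := by
    simp only [map_smul, mul_smul_comm, smul_mul_assoc, star_smul, star_trivial, smul_add,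
      RingHom.id_apply]

theorem act_apply (T : TAlgebra r U) (s x : U) :
    T.act s x = (s * T.half x) * star s + s * star (s * T.half x) := rfl

theorem star_act (T : TAlgebra r U) (s x : U) : star (T.act s x) = T.act s x := by
  simp only [act_apply, star_add, star_mul, star_star]
  abel

/-- The right side must depend on `u` and `w` only through `x = u w⋆ + w u⋆`. Multiplying it on the
left by the inverse of `s` gives `u (s w)⋆ + w (s u)⋆ = (s x)⋆`, and left multiplication by an
element of `H` is injective. Comparing with the decomposition `u = half x`, `w = 1` gives the
formula. -/
theorem act_polar [FiniteDimensional ℝ U] (T : TAlgebra r U) {s u w : U} (hs : s ∈ T.H)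
    (hu : u ∈ T.upper) (hw : w ∈ T.upper) :
    T.act s (u * star w + w * star u) =
      (s * u) * star (s * w) + (s * w) * star (s * u) := by
  obtain ⟨s', hs', h1, h2⟩ := T.exists_inv hs
  have key : ∀ u ∈ T.upper, ∀ w ∈ T.upper,
      s' * ((s * u) * star (s * w) + (s * w) * star (s * u)) =
        star (s * (u * star w + w * star u)) := by
    intro u hu w hw
    rw [T.upper_mul_polar hs'.1 (T.mul_mem_upper hs.1 hu) (T.mul_mem_upper hs.1 hw),
      T.upper_assoc hs'.1 hs.1 hu, T.upper_assoc hs'.1 hs.1 hw, h2, T.one_mul, T.one_mul,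
      T.upper_mul_polar hs.1 hu hw]
    simp only [star_add, star_mul, star_star]
    abel
  have hx : star (u * star w + w * star u) = u * star w + w * star u := by
    simp only [star_add, star_mul, star_star]
    abel
  set x := u * star w + w * star u with hxdef
  have h3 := key u hu w hw
  have h4 := key (T.half x) (T.half_mem_upper x) T.one T.one_mem_H.1
  rw [T.star_one, T.mul_one, T.one_mul, T.mul_one, T.half_add_star hx] at h4
  rw [← hxdef, ← h4, ← sub_eq_zero, ← mul_sub] at h3
  exact (sub_eq_zero.1 (T.eq_zero_of_mul_eq_zero hs' h3)).symm

theorem act_mul_star [FiniteDimensional ℝ U] (T : TAlgebra r U) {s u : U} (hs : s ∈ T.H)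
    (hu : u ∈ T.upper) : T.act s (u * star u) = (s * u) * star (s * u) := by
  have h := T.act_polar hs hu hu
  rw [map_add, ← two_smul ℝ, ← two_smul ℝ] at h
  exact smul_right_injective U (two_ne_zero' ℝ) h

/-- Linear maps that agree on the squares `w w⋆` agree on the Hermitian elements. -/
theorem eq_of_eq_on_squares (T : TAlgebra r U) {W : Type*} [AddCommGroup W] [Module ℝ W]
    {f g : U →ₗ[ℝ] W} (h : ∀ w ∈ T.upper, f (w * star w) = g (w * star w)) {x : U}
    (hx : star x = x) : f x = g x := by
  set a := T.half x
  have ha : a ∈ T.upper := T.half_mem_upper x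
  -- With `x = a + a⋆`, expand `(a + 1)(a + 1)⋆`.
  have hx' : x = (a + T.one) * star (a + T.one) - a * star a - T.one * star T.one := by
    simp only [star_add, T.star_one, mul_add, add_mul, T.mul_one, T.one_mul]
    conv_lhs => rw [← T.half_add_star hx]
    abel
  rw [hx']
  simp only [map_sub]
  rw [h _ (T.add_mem_upper ha T.one_mem_H.1), h _ ha, h _ T.one_mem_H.1]

theorem act_mul [FiniteDimensional ℝ U] (T : TAlgebra r U) {s t : U} (hs : s ∈ T.H)
    (ht : t ∈ T.H) {x : U} (hx : star x = x) : T.act (s * t) x = T.act s (T.act t x) := by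
  refine T.eq_of_eq_on_squares (f := T.act (s * t)) (g := T.act s ∘ₗ T.act t) (fun w hw => ?_) hx
  rw [LinearMap.comp_apply, T.act_mul_star (T.mul_mem_H hs ht) hw, T.act_mul_star ht hw,
    T.act_mul_star hs (T.mul_mem_upper ht.1 hw), T.upper_assoc hs.1 ht.1 hw]

theorem act_one (T : TAlgebra r U) {x : U} (hx : star x = x) : T.act T.one x = x := by
  rw [act_apply, T.one_mul, T.star_one, T.mul_one, T.one_mul, T.half_add_star hx]

/-- The trace is cyclic and associative, so the axiom on `t (u u⋆)` can be used inside it. The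
resulting expression pairs the cone of the `u u⋆` with the cone of the `t⋆ t`. -/
theorem tr_square_mul_square (T : TAlgebra r U) {t u : U} (ht : t ∈ T.upper) (hu : u ∈ T.upper) :
    T.tr ((u * star u) * (star t * t)) = T.tr ((t * u) * star (t * u)) := by
  rw [T.tr_mul_assoc, T.tr_mul_comm, T.tr_mul_assoc, T.upper_mul_star ht hu, ← T.tr_mul_assoc,
    star_mul]

/-- On squares `x = w w⋆` both sides are `tr ((t s w)(t s w)⋆)`. It identifies the adjoint of `act
s` on the dual cone as right translation of `t` by `s`. -/
theorem tr_act_mul_square [FiniteDimensional ℝ U] (T : TAlgebra r U) {s t : U} (hs : s ∈ T.H)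
    (ht : t ∈ T.H) {x : U} (hx : star x = x) :
    T.tr (T.act s x * (star t * t)) = T.tr (x * (star (t * s) * (t * s))) := by
  refine T.eq_of_eq_on_squares (f := T.tr ∘ₗ LinearMap.mulRight ℝ (star t * t) ∘ₗ T.act s)
    (g := T.tr ∘ₗ LinearMap.mulRight ℝ (star (t * s) * (t * s))) (fun w hw => ?_) hx
  simp only [LinearMap.comp_apply, LinearMap.mulRight_apply]
  rw [T.act_mul_star hs hw, T.tr_square_mul_square ht.1 (T.mul_mem_upper hs.1 hw),
    T.tr_square_mul_square (T.mul_mem_upper ht.1 hs.1) hw, T.upper_assoc ht.1 hs.1 hw]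

/-! ### Matrices of the action in an orthonormal basis -/

section Coordinates

variable (b : Module.Basis (Fin n) ℝ (selfAdjoint.submodule ℝ U))

theorem star_vec (x : Fin n → ℝ) : star (vec b x) = vec b x :=
  (∑ j, x j • b j : selfAdjoint.submodule ℝ U).2

theorem vec_eq_sum (x : Fin n → ℝ) : vec b x = ∑ j, x j • (b j : U) := by
  simp [vec]

/-- The orthogonal projection to the Hermitian elements, in coordinates. -/
def coord (T : TAlgebra r U) : U →ₗ[ℝ] (Fin n → ℝ) :=
  LinearMap.pi fun i => T.tr ∘ₗ LinearMap.mulRight ℝ (star (b i : U))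

theorem coord_apply (T : TAlgebra r U) (x : U) (i : Fin n) :
    T.coord b x i = T.tr (x * star (b i : U)) := rfl

variable {b}

theorem coord_vec (T : TAlgebra r U) (hb : T.IsOrthonormal b) (x : Fin n → ℝ) :
    T.coord b (vec b x) = x := by
  funext i
  rw [coord_apply, vec_eq_sum, Finset.sum_mul, map_sum]
  simp [smul_mul_assoc, hb _ i]

theorem vec_coord (T : TAlgebra r U) (hb : T.IsOrthonormal b) {x : U} (hx : star x = x) :
    vec b (T.coord b x) = x := by
  have : x = vec b (b.repr ⟨x, hx⟩) := by
    have h := congrArg Subtype.val (b.sum_repr ⟨x, hx⟩)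
    exact h.symm
  rw [this, coord_vec T hb]

theorem vec_injective : Function.Injective (vec b) := by
  intro x y h
  have h' : ∑ j, x j • b j = ∑ j, y j • b j := Subtype.ext h
  have := congrArg b.equivFun h'
  rwa [← b.equivFun_symm_apply, ← b.equivFun_symm_apply, LinearEquiv.apply_symm_apply,
    LinearEquiv.apply_symm_apply] at this

/-- Orthonormality turns the trace form into the dot product, so the matrix transpose is the adjoint
for the trace form. -/
theorem dotProduct_eq_tr (T : TAlgebra r U) (hb : T.IsOrthonormal b) (x ξ : Fin n → ℝ) :
    x ⬝ᵥ ξ = T.tr (vec b x * vec b ξ) := by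
  conv_lhs => rw [← T.coord_vec hb x]
  rw [vec_eq_sum b ξ, Finset.mul_sum, map_sum, dotProduct]
  refine Finset.sum_congr rfl fun i _ => ?_
  have : star (b i : U) = b i := (b i).2
  rw [coord_apply, this, mul_smul_comm, map_smul, smul_eq_mul, mul_comm]

/-- The matrix of `act s`. -/
def mat (T : TAlgebra r U) (b : Module.Basis (Fin n) ℝ (selfAdjoint.submodule ℝ U)) (s : U) :
    Matrix (Fin n) (Fin n) ℝ := fun i j => T.coord b (T.act s (b j)) i

theorem mat_mulVec_eq (T : TAlgebra r U) (s : U) (x : Fin n → ℝ) :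
    (T.mat b s).mulVec x = T.coord b (T.act s (vec b x)) := by
  funext i
  simp only [vec_eq_sum, map_sum, map_smul, Matrix.mulVec, dotProduct, mat, Finset.sum_apply,
    Pi.smul_apply, smul_eq_mul]
  exact Finset.sum_congr rfl fun j _ => mul_comm _ _

theorem vec_mat_mulVec (T : TAlgebra r U) (hb : T.IsOrthonormal b) (s : U) (x : Fin n → ℝ) :
    vec b ((T.mat b s).mulVec x) = T.act s (vec b x) := by
  rw [mat_mulVec_eq, T.vec_coord hb (T.star_act s _)]

theorem vec_mat_transpose_mulVec [FiniteDimensional ℝ U] (T : TAlgebra r U)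
    (hb : T.IsOrthonormal b) {s t : U} (hs : s ∈ T.H) (ht : t ∈ T.H) {ξ : Fin n → ℝ}
    (hξ : vec b ξ = star t * t) :
    vec b ((T.mat b s).transpose.mulVec ξ) = star (t * s) * (t * s) := by
  have hη : star (star (t * s) * (t * s)) = star (t * s) * (t * s) := by
    rw [star_mul, star_star]
  rw [← T.vec_coord hb hη]
  congr 1
  refine dotProduct_eq _ _ fun x => ?_
  rw [Matrix.mulVec_transpose, ← Matrix.dotProduct_mulVec, dotProduct_comm,
    T.dotProduct_eq_tr hb, T.vec_mat_mulVec hb, hξ, T.tr_act_mul_square hs ht (star_vec b x),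
    dotProduct_comm, T.dotProduct_eq_tr hb, T.vec_coord hb hη]

theorem mat_mul [FiniteDimensional ℝ U] (T : TAlgebra r U) (hb : T.IsOrthonormal b) {s t : U}
    (hs : s ∈ T.H) (ht : t ∈ T.H) : T.mat b (s * t) = T.mat b s * T.mat b t := by
  refine Matrix.ext_of_mulVec_single fun i => vec_injective (b := b) ?_
  rw [← Matrix.mulVec_mulVec, T.vec_mat_mulVec hb, T.vec_mat_mulVec hb, T.vec_mat_mulVec hb,
    T.act_mul hs ht (star_vec b _)]

theorem mat_one (T : TAlgebra r U) (hb : T.IsOrthonormal b) : T.mat b T.one = 1 := by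
  refine Matrix.ext_of_mulVec_single fun i => vec_injective (b := b) ?_
  rw [T.vec_mat_mulVec hb, T.act_one (star_vec b _), Matrix.one_mulVec]

theorem det_mat_ne_zero [FiniteDimensional ℝ U] (T : TAlgebra r U) (hb : T.IsOrthonormal b)
    {s : U} (hs : s ∈ T.H) : (T.mat b s).det ≠ 0 := by
  obtain ⟨s', hs', h1, _⟩ := T.exists_inv hs
  have h := congrArg Matrix.det (T.mat_mul hb hs hs')
  rw [h1, T.mat_one hb, Matrix.det_one, Matrix.det_mul] at h
  exact left_ne_zero_of_mul (h ▸ one_ne_zero)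

end Coordinates

end TAlgebra

/-! ### Openness of the cone and continuity of the triangular factor -/

open Filter Topology Set in
/-- A quadratic map with surjective derivative is open at the point in question. -/
theorem map_nhds_quadratic {d n : ℕ} (B : (Fin d → ℝ) →ₗ[ℝ] (Fin d → ℝ) →ₗ[ℝ] (Fin n → ℝ))
    (a : Fin d → ℝ) (h : ∀ y, ∃ x, B a x + B x a = y) :
    map (fun x => B x x) (𝓝 a) = 𝓝 (B a a) := by
  set Bc := B.toContinuousBilinearMap
  have h1 : HasStrictFDerivAt (fun x => Bc x x)
      ((Bc a).comp (ContinuousLinearMap.id ℝ _) + Bc.flip a) a :=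
    Bc.hasStrictFDerivAt.clm_apply (hasStrictFDerivAt_id a)
  refine h1.map_nhds_eq_of_surj ?_
  rw [LinearMap.range_eq_top]
  intro y
  obtain ⟨x, hx⟩ := h y
  exact ⟨x, hx⟩

namespace TAlgebra

open MatrixAlg Filter Topology Set

variable {r n : ℕ} {U : Type*} [NonUnitalNonAssocRing U] [Module ℝ U]
  [IsScalarTower ℝ U U] [SMulCommClass ℝ U U] [StarRing U] [StarModule ℝ U]
  {b : Module.Basis (Fin n) ℝ (selfAdjoint.submodule ℝ U)}

variable (U) in
/-- The involution as a linear map. -/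
def starL : U →ₗ[ℝ] U where
  toFun := star
  map_add' := star_add
  map_smul' c x := by simp

variable (U) in
-- The algebra carries no topology a priori. Any Hausdorff vector space topology serves for
-- continuity arguments, and coordinates provide one.
theorem exists_topology [FiniteDimensional ℝ U] : ∃ _ : TopologicalSpace U,
    IsTopologicalAddGroup U ∧ ContinuousSMul ℝ U ∧ T2Space U := by
  let φ := (Module.finBasis ℝ U).equivFun
  let _ : TopologicalSpace U := TopologicalSpace.induced φ inferInstance
  have hc : Continuous φ := continuous_induced_dom
  exact ⟨inferInstance, topologicalAddGroup_induced φ, continuousSMul_induced φ,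
    T2Space.of_injective_continuous φ.injective hc⟩

section Topological

variable [FiniteDimensional ℝ U] [TopologicalSpace U] [IsTopologicalAddGroup U]
  [ContinuousSMul ℝ U] [T2Space U]

variable (U) in
theorem continuous_star_of_finiteDimensional : Continuous (star : U → U) :=
  (starL U).continuous_of_finiteDimensional

variable (U) in
theorem continuousMul_of_finiteDimensional : ContinuousMul U := by
  refine ⟨?_⟩
  have : (fun p : U × U => p.1 * p.2) = fun p : U × U =>
      ∑ i, ∑ j, ((Module.finBasis ℝ U).repr p.1 i * (Module.finBasis ℝ U).repr p.2 j) •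
        (Module.finBasis ℝ U i * Module.finBasis ℝ U j) := by
    funext p
    conv_lhs => rw [← (Module.finBasis ℝ U).sum_repr p.1, ← (Module.finBasis ℝ U).sum_repr p.2]
    rw [Finset.sum_mul]
    refine Finset.sum_congr rfl fun i _ => ?_
    rw [Finset.mul_sum]
    refine Finset.sum_congr rfl fun j _ => ?_
    rw [smul_mul_assoc, mul_smul_comm, smul_smul]
  rw [this]
  have hc : ∀ i, Continuous fun x : U => (Module.finBasis ℝ U).repr x i := fun i =>
    ((Module.finBasis ℝ U).coord i).continuous_of_finiteDimensional
  have hc1 : ∀ i, Continuous fun p : U × U => (Module.finBasis ℝ U).repr p.1 i := fun i =>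
    (hc i).comp continuous_fst
  have hc2 : ∀ i, Continuous fun p : U × U => (Module.finBasis ℝ U).repr p.2 i := fun i =>
    (hc i).comp continuous_snd
  fun_prop

theorem continuous_mat (T : TAlgebra r U) : Continuous (T.mat b) := by
  have := continuousMul_of_finiteDimensional U
  have hs := continuous_star_of_finiteDimensional U
  refine continuous_matrix fun i j => ?_
  have h : Continuous fun x : U => T.coord b x i :=
    ((LinearMap.proj i).comp (T.coord b)).continuous_of_finiteDimensional
  refine h.comp ?_
  simp only [act_apply]
  fun_prop

theorem continuous_diag (T : TAlgebra r U) (i : Fin r) : Continuous (T.diag i) :=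
  (T.diag i).continuous_of_finiteDimensional

/-- The map from coordinates to upper triangular elements. -/
def upperOfCoord (T : TAlgebra r U) : (Fin (Module.finrank ℝ T.upperSubmodule) → ℝ) →ₗ[ℝ] U :=
  T.upperSubmodule.subtype ∘ₗ (Module.finBasis ℝ T.upperSubmodule).equivFun.symm.toLinearMap

theorem upperOfCoord_mem (T : TAlgebra r U) (x) : T.upperOfCoord x ∈ T.upper :=
  ((Module.finBasis ℝ T.upperSubmodule).equivFun.symm x).2

theorem exists_upperOfCoord (T : TAlgebra r U) {u : U} (hu : u ∈ T.upper) :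
    ∃ x, T.upperOfCoord x = u :=
  ⟨(Module.finBasis ℝ T.upperSubmodule).equivFun ⟨u, hu⟩, by
    simp only [upperOfCoord, LinearMap.comp_apply, LinearEquiv.coe_coe,
      LinearEquiv.symm_apply_apply]
    rfl⟩

theorem eventually_H_upperOfCoord (T : TAlgebra r U) {S : Set U} (hS : S ∈ 𝓝 T.one)
    {a : Fin (Module.finrank ℝ T.upperSubmodule) → ℝ} (ha : T.upperOfCoord a = T.one) :
    ∀ᶠ x in 𝓝 a, T.upperOfCoord x ∈ S ∩ T.H := by
  have hc : Continuous T.upperOfCoord := T.upperOfCoord.continuous_of_finiteDimensional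
  have h1 : ∀ᶠ x in 𝓝 a, T.upperOfCoord x ∈ S := hc.continuousAt.eventually_mem (ha ▸ hS)
  have h2 : ∀ᶠ x in 𝓝 a, ∀ i, 0 < T.diag i (T.upperOfCoord x) := by
    rw [eventually_all]
    intro i
    refine ((T.continuous_diag i).comp hc).continuousAt.eventually_const_lt ?_
    simp [ha, diag_one]
  filter_upwards [h1, h2] with x hx1 hx2 using ⟨hx1, T.upperOfCoord_mem x, hx2⟩

/-- At the unit, `u ↦ u u⋆` has derivative `u ↦ u + u⋆`, which maps triangular elements onto the
Hermitian ones. The arbitrary neighbourhood `S` yields continuity of the factor at the base point as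
well as openness there. -/
theorem mul_star_mem_nhds (T : TAlgebra r U) (hb : T.IsOrthonormal b) {S : Set U}
    (hS : S ∈ 𝓝 T.one) :
    {y | ∃ u ∈ S ∩ T.H, u * star u = vec b y} ∈ 𝓝 (T.coord b T.one) := by
  obtain ⟨a, ha⟩ := T.exists_upperOfCoord T.one_mem_H.1
  let B := ((LinearMap.mul ℝ U).compr₂ (T.coord b)).compl₁₂ T.upperOfCoord
    (starL U ∘ₗ T.upperOfCoord)
  have hB : ∀ x y, B x y = T.coord b (T.upperOfCoord x * star (T.upperOfCoord y)) :=
    fun x y => rfl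
  have h := map_nhds_quadratic B a fun y => by
    obtain ⟨x, hx⟩ := T.exists_upperOfCoord (T.half_mem_upper (vec b y))
    refine ⟨x, ?_⟩
    rw [hB, hB, ha, hx, T.one_mul, T.star_one, T.mul_one, ← map_add, add_comm,
      T.half_add_star (star_vec b y), T.coord_vec hb]
  rw [hB, ha, T.star_one, T.mul_one] at h
  rw [← h, mem_map]
  filter_upwards [T.eventually_H_upperOfCoord hS ha] with x hx
  exact ⟨_, hx, by beta_reduce; rw [hB, T.vec_coord hb (by rw [star_mul, star_star])]⟩

theorem star_mul_mem_nhds (T : TAlgebra r U) (hb : T.IsOrthonormal b) :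
    {y | vec b y ∈ T.dualCone} ∈ 𝓝 (T.coord b T.one) := by
  obtain ⟨a, ha⟩ := T.exists_upperOfCoord T.one_mem_H.1
  let B := ((LinearMap.mul ℝ U).compr₂ (T.coord b)).compl₁₂ (starL U ∘ₗ T.upperOfCoord)
    T.upperOfCoord
  have hB : ∀ x y, B x y = T.coord b (star (T.upperOfCoord x) * T.upperOfCoord y) :=
    fun x y => rfl
  have h := map_nhds_quadratic B a fun y => by
    obtain ⟨x, hx⟩ := T.exists_upperOfCoord (T.half_mem_upper (vec b y))
    refine ⟨x, ?_⟩
    rw [hB, hB, ha, hx, T.star_one, T.one_mul, T.mul_one, ← map_add,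
      T.half_add_star (star_vec b y), T.coord_vec hb]
  rw [hB, ha, T.star_one, T.mul_one] at h
  rw [← h, mem_map]
  filter_upwards [T.eventually_H_upperOfCoord univ_mem ha] with x hx
  exact ⟨_, hx.2, by beta_reduce; rw [hB, T.vec_coord hb (by rw [star_mul, star_star])]⟩

end Topological

open Classical in
/-- The element `t ∈ H` with `t t⋆ = y`, for `y ∈ Ω` in coordinates. -/
def chol (T : TAlgebra r U) (b : Module.Basis (Fin n) ℝ (selfAdjoint.submodule ℝ U))
    (y : Fin n → ℝ) : U :=
  -- Off the cone the value is the unit, so the result always lies in `H` and `trans b y` is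
  -- invertible for every `y`.
  if h : y ∈ T.coneSet b then Classical.choose h else T.one

theorem chol_mem (T : TAlgebra r U) (y : Fin n → ℝ) : T.chol b y ∈ T.H := by
  rw [chol]
  split_ifs with h
  · exact (Classical.choose_spec h).1
  · exact T.one_mem_H

theorem chol_mul_star (T : TAlgebra r U) {y : Fin n → ℝ} (hy : y ∈ T.coneSet b) :
    T.chol b y * star (T.chol b y) = vec b y := by
  rw [chol, dif_pos hy]
  exact (Classical.choose_spec hy).2

theorem chol_eq (T : TAlgebra r U) {y : Fin n → ℝ} {s : U} (hs : s ∈ T.H)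
    (h : s * star s = vec b y) : T.chol b y = s :=
  T.H_unique (T.chol_mem y) hs ((T.chol_mul_star ⟨s, hs, h⟩).trans h.symm)

/-- The base point of the cone, in coordinates. -/
def base (T : TAlgebra r U) (b : Module.Basis (Fin n) ℝ (selfAdjoint.submodule ℝ U)) :
    Fin n → ℝ := T.coord b T.one

/-- The matrix of the linear automorphism of the cone that maps the base point to `y`. -/
def trans (T : TAlgebra r U) (b : Module.Basis (Fin n) ℝ (selfAdjoint.submodule ℝ U))
    (y : Fin n → ℝ) : Matrix (Fin n) (Fin n) ℝ := T.mat b (T.chol b y)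

section

variable (T : TAlgebra r U) (hb : T.IsOrthonormal b)
include hb

theorem vec_base : vec b (T.base b) = T.one := T.vec_coord hb T.star_one

theorem base_mem : T.base b ∈ T.coneSet b :=
  ⟨T.one, T.one_mem_H, by rw [T.vec_base hb, T.star_one, T.mul_one]⟩

theorem chol_base : T.chol b (T.base b) = T.one :=
  T.chol_eq T.one_mem_H (by rw [T.vec_base hb, T.star_one, T.mul_one])

variable [FiniteDimensional ℝ U]

theorem mat_mulVec_base {s : U} (hs : s ∈ T.H) :
    vec b ((T.mat b s).mulVec (T.base b)) = s * star s := by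
  rw [T.vec_mat_mulVec hb, T.vec_base hb]
  conv_lhs => rw [← T.one_mul T.one]
  conv_lhs => enter [2, 2]; rw [← T.star_one]
  rw [T.act_mul_star hs T.one_mem_H.1, T.mul_one]

theorem trans_mulVec_base {y : Fin n → ℝ} (hy : y ∈ T.coneSet b) :
    (T.trans b y).mulVec (T.base b) = y := by
  apply vec_injective (b := b)
  rw [trans, T.mat_mulVec_base hb (T.chol_mem y), T.chol_mul_star hy]

theorem vec_mat_mulVec_of_mem {s : U} (hs : s ∈ T.H) {v : Fin n → ℝ} (hv : v ∈ T.coneSet b) :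
    (s * T.chol b v) * star (s * T.chol b v) = vec b ((T.mat b s).mulVec v) := by
  rw [T.vec_mat_mulVec hb, ← T.chol_mul_star hv, T.act_mul_star hs (T.chol_mem v).1]

theorem mat_mulVec_mem {s : U} (hs : s ∈ T.H) {v : Fin n → ℝ} (hv : v ∈ T.coneSet b) :
    (T.mat b s).mulVec v ∈ T.coneSet b :=
  ⟨_, T.mul_mem_H hs (T.chol_mem v), T.vec_mat_mulVec_of_mem hb hs hv⟩

theorem chol_mat_mulVec {s : U} (hs : s ∈ T.H) {v : Fin n → ℝ} (hv : v ∈ T.coneSet b) :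
    T.chol b ((T.mat b s).mulVec v) = s * T.chol b v :=
  T.chol_eq (T.mul_mem_H hs (T.chol_mem v)) (T.vec_mat_mulVec_of_mem hb hs hv)

theorem trans_mulVec_mem (y : Fin n → ℝ) {v : Fin n → ℝ} (hv : v ∈ T.coneSet b) :
    (T.trans b y).mulVec v ∈ T.coneSet b := T.mat_mulVec_mem hb (T.chol_mem y) hv

theorem trans_trans_mulVec (y : Fin n → ℝ) {v : Fin n → ℝ} (hv : v ∈ T.coneSet b) :
    T.trans b ((T.trans b y).mulVec v) = T.trans b y * T.trans b v := by
  rw [trans, trans, T.chol_mat_mulVec hb (T.chol_mem y) hv,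
    T.mat_mul hb (T.chol_mem y) (T.chol_mem v)]
  rfl

theorem det_trans_ne_zero (y : Fin n → ℝ) : (T.trans b y).det ≠ 0 :=
  T.det_mat_ne_zero hb (T.chol_mem y)

theorem coneSet_mem_nhds_base : T.coneSet b ∈ 𝓝 (T.base b) := by
  obtain ⟨_, _, _, _⟩ := exists_topology U
  filter_upwards [T.mul_star_mem_nhds hb univ_mem] with y hy
  obtain ⟨u, hu, h⟩ := hy
  exact ⟨u, hu.2, h⟩

theorem dualCone_mem_nhds_base : {y | vec b y ∈ T.dualCone} ∈ 𝓝 (T.base b) := by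
  obtain ⟨_, _, _, _⟩ := exists_topology U
  exact T.star_mul_mem_nhds hb

theorem mulVec_inv_mulVec {s : U} (hs : s ∈ T.H) (y : Fin n → ℝ) :
    (T.mat b s).mulVec ((T.mat b s)⁻¹.mulVec y) = y := by
  rw [Matrix.mulVec_mulVec, Matrix.mul_nonsing_inv _ (T.det_mat_ne_zero hb hs).isUnit,
    Matrix.one_mulVec]

theorem tendsto_trans_inv {y : Fin n → ℝ} (hy : y ∈ T.coneSet b) :
    Tendsto (fun x => (T.trans b y)⁻¹.mulVec x) (𝓝 y) (𝓝 (T.base b)) := by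
  have hc : Continuous fun x => (T.trans b y)⁻¹.mulVec x := by fun_prop
  have h := hc.tendsto y
  have hval : (T.trans b y)⁻¹.mulVec y = T.base b := by
    conv_lhs => enter [2]; rw [← T.trans_mulVec_base hb hy]
    rw [Matrix.mulVec_mulVec, Matrix.nonsing_inv_mul _ (T.det_trans_ne_zero hb y).isUnit,
      Matrix.one_mulVec]
  rwa [hval] at h

theorem isOpen_coneSet : IsOpen (T.coneSet b) := by
  rw [isOpen_iff_mem_nhds]
  intro y hy
  filter_upwards [(T.tendsto_trans_inv hb hy).eventually_mem (T.coneSet_mem_nhds_base hb)] with x hx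
  rw [← T.mulVec_inv_mulVec hb (T.chol_mem (b := b) y) x]
  exact T.mat_mulVec_mem hb (T.chol_mem y) hx

theorem continuousOn_chol [TopologicalSpace U] [IsTopologicalAddGroup U]
    [ContinuousSMul ℝ U] [T2Space U] : ContinuousOn (T.chol b) (T.coneSet b) := by
  have := continuousMul_of_finiteDimensional U
  -- By uniqueness of the factor, points near the base point, being squares of elements of `S ∩ H`,
  -- have their factor in `S`.
  have h0 : ContinuousAt (T.chol b) (T.base b) := by
    intro S hS
    rw [T.chol_base hb] at hS
    rw [mem_map]
    filter_upwards [T.mul_star_mem_nhds hb hS] with y hy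
    obtain ⟨u, hu, h⟩ := hy
    rw [mem_preimage, T.chol_eq hu.2 h]
    exact hu.1
  intro y hy
  refine ContinuousAt.continuousWithinAt ?_
  -- Homogeneity: the factor of `x` is that of `y` times that of `A_y⁻¹ x`, and the latter point
  -- tends to the base point as `x → y`.
  have hev : T.chol b =ᶠ[𝓝 y] fun x => T.chol b y * T.chol b ((T.trans b y)⁻¹.mulVec x) := by
    filter_upwards [(T.tendsto_trans_inv hb hy).eventually_mem (T.coneSet_mem_nhds_base hb)]
      with x hx
    conv_lhs => rw [← T.mulVec_inv_mulVec hb (T.chol_mem (b := b) y) x]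
    exact T.chol_mat_mulVec hb (T.chol_mem y) hx
  refine ContinuousAt.congr ?_ hev.symm
  have h1 := h0.tendsto.comp (T.tendsto_trans_inv hb hy)
  have h2 := h1.const_mul (T.chol b y)
  rw [ContinuousAt]
  have hval : (T.trans b y)⁻¹.mulVec y = T.base b := by
    conv_lhs => enter [2]; rw [← T.trans_mulVec_base hb hy]
    rw [Matrix.mulVec_mulVec, Matrix.nonsing_inv_mul _ (T.det_trans_ne_zero hb y).isUnit,
      Matrix.one_mulVec]
  rw [hval]
  exact h2

theorem continuousOn_trans : ContinuousOn (T.trans b) (T.coneSet b) := by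
  obtain ⟨_, _, _, _⟩ := exists_topology U
  exact T.continuous_mat.comp_continuousOn (T.continuousOn_chol hb)

theorem continuousOn_diag_chol (i : Fin r) :
    ContinuousOn (fun y => T.diag i (T.chol b y)) (T.coneSet b) := by
  obtain ⟨_, _, _, _⟩ := exists_topology U
  exact (T.continuous_diag i).comp_continuousOn (T.continuousOn_chol hb)

end

theorem Q_vec (T : TAlgebra r U) (j : Fin r) {y : Fin n → ℝ} (hy : y ∈ T.coneSet b) :
    T.Q j (vec b y) = T.diag j (T.chol b y) ^ 2 := by
  rw [← T.chol_mul_star hy, T.Q_mul_star j (T.chol_mem y)]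

theorem Q_vec_pos (T : TAlgebra r U) (j : Fin r) {y : Fin n → ℝ} (hy : y ∈ T.coneSet b) :
    0 < T.Q j (vec b y) := by
  rw [T.Q_vec j hy]
  exact pow_pos ((T.chol_mem y).2 j) 2

theorem Qpow_pos (T : TAlgebra r U) (α : Fin r → ℝ) {y : Fin n → ℝ} (hy : y ∈ T.coneSet b) :
    0 < T.Qpow α (vec b y) :=
  Finset.prod_pos fun j _ => Real.rpow_pos_of_pos (T.Q_vec_pos j hy) _

theorem Qpow_add (T : TAlgebra r U) (α β : Fin r → ℝ) {y : Fin n → ℝ} (hy : y ∈ T.coneSet b) :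
    T.Qpow (fun j => α j + β j) (vec b y) = T.Qpow α (vec b y) * T.Qpow β (vec b y) := by
  simp only [Qpow, ← Finset.prod_mul_distrib]
  exact Finset.prod_congr rfl fun j _ => Real.rpow_add (T.Q_vec_pos j hy) _ _

theorem Qpow_const_mul (T : TAlgebra r U) (c : ℝ) (α : Fin r → ℝ) {y : Fin n → ℝ}
    (hy : y ∈ T.coneSet b) :
    T.Qpow (fun j => c * α j) (vec b y) = T.Qpow α (vec b y) ^ c := by
  simp only [Qpow]
  rw [← Real.finsetProd_rpow _ _ fun j _ => (Real.rpow_pos_of_pos (T.Q_vec_pos j hy) _).le]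
  refine Finset.prod_congr rfl fun j _ => ?_
  rw [mul_comm, Real.rpow_mul (T.Q_vec_pos j hy).le]

/-- The factor of `A_y v` is the product of the factors of `y` and `v`, and diagonal entries of
triangular elements multiply. -/
theorem Qpow_trans [FiniteDimensional ℝ U] (T : TAlgebra r U) (hb : T.IsOrthonormal b)
    (α : Fin r → ℝ) {y v : Fin n → ℝ} (hy : y ∈ T.coneSet b) (hv : v ∈ T.coneSet b) :
    T.Qpow α (vec b ((T.trans b y).mulVec v)) = T.Qpow α (vec b y) * T.Qpow α (vec b v) := by
  simp only [Qpow, ← Finset.prod_mul_distrib]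
  refine Finset.prod_congr rfl fun j _ => ?_
  rw [← Real.mul_rpow (T.Q_vec_pos j hy).le (T.Q_vec_pos j hv).le,
    T.Q_vec j (T.trans_mulVec_mem hb y hv), T.Q_vec j hy, T.Q_vec j hv, trans,
    T.chol_mat_mulVec hb (T.chol_mem y) hv, T.diag_mul (T.chol_mem y).1 (T.chol_mem v).1, mul_pow]

theorem continuousOn_Qpow [FiniteDimensional ℝ U] (T : TAlgebra r U) (hb : T.IsOrthonormal b)
    (α : Fin r → ℝ) : ContinuousOn (fun y => T.Qpow α (vec b y)) (T.coneSet b) := by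
  refine continuousOn_finsetProd _ fun j _ => ?_
  have h : ContinuousOn (fun y => T.Q j (vec b y)) (T.coneSet b) :=
    ((T.continuousOn_diag_chol hb j).pow 2).congr fun y hy => T.Q_vec j hy
  exact h.rpow_const fun y hy => Or.inl (T.Q_vec_pos j hy).ne'

/-- A polynomial is determined by its values near a point. -/
theorem _root_.MvPolynomial.eq_of_eventually_eval_eq {n : ℕ} {P R : MvPolynomial (Fin n) ℝ}
    {a : Fin n → ℝ} (h : ∀ᶠ x in 𝓝 a, MvPolynomial.eval x P = MvPolynomial.eval x R) : P = R := by
  obtain ⟨ε, hε, hball⟩ := Metric.eventually_nhds_iff_ball.1 h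
  -- A ball for the sup norm is a product of intervals, each an infinite set of values for its
  -- variable.
  refine MvPolynomial.funext_set (fun i => Metric.ball (a i) ε) (fun i => ?_) fun x hx => ?_
  · rw [Real.ball_eq_Ioo]
    exact Ioo_infinite (by linarith)
  · refine hball x ?_
    rw [ball_pi _ hε]
    exact hx

/-- The covariance of the symbol of the Box operator. -/
theorem compTranspose_trans [FiniteDimensional ℝ U] (T : TAlgebra r U) (hb : T.IsOrthonormal b)
    {ρ : Fin r → ℝ} {P : MvPolynomial (Fin n) ℝ}
    (hP : ∀ ξ : Fin n → ℝ, vec b ξ ∈ T.dualCone →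
      MvPolynomial.eval ξ P = T.QstarPow ρ (vec b ξ)) {y : Fin n → ℝ} (hy : y ∈ T.coneSet b) :
    compTranspose (T.trans b y) P = MvPolynomial.C (T.Qpow ρ (vec b y)) * P := by
  -- The symbol is known only on the dual cone, but that set is a neighbourhood of the base point.
  -- There `A_yᵀ` sends `t⋆ t` to `(t s)⋆ (t s)` with `s` the factor of `y`, and the diagonals
  -- multiply.
  refine MvPolynomial.eq_of_eventually_eval_eq (a := T.base b) ?_
  filter_upwards [T.dualCone_mem_nhds_base hb] with ξ hξ
  obtain ⟨t, ht, hξt⟩ := id hξ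
  have hs := T.chol_mem (b := b) y
  have h := T.vec_mat_transpose_mulVec hb hs ht hξt.symm
  rw [eval_compTranspose, map_mul, MvPolynomial.eval_C, hP ξ hξ, trans,
    hP _ ⟨t * T.chol b y, T.mul_mem_H ht hs, h.symm⟩, h, ← hξt]
  simp only [QstarPow, Qpow, ← Finset.prod_mul_distrib]
  refine Finset.prod_congr rfl fun j _ => ?_
  rw [T.Qstar_star_mul j (T.mul_mem_H ht hs), T.Qstar_star_mul j ht, T.Q_vec j hy,
    T.diag_mul ht.1 hs.1, ← Real.mul_rpow (sq_nonneg _) (sq_nonneg _), mul_pow, mul_comm]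

end TAlgebra

/-! ### Minkowski's integral inequality for extended nonnegative functions -/

section Minkowski

variable {α β : Type*} [MeasurableSpace α] [MeasurableSpace β]

theorem measurable_eLpNorm_section {G : α × β → ℝ≥0∞} (hG : Measurable G) (p : ℝ≥0∞)
    (ν : Measure β) [SFinite ν] : Measurable fun a => eLpNorm (fun x => G (a, x)) p ν := by
  rcases eq_or_ne p 0 with rfl | hp0
  · simp
  rcases eq_or_ne p ∞ with rfl | hp
  · simp only [eLpNorm_exponent_top, eLpNormEssSup, enorm_eq_self]
    refine measurable_of_Ioi fun c => ?_
    -- The essential supremum exceeds `c` exactly when the superlevel set has nonzero measure, and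
    -- the measure of a section depends measurably on the parameter.
    have : (fun a => essSup (fun x => G (a, x)) ν) ⁻¹' Set.Ioi c =
        {a | ν (Prod.mk a ⁻¹' {q | c < G q}) ≠ 0} := by
      ext a
      simp only [Set.mem_preimage, Set.mem_Ioi, Set.mem_ofPred_eq]
      rw [← not_le, not_iff_not]
      refine ⟨fun h => ?_, fun h => essSup_le_of_ae_le _ ?_⟩
      · have h1 := ae_le_essSup (f := fun x => G (a, x)) (μ := ν)
        have h2 : ∀ᵐ x ∂ν, G (a, x) ≤ c := h1.mono fun x hx => hx.trans h
        simpa [ae_iff] using h2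
      · simpa [Filter.EventuallyLE, ae_iff] using h
    rw [this]
    exact (measurable_measure_prodMk_left (measurableSet_lt measurable_const hG))
      (measurableSet_singleton 0).compl
  · simp only [eLpNorm_eq_lintegral_rpow_enorm_toReal hp0 hp, enorm_eq_self]
    exact (hG.pow_const _).lintegral_prod_right'.pow_const _

/-- Minkowski's integral inequality. -/
theorem eLpNorm_lintegral_le {G : α × β → ℝ≥0∞} (hG : Measurable G) {p : ℝ≥0∞} (hp : 1 ≤ p)
    (μ : Measure α) [SFinite μ] (ν : Measure β) [SFinite ν] :
    eLpNorm (fun x => ∫⁻ a, G (a, x) ∂μ) p ν ≤ ∫⁻ a, eLpNorm (fun x => G (a, x)) p ν ∂μ := by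
  set N : α → ℝ≥0∞ := fun a => eLpNorm (fun x => G (a, x)) p ν with hN
  have hNm : Measurable N := measurable_eLpNorm_section hG p ν
  have hp0 : p ≠ 0 := (zero_lt_one.trans_le hp).ne'
  rcases eq_or_ne p ∞ with rfl | hpt
  · rw [eLpNorm_exponent_top]
    refine essSup_le_of_ae_le _ ?_
    have h1 : ∀ᵐ a ∂μ, ∀ᵐ x ∂ν, G (a, x) ≤ N a := ae_of_all _ fun a => by
      have := ae_le_essSup (f := fun x => ‖G (a, x)‖ₑ) (μ := ν)
      simpa [hN, eLpNormEssSup] using this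
    rw [Measure.ae_ae_comm (p := fun a x => G (a, x) ≤ N a)
      (measurableSet_le (by fun_prop) (by fun_prop))] at h1
    filter_upwards [h1] with x hx
    exact lintegral_mono_ae hx
  rcases eq_or_ne (∫⁻ a, N a ∂μ) ∞ with hI | hI
  · rw [hI]; exact le_top
  set s := p.toReal with hs
  have hs1 : 1 ≤ s := by
    have := ENNReal.toReal_mono hpt hp
    simpa using this
  have hs0 : 0 < s := by linarith
  have hNfin : ∀ᵐ a ∂μ, N a < ∞ := ae_lt_top hNm hI
  have hNpow : ∀ a, N a ^ s = ∫⁻ x, G (a, x) ^ s ∂ν := fun a => by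
    simp only [hN, eLpNorm_eq_lintegral_rpow_enorm_toReal hp0 hpt, enorm_eq_self]
    rw [← ENNReal.rpow_mul, one_div, inv_mul_cancel₀ hs0.ne', ENNReal.rpow_one]
  rcases eq_or_lt_of_le hs1 with h1 | h1
  · have hp1 : p = 1 := by
      rw [← ENNReal.ofReal_toReal hpt, ← hs, ← h1, ENNReal.ofReal_one]
    subst hp1
    simp only [eLpNorm_one_eq_lintegral_enorm, enorm_eq_self, hN]
    rw [lintegral_lintegral_swap (f := fun x a => G (a, x))]
    exact (hG.comp measurable_swap).aemeasurable
  -- The reciprocal of the exponent conjugate to `s`.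
  set c : ℝ := (s - 1) / s with hc
  have hc0 : 0 < c := div_pos (by linarith) hs0
  have hcs : c * s = s - 1 := by rw [hc]; field_simp
  have hconj : s.HolderConjugate c⁻¹ := by
    rw [Real.holderConjugate_iff]
    refine ⟨h1, ?_⟩
    rw [inv_inv, hc]; field_simp; ring
  -- Hölder is applied in `a` to the splitting `G = K · N^c`. The power of `N` is chosen so that `∫
  -- K^s dx = N^{1-s} N^s = N` where `0 < N < ∞`.
  set K : α × β → ℝ≥0∞ := fun q => G q * N q.1 ^ (-c) with hK
  have hKm : Measurable K := hG.mul ((hNm.comp measurable_fst).pow_const _)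
  have hle : ∀ᵐ x ∂ν, ∀ᵐ a ∂μ, G (a, x) ≤ K (a, x) * N a ^ c := by
    rw [← Measure.ae_ae_comm (p := fun a x => G (a, x) ≤ K (a, x) * N a ^ c)
      (measurableSet_le (by fun_prop) (by fun_prop))]
    filter_upwards [hNfin] with a ha
    rcases eq_or_ne (N a) 0 with h0 | h0
    · have : (fun x => G (a, x)) =ᵐ[ν] 0 := by
        exact (eLpNorm_eq_zero_iff (f := fun x => G (a, x))
          (hG.comp measurable_prodMk_left).aestronglyMeasurable hp0).1 h0
      filter_upwards [this] with x hx
      simp only [Pi.zero_apply] at hx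
      rw [hx]; exact zero_le
    · refine ae_of_all _ fun x => ?_
      simp only [hK]
      rw [mul_assoc, ← ENNReal.rpow_add _ _ h0 ha.ne, neg_add_cancel, ENNReal.rpow_zero, mul_one]
  have hKs : ∫⁻ x, ∫⁻ a, K (a, x) ^ s ∂μ ∂ν ≤ ∫⁻ a, N a ∂μ := by
    rw [lintegral_lintegral_swap (by
      exact ((hKm.comp measurable_swap).pow_const s).aemeasurable)]
    refine lintegral_mono_ae ?_
    filter_upwards [hNfin] with a ha
    simp only [hK, ENNReal.mul_rpow_of_nonneg _ _ hs0.le, ← ENNReal.rpow_mul, neg_mul, hcs]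
    rw [lintegral_mul_const _ (by fun_prop), ← hNpow]
    rcases eq_or_ne (N a) 0 with h0 | h0
    · rw [h0, ENNReal.zero_rpow_of_pos hs0, zero_mul]
    · rw [← ENNReal.rpow_add _ _ h0 ha.ne]
      simp
  have hpt' : ∀ᵐ x ∂ν, (∫⁻ a, G (a, x) ∂μ) ^ s ≤
      (∫⁻ a, K (a, x) ^ s ∂μ) * (∫⁻ a, N a ∂μ) ^ (s - 1) := by
    filter_upwards [hle] with x hx
    have h2 : ∫⁻ a, G (a, x) ∂μ ≤
        (∫⁻ a, K (a, x) ^ s ∂μ) ^ (1 / s) * (∫⁻ a, N a ∂μ) ^ c := by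
      refine (lintegral_mono_ae hx).trans ?_
      refine (ENNReal.lintegral_mul_le_Lp_mul_Lq μ hconj (f := fun a => K (a, x))
        (g := fun a => N a ^ c) (by fun_prop) (by fun_prop)).trans_eq ?_
      simp only [← ENNReal.rpow_mul, mul_inv_cancel₀ hc0.ne', ENNReal.rpow_one, one_div, inv_inv]
    refine (ENNReal.rpow_le_rpow h2 hs0.le).trans_eq ?_
    rw [ENNReal.mul_rpow_of_nonneg _ _ hs0.le, ← ENNReal.rpow_mul, ← ENNReal.rpow_mul, hcs,
      one_div, inv_mul_cancel₀ hs0.ne', ENNReal.rpow_one]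
  rw [eLpNorm_eq_lintegral_rpow_enorm_toReal hp0 hpt, one_div, ENNReal.rpow_inv_le_iff hs0]
  simp only [enorm_eq_self]
  refine (lintegral_mono_ae hpt').trans ?_
  have hm : Measurable fun x => ∫⁻ a, K (a, x) ^ s ∂μ := (hKm.pow_const s).lintegral_prod_left'
  rw [lintegral_mul_const _ hm]
  calc _ ≤ (∫⁻ a, N a ∂μ) * (∫⁻ a, N a ∂μ) ^ (s - 1) := mul_le_mul_left hKs _
    _ = (∫⁻ a, N a ∂μ) ^ (1 : ℝ) * (∫⁻ a, N a ∂μ) ^ (s - 1) := by rw [ENNReal.rpow_one]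
    _ = (∫⁻ a, N a ∂μ) ^ s := by
      rw [← ENNReal.rpow_add_of_nonneg _ _ zero_le_one (by linarith), add_sub_cancel]

end Minkowski

/-! ### Cauchy and mean value estimates for slice norms -/

section Slices

open Set Metric

variable {n : ℕ}

/-- The tube domain over `Ω`. -/
def tubeOver (Ω : Set (Fin n → ℝ)) : Set (Fin n → ℂ) := {z | (fun j => (z j).im) ∈ Ω}

/-- The norm of the slice `f (· + i y)`. -/
def sliceNorm (p : ℝ≥0∞) (f : (Fin n → ℂ) → ℂ) (y : Fin n → ℝ) : ℝ≥0∞ :=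
  eLpNorm (fun x => f (TAlgebra.cpt x y)) p volume

theorem isOpen_tubeOver {Ω : Set (Fin n → ℝ)} (hΩ : IsOpen Ω) : IsOpen (tubeOver Ω) :=
  hΩ.preimage (by fun_prop)

theorem cpt_mem_tubeOver {Ω : Set (Fin n → ℝ)} {x y : Fin n → ℝ} :
    TAlgebra.cpt x y ∈ tubeOver Ω ↔ y ∈ Ω := by
  have : (fun j => (TAlgebra.cpt x y j).im) = y := by
    funext j
    simp [TAlgebra.cpt]
  simp only [tubeOver, mem_ofPred_eq, this]

theorem continuous_cpt : Continuous fun q : (Fin n → ℝ) × (Fin n → ℝ) =>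
    TAlgebra.cpt q.1 q.2 := by
  unfold TAlgebra.cpt
  fun_prop

theorem sliceNorm_congr {Ω : Set (Fin n → ℝ)} {f g : (Fin n → ℂ) → ℂ}
    (h : EqOn f g (tubeOver Ω)) (p : ℝ≥0∞) {y : Fin n → ℝ} (hy : y ∈ Ω) :
    sliceNorm p f y = sliceNorm p g y := by
  unfold sliceNorm
  congr 1
  funext x
  exact h (cpt_mem_tubeOver.2 hy)

/-- The function is controlled only on the tube. Extension by zero makes it globally measurable
without changing its slices over `Ω`. -/
theorem measurable_indicator_tubeOver {Ω : Set (Fin n → ℝ)} (hΩ : IsOpen Ω)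
    {f : (Fin n → ℂ) → ℂ} (hf : ContinuousOn f (tubeOver Ω)) :
    Measurable ((tubeOver Ω).indicator f) := by
  classical
  rw [← piecewise_eq_indicator]
  exact hf.measurable_piecewise continuousOn_const (isOpen_tubeOver hΩ).measurableSet

theorem sliceNorm_indicator {Ω : Set (Fin n → ℝ)} (f : (Fin n → ℂ) → ℂ) (p : ℝ≥0∞)
    {y : Fin n → ℝ} (hy : y ∈ Ω) :
    sliceNorm p ((tubeOver Ω).indicator f) y = sliceNorm p f y :=
  sliceNorm_congr (fun _ hz => indicator_of_mem hz f) p hy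

theorem measurable_sliceNorm {f : (Fin n → ℂ) → ℂ} (hf : Measurable f) (p : ℝ≥0∞) :
    Measurable (sliceNorm p f) := by
  have h : Measurable fun q : (Fin n → ℝ) × (Fin n → ℝ) => ‖f (TAlgebra.cpt q.2 q.1)‖ₑ :=
    (hf.comp (continuous_cpt.measurable.comp measurable_swap)).enorm
  have := measurable_eLpNorm_section h p volume
  simp only [eLpNorm_enorm] at this
  exact this

theorem sliceNorm_const_smul (p : ℝ≥0∞) (c : ℂ) (f : (Fin n → ℂ) → ℂ) (y : Fin n → ℝ) :
    sliceNorm p (c • f) y = ‖c‖ₑ * sliceNorm p f y :=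
  eLpNorm_const_smul c (fun x => f (TAlgebra.cpt x y)) p volume

theorem cpt_add_circleMap (x y v : Fin n → ℝ) (θ : ℝ) :
    TAlgebra.cpt x y + circleMap 0 1 θ • (fun j => (v j : ℂ)) =
      TAlgebra.cpt (x + Real.cos θ • v) (y + Real.sin θ • v) := by
  funext j
  simp only [TAlgebra.cpt, circleMap, Pi.add_apply, Pi.smul_apply, smul_eq_mul, zero_add,
    Complex.ofReal_one, one_mul, Complex.exp_mul_I, Complex.ofReal_add, Complex.ofReal_mul,
    Complex.ofReal_cos, Complex.ofReal_sin]
  ring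

/-- Slice norms of averages over circles in real directions. -/
theorem eLpNorm_le_lintegral_sliceNorm {f : (Fin n → ℂ) → ℂ} (hf : Measurable f) {p : ℝ≥0∞}
    (hp : 1 ≤ p) {k : ℝ → ℂ} (hk : Measurable k) (y v : Fin n → ℝ) {h : (Fin n → ℝ) → ℂ}
    (hh : ∀ x, ‖h x‖ₑ ≤ ∫⁻ θ in Ioc 0 (2 * Real.pi),
      ‖k θ * f (TAlgebra.cpt x y + circleMap 0 1 θ • (fun j => (v j : ℂ)))‖ₑ) :
    eLpNorm h p volume ≤
      ∫⁻ θ in Ioc 0 (2 * Real.pi), ‖k θ‖ₑ * sliceNorm p f (y + Real.sin θ • v) := by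
  set G : ℝ × (Fin n → ℝ) → ℝ≥0∞ := fun q =>
    ‖k q.1 * f (TAlgebra.cpt (q.2 + Real.cos q.1 • v) (y + Real.sin q.1 • v))‖ₑ with hG
  have hGm : Measurable G := by
    refine Measurable.enorm ((hk.comp measurable_fst).mul (hf.comp ?_))
    refine (continuous_cpt.comp (Continuous.prodMk ?_ ?_)).measurable <;> fun_prop
  have h1 : eLpNorm h p volume ≤
      eLpNorm (fun x => ∫⁻ θ in Ioc 0 (2 * Real.pi), G (θ, x)) p volume := by
    refine eLpNorm_mono_enorm fun x => ?_
    rw [enorm_eq_self]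
    refine (hh x).trans_eq ?_
    simp only [cpt_add_circleMap, hG]
  refine h1.trans ((eLpNorm_lintegral_le hGm hp _ _).trans_eq ?_)
  refine lintegral_congr fun θ => ?_
  simp only [hG]
  rw [eLpNorm_enorm]
  have h2 := eLpNorm_const_smul (k θ) (fun x : Fin n → ℝ =>
    f (TAlgebra.cpt (x + Real.cos θ • v) (y + Real.sin θ • v))) p volume
  refine h2.trans ?_
  congr 1
  have hm : Measurable fun x : Fin n → ℝ => f (TAlgebra.cpt x (y + Real.sin θ • v)) :=
    hf.comp (continuous_cpt.comp (by fun_prop : Continuous fun x : Fin n → ℝ =>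
      (x, y + Real.sin θ • v))).measurable
  -- The real part of the displacement only translates the slice, so its norm is unchanged.
  exact eLpNorm_comp_measurePreserving hm.aestronglyMeasurable
    (measurePreserving_add_right volume (Real.cos θ • v))

theorem enorm_intervalIntegral_le (g : ℝ → ℂ) {a b : ℝ} (hab : a ≤ b) :
    ‖∫ θ in a..b, g θ‖ₑ ≤ ∫⁻ θ in Ioc a b, ‖g θ‖ₑ := by
  rw [intervalIntegral.integral_of_le hab]
  exact enorm_integral_le_lintegral_enorm _

theorem add_smul_mem_tubeOver {Ω : Set (Fin n → ℝ)} {x y v : Fin n → ℝ}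
    (hv : ∀ s : ℝ, |s| ≤ 1 → y + s • v ∈ Ω) {w : ℂ} (hw : ‖w‖ ≤ 1) :
    TAlgebra.cpt x y + w • (fun j => (v j : ℂ)) ∈ tubeOver Ω := by
  have h := hv w.im ((Complex.abs_im_le_norm w).trans hw)
  simp only [tubeOver, mem_ofPred_eq]
  convert h using 1
  funext j
  simp [TAlgebra.cpt]

/-- Cauchy's formula on the unit circle in the real direction `ε e_j`, followed by Minkowski.
Imaginary parts move only by `ε sin θ e_j` and stay in the ball; the factor `1/ε` undoes the scaling
of the direction. -/
theorem sliceNorm_partialDeriv_le {Ω : Set (Fin n → ℝ)} (hΩ : IsOpen Ω) {f : (Fin n → ℂ) → ℂ}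
    (hf : DifferentiableOn ℂ f (tubeOver Ω)) {p : ℝ≥0∞} (hp : 1 ≤ p) {ε : ℝ} (hε : 0 < ε)
    {y : Fin n → ℝ} (hy : closedBall y ε ⊆ Ω) {M : ℝ≥0∞}
    (hM : ∀ y' ∈ closedBall y ε, sliceNorm p f y' ≤ M) (j : Fin n) :
    sliceNorm p (partialDeriv j f) y ≤ ENNReal.ofReal ε⁻¹ * M := by
  set v : Fin n → ℝ := Pi.single j ε with hv
  have hmem : ∀ s : ℝ, |s| ≤ 1 → y + s • v ∈ closedBall y ε := fun s hs => by
    rw [mem_closedBall, dist_self_add_left, norm_smul, hv, Pi.norm_single, Real.norm_eq_abs,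
      Real.norm_of_nonneg hε.le]
    nlinarith
  have hD := isOpen_tubeOver hΩ
  have hfm := measurable_indicator_tubeOver hΩ hf.continuousOn
  set f' := (tubeOver Ω).indicator f with hf'
  have hvc : (fun j => (v j : ℂ)) = (ε : ℂ) • Pi.single j (1 : ℂ) := by
    funext i
    by_cases hij : i = j
    · subst hij; simp [hv]
    · simp [hv, hij]
  have h1 := eLpNorm_le_lintegral_sliceNorm hfm hp
    (k := fun θ => (2 * Real.pi : ℂ)⁻¹ * (circleMap 0 1 θ)⁻¹)
    (measurable_const.mul (continuous_circleMap 0 1).measurable.inv) y v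
    (h := fun x => ((ε : ℂ) • partialDeriv j f) (TAlgebra.cpt x y)) (fun x => by
      have hin : ∀ w : ℂ, ‖w‖ ≤ 1 →
          TAlgebra.cpt x y + w • (fun j => (v j : ℂ)) ∈ tubeOver Ω :=
        fun w hw => add_smul_mem_tubeOver (fun s hs => hy (hmem s hs)) hw
      have h2 := fderiv_apply_eq_integral hD hf hin
      conv at h2 => lhs; rw [hvc, map_smul]
      rw [Pi.smul_apply, partialDeriv, h2, ← intervalIntegral.integral_const_mul]
      refine (enorm_intervalIntegral_le _ Real.two_pi_pos.le).trans_eq ?_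
      refine lintegral_congr fun θ => ?_
      rw [hf', indicator_of_mem (hin _ (by simp)), mul_assoc])
  have h3 : eLpNorm (fun x => ((ε : ℂ) • partialDeriv j f) (TAlgebra.cpt x y)) p volume =
      ‖(ε : ℂ)‖ₑ * sliceNorm p (partialDeriv j f) y := sliceNorm_const_smul p _ _ y
  have hknorm : ∀ θ : ℝ, ‖(2 * Real.pi : ℂ)⁻¹ * (circleMap 0 1 θ)⁻¹‖ₑ =
      ENNReal.ofReal (2 * Real.pi)⁻¹ := fun θ => by
    rw [← ofReal_norm]
    congr 1
    rw [norm_mul, norm_inv, norm_inv, norm_circleMap_zero]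
    simp [abs_of_pos Real.pi_pos]
  have h4 : ∫⁻ θ in Ioc 0 (2 * Real.pi), ‖(2 * Real.pi : ℂ)⁻¹ * (circleMap 0 1 θ)⁻¹‖ₑ *
      sliceNorm p f' (y + Real.sin θ • v) ≤ M := by
    calc _ ≤ ∫⁻ θ in Ioc 0 (2 * Real.pi), ENNReal.ofReal (2 * Real.pi)⁻¹ * M := by
          refine lintegral_mono fun θ => ?_
          rw [hknorm]
          gcongr
          have hin := hmem (Real.sin θ) (Real.abs_sin_le_one θ)
          rw [hf', sliceNorm_indicator f p (hy hin)]
          exact hM _ hin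
      _ = M := by
          rw [setLIntegral_const, Real.volume_Ioc, sub_zero, mul_right_comm,
            ← ENNReal.ofReal_mul (by positivity), inv_mul_cancel₀ Real.two_pi_pos.ne',
            ENNReal.ofReal_one, one_mul]
  rw [h3] at h1
  have h5 := h1.trans h4
  have hεe : ‖(ε : ℂ)‖ₑ = ENNReal.ofReal ε := by
    rw [← ofReal_norm, Complex.norm_real, Real.norm_of_nonneg hε.le]
  rw [hεe] at h5
  calc sliceNorm p (partialDeriv j f) y
      = ENNReal.ofReal ε⁻¹ * (ENNReal.ofReal ε * sliceNorm p (partialDeriv j f) y) := by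
        rw [← mul_assoc, ← ENNReal.ofReal_mul (by positivity), inv_mul_cancel₀ hε.ne',
          ENNReal.ofReal_one, one_mul]
    _ ≤ _ := by gcongr

/-- The mean value property with a weight that vanishes at the real points of the circle. -/
theorem eq_weighted_circle_mean {D : Set (Fin n → ℂ)} (hD : IsOpen D) {f : (Fin n → ℂ) → ℂ}
    (hf : DifferentiableOn ℂ f D) {z v : Fin n → ℂ} (hv : ∀ w : ℂ, ‖w‖ ≤ 1 → z + w • v ∈ D)
    (N : ℕ) : f z = ∫ θ in (0 : ℝ)..2 * Real.pi,
      ((2 * Real.pi : ℂ)⁻¹ * (1 - circleMap 0 1 θ ^ 2) ^ N) * f (z + circleMap 0 1 θ • v) := by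
  -- The factor `(1 - w²)^N` is holomorphic and equals `1` at `w = 0`, so the ordinary mean value
  -- property still returns `f z`.
  have hdiff : DifferentiableOn ℂ (fun w : ℂ => (1 - w ^ 2) ^ N * f (z + w • v))
      (closedBall 0 1) := by
    intro w hw
    have hw' : z + w • v ∈ D := hv w (by simpa using hw)
    have h1 : DifferentiableAt ℂ (fun w : ℂ => f (z + w • v)) w :=
      (hf.differentiableAt (hD.mem_nhds hw')).comp w (by fun_prop)
    exact (DifferentiableAt.mul (by fun_prop) h1).differentiableWithinAt
  have h := (hdiff.mono (closure_ball_subset_closedBall (x := (0 : ℂ)) (ε := |1|)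
    |>.trans (by simp))).diffContOnCl.circleAverage
  rw [Real.circleAverage] at h
  simp only [Complex.real_smul, zero_smul, add_zero] at h
  rw [← intervalIntegral.integral_const_mul] at h
  have h0 : (1 - (0 : ℂ) ^ 2) ^ N * f z = f z := by simp
  rw [h0] at h
  rw [← h]
  congr 1
  funext θ
  push_cast
  ring

theorem enorm_one_sub_circleMap_sq (θ : ℝ) (N : ℕ) :
    ‖((2 * Real.pi : ℂ)⁻¹ * (1 - circleMap 0 1 θ ^ 2) ^ N)‖ₑ =
      ENNReal.ofReal ((2 * Real.pi)⁻¹ * (2 ^ N * |Real.sin θ| ^ N)) := by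
  have h : 1 - circleMap 0 1 θ ^ 2 = -2 * Complex.I * Real.sin θ * circleMap 0 1 θ := by
    simp only [circleMap, zero_add, Complex.ofReal_one, one_mul, Complex.exp_mul_I,
      Complex.ofReal_sin]
    have h1 := Complex.sin_sq_add_cos_sq (θ : ℂ)
    linear_combination (-1 : ℂ) * h1 + Complex.sin θ ^ 2 * Complex.I_sq
  rw [← ofReal_norm]
  congr 1
  rw [h]
  simp [-Complex.ofReal_sin, norm_pow, abs_of_pos Real.pi_pos, mul_pow]

/-- The substitution `u = c v` costs `|c|^{-n}`, which the prefactor absorbs. The exponent `n + 1`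
instead of `n` makes the prefactor vanish at `c = 0` even for `n = 0`. -/
theorem lintegral_ball_smul_le {g : (Fin n → ℝ) → ℝ≥0∞} (hg : Measurable g) (δ : ℝ) {c : ℝ}
    (hc : |c| ≤ 1) : ENNReal.ofReal (|c| ^ (n + 1)) * ∫⁻ v in ball 0 δ, g (c • v) ≤
      ∫⁻ v in ball 0 δ, g v := by
  rcases eq_or_ne c 0 with rfl | hc0
  · simp
  have hc' : 0 < |c| := abs_pos.2 hc0
  have hgi : Measurable ((ball (0 : Fin n → ℝ) δ).indicator g) := hg.indicator measurableSet_ball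
  have h1 : ∫⁻ v in ball 0 δ, g (c • v) ≤ ∫⁻ v, (ball (0 : Fin n → ℝ) δ).indicator g (c • v) := by
    rw [← lintegral_indicator measurableSet_ball]
    refine lintegral_mono fun v => ?_
    by_cases hv : v ∈ ball (0 : Fin n → ℝ) δ
    · rw [indicator_of_mem hv, indicator_of_mem]
      rw [mem_ball_zero_iff] at hv ⊢
      rw [norm_smul, Real.norm_eq_abs]
      nlinarith [norm_nonneg v]
    · rw [indicator_of_notMem hv]; exact zero_le
  have h2 : ∫⁻ v, (ball (0 : Fin n → ℝ) δ).indicator g (c • v) =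
      ENNReal.ofReal |(c ^ n)⁻¹| * ∫⁻ v in ball 0 δ, g v := by
    rw [← lintegral_map hgi (measurable_const_smul c), Measure.map_addHaar_smul _ hc0,
      lintegral_smul_measure, lintegral_indicator measurableSet_ball]
    simp
  rw [h2] at h1
  calc _ ≤ ENNReal.ofReal (|c| ^ (n + 1)) *
        (ENNReal.ofReal |(c ^ n)⁻¹| * ∫⁻ v in ball 0 δ, g v) := by gcongr
    _ = ENNReal.ofReal |c| * ∫⁻ v in ball 0 δ, g v := by
        rw [← mul_assoc, ← ENNReal.ofReal_mul (by positivity), abs_inv, abs_pow, pow_succ']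
        congr 2
        field_simp
    _ ≤ 1 * ∫⁻ v in ball 0 δ, g v := by
        gcongr
        exact ENNReal.ofReal_le_one.2 hc
    _ = _ := one_mul _

/-- The sub-mean value property of slice norms of holomorphic functions. -/
theorem volume_ball_mul_sliceNorm_le {Ω : Set (Fin n → ℝ)} (hΩ : IsOpen Ω)
    {f : (Fin n → ℂ) → ℂ} (hf : DifferentiableOn ℂ f (tubeOver Ω)) {p : ℝ≥0∞} (hp : 1 ≤ p)
    {δ : ℝ} {y : Fin n → ℝ} (hy : ball y δ ⊆ Ω) :
    volume (ball (0 : Fin n → ℝ) δ) * sliceNorm p f y ≤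
      2 ^ (n + 1) * ∫⁻ y' in ball y δ, sliceNorm p f y' := by
  rcases le_or_gt δ 0 with hδ | hδ
  · simp [ball_eq_empty.2 hδ]
  have hD := isOpen_tubeOver hΩ
  have hfm := measurable_indicator_tubeOver hΩ hf.continuousOn
  set f' := (tubeOver Ω).indicator f with hf'
  have hF := measurable_sliceNorm hfm p
  set F := sliceNorm p f' with hFdef
  have hFy : F y = sliceNorm p f y := sliceNorm_indicator f p (hy (mem_ball_self hδ))
  set k : ℝ → ℂ := fun θ => (2 * Real.pi : ℂ)⁻¹ * (1 - circleMap 0 1 θ ^ 2) ^ (n + 1) with hk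
  have hkc : Continuous k := by
    have := continuous_circleMap 0 1
    fun_prop
  -- Each real direction `v` gives one inequality. Integrating over `v` in the ball then replaces
  -- values on segments by a volume average.
  have hmean : ∀ v ∈ ball (0 : Fin n → ℝ) δ,
      F y ≤ ∫⁻ θ in Ioc 0 (2 * Real.pi), ‖k θ‖ₑ * F (y + Real.sin θ • v) := by
    intro v hv
    rw [hFy]
    refine eLpNorm_le_lintegral_sliceNorm hfm hp hkc.measurable y v fun x => ?_
    have hmem : ∀ s : ℝ, |s| ≤ 1 → y + s • v ∈ Ω := fun s hs => hy (by
      rw [mem_ball_zero_iff] at hv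
      rw [mem_ball, dist_self_add_left, norm_smul, Real.norm_eq_abs]
      nlinarith [norm_nonneg v])
    have hin : ∀ w : ℂ, ‖w‖ ≤ 1 →
        TAlgebra.cpt x y + w • (fun j => (v j : ℂ)) ∈ tubeOver Ω :=
      fun w hw => add_smul_mem_tubeOver hmem hw
    conv_lhs => rw [eq_weighted_circle_mean hD hf hin (n + 1)]
    refine (enorm_intervalIntegral_le _ Real.two_pi_pos.le).trans_eq ?_
    refine lintegral_congr fun θ => ?_
    rw [hf', indicator_of_mem (hin _ (by simp))]
  have hswap : Measurable fun q : (Fin n → ℝ) × ℝ => ‖k q.2‖ₑ * F (y + Real.sin q.2 • q.1) :=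
    (hkc.measurable.comp measurable_snd).enorm.mul (hF.comp (by fun_prop))
  calc volume (ball (0 : Fin n → ℝ) δ) * sliceNorm p f y
      = ∫⁻ v in ball (0 : Fin n → ℝ) δ, F y := by rw [setLIntegral_const, hFy, mul_comm]
    _ ≤ ∫⁻ v in ball (0 : Fin n → ℝ) δ,
          ∫⁻ θ in Ioc 0 (2 * Real.pi), ‖k θ‖ₑ * F (y + Real.sin θ • v) :=
        setLIntegral_mono' measurableSet_ball hmean
    _ = ∫⁻ θ in Ioc 0 (2 * Real.pi),
          ∫⁻ v in ball (0 : Fin n → ℝ) δ, ‖k θ‖ₑ * F (y + Real.sin θ • v) :=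
        lintegral_lintegral_swap hswap.aemeasurable
    -- The weight contributes `(2 |sin θ|)^{n+1}`, which pays for the substitution `v ↦ sin θ v`,
    -- singular at real points of the circle.
    _ ≤ ∫⁻ θ in Ioc 0 (2 * Real.pi), ENNReal.ofReal ((2 * Real.pi)⁻¹ * 2 ^ (n + 1)) *
          ∫⁻ v in ball (0 : Fin n → ℝ) δ, F (y + v) := by
        refine lintegral_mono fun θ => ?_
        have hFθ : Measurable fun v : Fin n → ℝ => F (y + Real.sin θ • v) :=
          hF.comp (by fun_prop : Measurable fun v : Fin n → ℝ => y + Real.sin θ • v)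
        rw [lintegral_const_mul _ hFθ, hk, enorm_one_sub_circleMap_sq,
          ← mul_assoc, ENNReal.ofReal_mul (by positivity), mul_assoc]
        gcongr
        exact lintegral_ball_smul_le (g := fun v => F (y + v)) (hF.comp (by fun_prop)) δ
          (Real.abs_sin_le_one θ)
    _ = 2 ^ (n + 1) * ∫⁻ v in ball (0 : Fin n → ℝ) δ, F (y + v) := by
        rw [setLIntegral_const, Real.volume_Ioc, sub_zero, mul_right_comm,
          ← ENNReal.ofReal_mul (by positivity), mul_right_comm,
          inv_mul_cancel₀ Real.two_pi_pos.ne', one_mul, ENNReal.ofReal_pow (by norm_num)]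
        simp
    _ = 2 ^ (n + 1) * ∫⁻ y' in ball y δ, F y' := by
        congr 1
        rw [← lintegral_indicator measurableSet_ball, ← lintegral_indicator measurableSet_ball,
          ← lintegral_add_left_eq_self ((ball y δ).indicator F) y]
        refine lintegral_congr fun v => ?_
        by_cases hv : v ∈ ball (0 : Fin n → ℝ) δ
        · rw [indicator_of_mem hv, indicator_of_mem]
          simpa using hv
        · rw [indicator_of_notMem hv, indicator_of_notMem]
          simpa using hv
    _ = 2 ^ (n + 1) * ∫⁻ y' in ball y δ, sliceNorm p f y' := by
        congr 1
        exact setLIntegral_congr_fun measurableSet_ball fun y' hy' =>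
          sliceNorm_indicator f p (hy hy')

end Slices

/-! ### Local estimates at a point for constant coefficient operators -/

section LocalEstimate

open Set Metric

variable {n : ℕ}

/-- An operator on holomorphic functions on a tube whose slice norms on a ball around `e` are
controlled by the slice norms of the argument on larger balls. -/
structure SliceBounded (Ω : Set (Fin n → ℝ)) (e : Fin n → ℝ) (p : ℝ≥0∞)
    (L : ((Fin n → ℂ) → ℂ) → (Fin n → ℂ) → ℂ) : Prop where
  holo : ∀ f, DifferentiableOn ℂ f (tubeOver Ω) → DifferentiableOn ℂ (L f) (tubeOver Ω)
  -- Every pair of radii is allowed, so the shrinking of the ball can be shared among the factors of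
  -- a composition.
  bound : ∀ s t : ℝ, 0 < s → s < t → closedBall e t ⊆ Ω → ∃ C : ℝ≥0, ∀ f,
    DifferentiableOn ℂ f (tubeOver Ω) → ∀ M : ℝ≥0∞,
      (∀ y ∈ closedBall e t, sliceNorm p f y ≤ M) →
      ∀ y ∈ closedBall e s, sliceNorm p (L f) y ≤ C * M

namespace SliceBounded

variable {Ω : Set (Fin n → ℝ)} {e : Fin n → ℝ} {p : ℝ≥0∞}

theorem id : SliceBounded Ω e p id :=
  ⟨fun _ h => h, fun s t _ hst _ => ⟨1, fun f _ M hM y hy => by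
    simpa using hM y (closedBall_subset_closedBall hst.le hy)⟩⟩

theorem comp {L L' : ((Fin n → ℂ) → ℂ) → (Fin n → ℂ) → ℂ} (h : SliceBounded Ω e p L)
    (h' : SliceBounded Ω e p L') : SliceBounded Ω e p (L ∘ L') := by
  refine ⟨fun f hf => h.holo _ (h'.holo f hf), fun s t hs hst ht => ?_⟩
  obtain ⟨C, hC⟩ := h.bound s ((s + t) / 2) hs (by linarith)
    ((closedBall_subset_closedBall (by linarith)).trans ht)
  obtain ⟨C', hC'⟩ := h'.bound ((s + t) / 2) t (by linarith) (by linarith) ht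
  refine ⟨C * C', fun f hf M hM y hy => ?_⟩
  have := hC _ (h'.holo f hf) (C' * M) (hC' f hf M hM) y hy
  rwa [← mul_assoc, ← ENNReal.coe_mul] at this

theorem iterate {L : ((Fin n → ℂ) → ℂ) → (Fin n → ℂ) → ℂ} (h : SliceBounded Ω e p L) (k : ℕ) :
    SliceBounded Ω e p (L^[k]) := by
  induction k with
  | zero => exact id
  | succ k ih =>
    rw [Function.iterate_succ']
    exact h.comp ih

theorem partialDeriv (hΩ : IsOpen Ω) (hp : 1 ≤ p) (j : Fin n) :
    SliceBounded Ω e p (partialDeriv j) := by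
  refine ⟨fun f hf => differentiableOn_partialDeriv (isOpen_tubeOver hΩ) hf j,
    fun s t hs hst ht => ⟨(t - s)⁻¹.toNNReal, fun f hf M hM y hy => ?_⟩⟩
  have hsub : closedBall y (t - s) ⊆ closedBall e t :=
    closedBall_subset_closedBall' (by have := mem_closedBall.1 hy; linarith)
  exact sliceNorm_partialDeriv_le hΩ hf hp (by linarith) (hsub.trans ht)
    (fun y' hy' => hM y' (hsub hy')) j

theorem const_smul {L : ((Fin n → ℂ) → ℂ) → (Fin n → ℂ) → ℂ} (h : SliceBounded Ω e p L) (c : ℂ) :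
    SliceBounded Ω e p (fun f => c • L f) := by
  refine ⟨fun f hf => (h.holo f hf).const_smul c, fun s t hs hst ht => ?_⟩
  obtain ⟨C, hC⟩ := h.bound s t hs hst ht
  refine ⟨‖c‖₊ * C, fun f hf M hM y hy => ?_⟩
  rw [sliceNorm_const_smul, ENNReal.coe_mul, mul_assoc]
  exact mul_le_mul_right (hC f hf M hM y hy) _

theorem add {L L' : ((Fin n → ℂ) → ℂ) → (Fin n → ℂ) → ℂ} (hp : 1 ≤ p)
    (h : SliceBounded Ω e p L) (h' : SliceBounded Ω e p L') :
    SliceBounded Ω e p (fun f => L f + L' f) := by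
  refine ⟨fun f hf => (h.holo f hf).add (h'.holo f hf), fun s t hs hst ht => ?_⟩
  obtain ⟨C, hC⟩ := h.bound s t hs hst ht
  obtain ⟨C', hC'⟩ := h'.bound s t hs hst ht
  refine ⟨C + C', fun f hf M hM y hy => ?_⟩
  have hyΩ : y ∈ Ω := ht (closedBall_subset_closedBall hst.le hy)
  have hcont : ∀ g : (Fin n → ℂ) → ℂ, DifferentiableOn ℂ g (tubeOver Ω) →
      AEStronglyMeasurable (fun x => g (TAlgebra.cpt x y)) volume := fun g hg =>
    (hg.continuousOn.comp_continuous
      (continuous_cpt.comp (by fun_prop : Continuous fun x : Fin n → ℝ => (x, y)))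
      fun x => cpt_mem_tubeOver.2 hyΩ).aestronglyMeasurable
  refine (eLpNorm_add_le (hcont _ (h.holo f hf)) (hcont _ (h'.holo f hf)) hp).trans ?_
  rw [ENNReal.coe_add, add_mul]
  exact add_le_add (hC f hf M hM y hy) (hC' f hf M hM y hy)

theorem sum {ι : Type*} (hp : 1 ≤ p) (S : Finset ι)
    {L : ι → ((Fin n → ℂ) → ℂ) → (Fin n → ℂ) → ℂ} (h : ∀ i, SliceBounded Ω e p (L i)) :
    SliceBounded Ω e p (fun f => ∑ i ∈ S, L i f) := by
  classical
  induction S using Finset.induction_on with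
  | empty => simpa using (id (Ω := Ω) (e := e) (p := p)).const_smul 0
  | insert a S ha ih =>
    simp only [Finset.sum_insert ha]
    exact (h a).add hp ih

theorem multiDeriv (hΩ : IsOpen Ω) (hp : 1 ≤ p) (α : Fin n →₀ ℕ) :
    SliceBounded Ω e p (multiDeriv α) := by
  have : ∀ l : List (Fin n), SliceBounded Ω e p (listDeriv α l) := fun l => by
    induction l with
    | nil => exact id
    | cons a l ih => exact ((partialDeriv hΩ hp a).iterate _).comp ih
  exact this _

theorem symbolOp (hΩ : IsOpen Ω) (hp : 1 ≤ p) (P : MvPolynomial (Fin n) ℝ) :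
    SliceBounded Ω e p (symbolOp P) := by
  have h := sum (Ω := Ω) (e := e) hp P.support fun α => (multiDeriv hΩ hp α).const_smul
    (((P.coeff α : ℝ) : ℂ) * (-Complex.I) ^ (∑ j, α j))
  convert h using 2 with f
  funext z
  simp [_root_.symbolOp]

/-- The slice norm at the centre of a ball is controlled by an average over the ball. -/
theorem le_lintegral (hΩ : IsOpen Ω) (hp : 1 ≤ p)
    {L : ((Fin n → ℂ) → ℂ) → (Fin n → ℂ) → ℂ} (h : SliceBounded Ω e p L) {δ : ℝ} (hδ : 0 < δ)
    (hball : closedBall e δ ⊆ Ω) :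
    ∃ C : ℝ≥0, ∀ f, DifferentiableOn ℂ f (tubeOver Ω) →
      sliceNorm p (L f) e ≤ C * ∫⁻ v in ball e δ, sliceNorm p f v := by
  -- Half the radius is kept for the averages: balls of radius `δ / 2` centred in the ball of radius
  -- `δ / 2` stay inside the one of radius `δ`.
  obtain ⟨C, hC⟩ := h.bound (δ / 4) (δ / 2) (by linarith) (by linarith)
    ((closedBall_subset_closedBall (by linarith)).trans hball)
  set V := volume (ball (0 : Fin n → ℝ) (δ / 2)) with hV
  have hV0 : V ≠ 0 := (measure_ball_pos volume _ (by linarith)).ne'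
  have hVt : V ≠ ∞ := measure_ball_lt_top.ne
  have hK : V⁻¹ * 2 ^ (n + 1) ≠ ∞ :=
    ENNReal.mul_ne_top (ENNReal.inv_ne_top.2 hV0) (by simp)
  refine ⟨C * (V⁻¹ * 2 ^ (n + 1)).toNNReal, fun f hf => ?_⟩
  rw [ENNReal.coe_mul, ENNReal.coe_toNNReal hK, mul_assoc]
  refine hC f hf _ (fun y hy => ?_) e (mem_closedBall_self (by linarith))
  have hsub : ball y (δ / 2) ⊆ ball e δ :=
    ball_subset_ball' (by have := mem_closedBall.1 hy; linarith)
  have h1 := volume_ball_mul_sliceNorm_le hΩ hf hp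
    (hsub.trans (ball_subset_closedBall.trans hball))
  calc sliceNorm p f y = V⁻¹ * (V * sliceNorm p f y) := by
        rw [← mul_assoc, ENNReal.inv_mul_cancel hV0 hVt, one_mul]
    _ ≤ V⁻¹ * (2 ^ (n + 1) * ∫⁻ v in ball e δ, sliceNorm p f v) := by
        refine mul_le_mul_right (h1.trans ?_) _
        gcongr
    _ = _ := by rw [mul_assoc]

end SliceBounded

theorem cmul_cpt (M : Matrix (Fin n) (Fin n) ℝ) (x y : Fin n → ℝ) :
    cmul M (TAlgebra.cpt x y) = TAlgebra.cpt (M.mulVec x) (M.mulVec y) := by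
  funext i
  simp only [cmul_apply, TAlgebra.cpt, Matrix.mulVec, dotProduct]
  push_cast
  rw [Finset.sum_mul, ← Finset.sum_add_distrib]
  exact Finset.sum_congr rfl fun j _ => by ring

theorem mapsTo_cmul {Ω : Set (Fin n → ℝ)} {M : Matrix (Fin n) (Fin n) ℝ}
    (hM : ∀ y ∈ Ω, M.mulVec y ∈ Ω) : MapsTo (cmul M) (tubeOver Ω) (tubeOver Ω) := by
  intro z hz
  have : z = TAlgebra.cpt (fun j => (z j).re) (fun j => (z j).im) := by
    funext j
    simp [TAlgebra.cpt, Complex.re_add_im]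
  rw [this, cmul_cpt, cpt_mem_tubeOver]
  exact hM _ hz

/-- Change of variables in `x`: the constant is `|det M|^{-1/p}`, equal to `1` for `p = ∞`. What
matters is that it is positive, finite and independent of `f` and `y`, so it cancels from
homogeneous inequalities. -/
theorem exists_sliceNorm_comp_cmul {M : Matrix (Fin n) (Fin n) ℝ} (hM : M.det ≠ 0) (p : ℝ≥0∞) :
    ∃ κ : ℝ≥0∞, κ ≠ 0 ∧ κ ≠ ∞ ∧ ∀ (f : (Fin n → ℂ) → ℂ) (y : Fin n → ℝ),
      sliceNorm p (f ∘ cmul M) y = κ * sliceNorm p f (M.mulVec y) := by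
  have hc : ENNReal.ofReal |M.det⁻¹| ≠ 0 := by
    rw [Ne, ENNReal.ofReal_eq_zero, not_le]
    positivity
  refine ⟨ENNReal.ofReal |M.det⁻¹| ^ (1 / p).toReal, ?_, ?_, fun f y => ?_⟩
  · simp [ENNReal.rpow_eq_zero_iff, hM]
  · simp [ENNReal.rpow_eq_top_iff, hM]
  · have hemb : MeasurableEmbedding (Matrix.toLin' M) := by
      have hdet : (Matrix.toLin' M).det ≠ 0 := by rwa [LinearMap.det_toLin']
      exact ((LinearMap.equivOfDetNeZero _
        hdet).toContinuousLinearEquiv.toHomeomorph).measurableEmbedding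
    have h := hemb.eLpNorm_map_measure (μ := volume) (p := p)
      (g := fun x => f (TAlgebra.cpt x (M.mulVec y)))
    rw [Real.map_matrix_volume_pi_eq_smul_volume_pi hM, eLpNorm_smul_measure_of_ne_zero hc] at h
    rw [sliceNorm, sliceNorm, ← smul_eq_mul, h]
    congr 1
    funext x
    simp only [Function.comp, cmul_cpt, Matrix.toLin'_apply]

end LocalEstimate

/-! ### Covariance of the Box operator and the pointwise estimate -/

namespace TAlgebra

open Set Metric

variable {r n : ℕ} {U : Type*} [NonUnitalNonAssocRing U] [Module ℝ U]
  [IsScalarTower ℝ U U] [SMulCommClass ℝ U U] [StarRing U] [StarModule ℝ U]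
  [FiniteDimensional ℝ U] {b : Module.Basis (Fin n) ℝ (selfAdjoint.submodule ℝ U)}
  (T : TAlgebra r U) (hb : T.IsOrthonormal b)
include hb

theorem differentiableOn_box_iterate {ρ : Fin r → ℝ} (hρ : T.IsIntegralVector b ρ) (k : ℕ)
    {f : (Fin n → ℂ) → ℂ} (hf : DifferentiableOn ℂ f (T.tube b)) :
    DifferentiableOn ℂ ((T.box b hρ)^[k] f) (T.tube b) := by
  induction k with
  | zero => exact hf
  | succ k ih =>
    rw [Function.iterate_succ_apply']
    exact differentiableOn_symbolOp (isOpen_tubeOver (T.isOpen_coneSet hb)) ih _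

/-- The covariance of the powers of the Box operator. -/
theorem box_iterate_comp_cmul {ρ : Fin r → ℝ} (hρ : T.IsIntegralVector b ρ) (k : ℕ)
    {f : (Fin n → ℂ) → ℂ} (hf : DifferentiableOn ℂ f (T.tube b)) {y : Fin n → ℝ}
    (hy : y ∈ T.coneSet b) :
    EqOn ((T.box b hρ)^[k] (f ∘ cmul (T.trans b y)))
      (((T.Qpow ρ (vec b y) : ℂ) ^ k) • ((T.box b hρ)^[k] f ∘ cmul (T.trans b y)))
      (T.tube b) := by
  have hD : IsOpen (T.tube b) := isOpen_tubeOver (T.isOpen_coneSet hb)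
  have hmaps : MapsTo (cmul (T.trans b y)) (T.tube b) (T.tube b) :=
    mapsTo_cmul fun v hv => T.trans_mulVec_mem hb y hv
  induction k with
  | zero => intro z _; simp
  | succ k ih =>
    intro z hz
    have hk := T.differentiableOn_box_iterate hb hρ k hf
    have hcomp : DifferentiableOn ℂ ((T.box b hρ)^[k] f ∘ cmul (T.trans b y)) (T.tube b) :=
      hk.comp (differentiable_cmul _).differentiableOn hmaps
    rw [Function.iterate_succ_apply', Function.iterate_succ_apply', box,
      symbolOp_congr hD ih _ hz, symbolOp_const_smul hD hcomp _ _ hz, Pi.smul_apply,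
      symbolOp_comp_cmul hD hD hk hmaps _ hz,
      T.compTranspose_trans hb hρ.2.choose_spec hy, symbolOp_C_mul]
    simp only [Pi.smul_apply, Function.comp, smul_eq_mul]
    rw [pow_succ, mul_assoc]
    rfl

/-- The pointwise estimate of the slice norms of `Box ^ k f`. -/
theorem exists_sliceNorm_box_le {ρ : Fin r → ℝ} (hρ : T.IsIntegralVector b ρ) (k : ℕ)
    {p : ℝ≥0∞} (hp : 1 ≤ p) {δ : ℝ} (hδ : 0 < δ) (hball : closedBall (T.base b) δ ⊆ T.coneSet b) :
    ∃ C : ℝ≥0, ∀ f, DifferentiableOn ℂ f (T.tube b) → ∀ y ∈ T.coneSet b,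
      ENNReal.ofReal (T.Qpow ρ (vec b y) ^ k) * sliceNorm p ((T.box b hρ)^[k] f) y ≤
        C * ∫⁻ v in ball (T.base b) δ, sliceNorm p f ((T.trans b y).mulVec v) := by
  have hΩ := T.isOpen_coneSet hb
  obtain ⟨C, hC⟩ := ((SliceBounded.symbolOp (e := T.base b) hΩ hp hρ.2.choose).iterate k).le_lintegral
    hΩ hp hδ hball
  refine ⟨C, fun f hf y hy => ?_⟩
  have hmaps : MapsTo (cmul (T.trans b y)) (T.tube b) (T.tube b) :=
    mapsTo_cmul fun v hv => T.trans_mulVec_mem hb y hv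
  obtain ⟨κ, hκ0, hκt, hκ⟩ := exists_sliceNorm_comp_cmul (T.det_trans_ne_zero hb y) p
  -- The local estimate at the base point is used for `f ∘ A_y`; covariance turns its left side into
  -- data of `Box^k f` at `A_y e = y`.
  have h1 := hC (f ∘ cmul (T.trans b y))
    (hf.comp (differentiable_cmul _).differentiableOn hmaps)
  have h2 := sliceNorm_congr (T.box_iterate_comp_cmul hb hρ k hf hy) p (T.base_mem hb)
  simp only [hκ] at h1
  rw [lintegral_const_mul' _ _ hκt] at h1
  change sliceNorm p ((T.box b hρ)^[k] (f ∘ cmul (T.trans b y))) (T.base b) ≤ _ at h1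
  rw [h2, sliceNorm_const_smul, hκ, T.trans_mulVec_base hb hy] at h1
  have hQ : ‖((T.Qpow ρ (vec b y) : ℂ) ^ k)‖ₑ = ENNReal.ofReal (T.Qpow ρ (vec b y) ^ k) := by
    rw [← ofReal_norm, norm_pow, Complex.norm_real, Real.norm_of_nonneg (T.Qpow_pos ρ hy).le]
  rw [hQ, mul_left_comm, mul_left_comm (C : ℝ≥0∞)] at h1
  exact (ENNReal.mul_le_mul_iff_right hκ0 hκt).1 h1

end TAlgebra

/-! ### A Schur test by Tonelli's theorem -/

section Schur

open Set

/-- A Schur type estimate for a kernel supported in a set `S` on which the weights `w / J` are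
comparable. -/
theorem lintegral_kernel_le {n : ℕ} {Ω : Set (Fin n → ℝ)} (hΩ : MeasurableSet Ω)
    {S : Set ((Fin n → ℝ) × (Fin n → ℝ))} (hS : MeasurableSet S) {w J : (Fin n → ℝ) → ℝ}
    (hw : ∀ y ∈ Ω, 0 < w y) (hJ : ∀ y, 0 < J y)
    (hm : Measurable (Ω.indicator fun x => w x * (J x)⁻¹)) {C : ℝ} (hC : 0 ≤ C) {V : ℝ≥0∞}
    (hV : V ≠ ∞) (hSΩ : ∀ y x, y ∈ Ω → (y, x) ∈ S → x ∈ Ω)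
    (hle : ∀ y x, y ∈ Ω → (y, x) ∈ S → w y * (J y)⁻¹ ≤ C * (w x * (J x)⁻¹))
    (hvol : ∀ x ∈ Ω, volume {y | (y, x) ∈ S} ≤ ENNReal.ofReal (J x) * V)
    {Φ : (Fin n → ℝ) → ℝ≥0∞} (hΦ : Measurable Φ) :
    ∫⁻ y in Ω, ENNReal.ofReal (w y) *
        (ENNReal.ofReal (J y)⁻¹ * ∫⁻ x, {x | (y, x) ∈ S}.indicator Φ x) ≤
      ENNReal.ofReal C * V * ∫⁻ y in Ω, ENNReal.ofReal (w y) * Φ y := by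
  -- The weight at `y` is traded for the one at `x`, so that the integrand depends on `y` only
  -- through membership in `S`. The indicator makes `g` measurable on the whole space.
  set g : (Fin n → ℝ) → ℝ≥0∞ := fun x => ENNReal.ofReal C *
    (ENNReal.ofReal (Ω.indicator (fun x => w x * (J x)⁻¹) x) * Φ x) with hg
  have hgm : Measurable g := by fun_prop
  have hgeq : ∀ x ∈ Ω, g x = ENNReal.ofReal C * (ENNReal.ofReal (w x) *
      ENNReal.ofReal (J x)⁻¹ * Φ x) := fun x hx => by
    simp only [hg, indicator_of_mem hx]
    rw [ENNReal.ofReal_mul (hw x hx).le]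
  have hgz : ∀ x ∉ Ω, g x = 0 := fun x hx => by
    simp [hg, indicator_of_notMem hx]
  set G : (Fin n → ℝ) × (Fin n → ℝ) → ℝ≥0∞ := S.indicator fun q => g q.2 with hG
  have hGm : Measurable G := (hgm.comp measurable_snd).indicator hS
  have hstep1 : ∀ y ∈ Ω, ENNReal.ofReal (w y) *
      (ENNReal.ofReal (J y)⁻¹ * ∫⁻ x, {x | (y, x) ∈ S}.indicator Φ x) ≤ ∫⁻ x, G (y, x) := by
    intro y hy
    rw [← mul_assoc, ← lintegral_const_mul' _ _ (by finiteness)]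
    refine lintegral_mono fun x => ?_
    by_cases hx : (y, x) ∈ S
    · have hxΩ := hSΩ y x hy hx
      rw [indicator_of_mem (show x ∈ {x | (y, x) ∈ S} from hx), hG, indicator_of_mem hx,
        hgeq x hxΩ, ← mul_assoc, ← ENNReal.ofReal_mul (hw y hy).le,
        ← ENNReal.ofReal_mul (hw x hxΩ).le, ← ENNReal.ofReal_mul hC]
      exact mul_le_mul_left (ENNReal.ofReal_le_ofReal (hle y x hy hx)) _
    · rw [indicator_of_notMem (show x ∉ {x | (y, x) ∈ S} from hx), mul_zero]
      exact zero_le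
  have hstep2 : ∀ x, ∫⁻ y, G (y, x) ≤ Ω.indicator (fun x => (ENNReal.ofReal C * V) *
      (ENNReal.ofReal (w x) * Φ x)) x := by
    intro x
    have hind : ∀ y, G (y, x) = {y | (y, x) ∈ S}.indicator (fun _ => g x) y := fun y => by
      by_cases h : (y, x) ∈ S
      · rw [hG, indicator_of_mem h, indicator_of_mem (show y ∈ {y | (y, x) ∈ S} from h)]
      · rw [hG, indicator_of_notMem h, indicator_of_notMem (show y ∉ {y | (y, x) ∈ S} from h)]
    have hSx : MeasurableSet {y | (y, x) ∈ S} := hS.preimage measurable_prodMk_right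
    simp only [hind]
    rw [lintegral_indicator_const hSx]
    by_cases hx : x ∈ Ω
    · rw [hgeq x hx, indicator_of_mem hx]
      calc _ ≤ ENNReal.ofReal C * (ENNReal.ofReal (w x) * ENNReal.ofReal (J x)⁻¹ * Φ x) *
            (ENNReal.ofReal (J x) * V) := mul_le_mul_right (hvol x hx) _
        _ = ENNReal.ofReal C * V * (ENNReal.ofReal (w x) * Φ x) *
            (ENNReal.ofReal (J x)⁻¹ * ENNReal.ofReal (J x)) := by ring
        _ = _ := by
            rw [← ENNReal.ofReal_mul (inv_nonneg.2 (hJ x).le),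
              inv_mul_cancel₀ (hJ x).ne', ENNReal.ofReal_one, mul_one]
    · rw [hgz x hx, zero_mul]
      exact zero_le
  calc _ ≤ ∫⁻ y in Ω, ∫⁻ x, G (y, x) := setLIntegral_mono' hΩ hstep1
    _ ≤ ∫⁻ y, ∫⁻ x, G (y, x) := setLIntegral_le_lintegral _ _
    _ = ∫⁻ x, ∫⁻ y, G (y, x) := lintegral_lintegral_swap hGm.aemeasurable
    _ ≤ ∫⁻ x, Ω.indicator (fun x => (ENNReal.ofReal C * V) * (ENNReal.ofReal (w x) * Φ x)) x :=
        lintegral_mono hstep2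
    _ = _ := by
        rw [lintegral_indicator hΩ, lintegral_const_mul' _ _ (by finiteness)]

end Schur


/-! ### Averages over the translates of a ball around the base point -/

namespace TAlgebra

open Set Metric

variable {r n : ℕ} {U : Type*} [NonUnitalNonAssocRing U] [Module ℝ U]
  [IsScalarTower ℝ U U] [SMulCommClass ℝ U U] [StarRing U] [StarModule ℝ U]
  [FiniteDimensional ℝ U] {b : Module.Basis (Fin n) ℝ (selfAdjoint.submodule ℝ U)}
  (T : TAlgebra r U) (hb : T.IsOrthonormal b)
include hb

theorem continuousOn_trans_inv : ContinuousOn (fun y => (T.trans b y)⁻¹) (T.coneSet b) := by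
  have h : (fun y => (T.trans b y)⁻¹) = fun y => (T.trans b y).det⁻¹ • (T.trans b y).adjugate := by
    funext y
    rw [Matrix.inv_def, Ring.inverse_eq_inv']
  rw [h]
  have hA := T.continuousOn_trans hb
  have hdet : ContinuousOn (fun y => (T.trans b y).det) (T.coneSet b) :=
    (continuous_id.matrix_det).comp_continuousOn hA
  have hadj : ContinuousOn (fun y => (T.trans b y).adjugate) (T.coneSet b) :=
    (continuous_id.matrix_adjugate).comp_continuousOn hA
  exact (hdet.inv₀ fun y _ => T.det_trans_ne_zero hb y).smul hadj

theorem continuousOn_trans_inv_mulVec :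
    ContinuousOn (fun q : (Fin n → ℝ) × (Fin n → ℝ) => (T.trans b q.1)⁻¹.mulVec q.2)
      (T.coneSet b ×ˢ univ) := by
  have h1 : ContinuousOn (fun q : (Fin n → ℝ) × (Fin n → ℝ) => (T.trans b q.1)⁻¹)
      (T.coneSet b ×ˢ univ) :=
    (T.continuousOn_trans_inv hb).comp continuousOn_fst fun q hq => hq.1
  have h2 : Continuous fun q : Matrix (Fin n) (Fin n) ℝ × (Fin n → ℝ) => q.1.mulVec q.2 :=
    continuous_fst.matrix_mulVec continuous_snd
  exact h2.comp_continuousOn (h1.prodMk continuousOn_snd)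

theorem continuousOn_abs_det_trans :
    ContinuousOn (fun y => |(T.trans b y).det|) (T.coneSet b) :=
  ((continuous_id.matrix_det).comp_continuousOn (T.continuousOn_trans hb)).abs

theorem trans_inv_mulVec_trans_mulVec (y v : Fin n → ℝ) :
    (T.trans b y)⁻¹.mulVec ((T.trans b y).mulVec v) = v := by
  rw [Matrix.mulVec_mulVec, Matrix.nonsing_inv_mul _ (T.det_trans_ne_zero hb y).isUnit,
    Matrix.one_mulVec]

theorem trans_mulVec_trans_inv_mulVec (y v : Fin n → ℝ) :
    (T.trans b y).mulVec ((T.trans b y)⁻¹.mulVec v) = v :=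
  T.mulVec_inv_mulVec hb (T.chol_mem y) v

/-- The change of variables `v ↦ A_y v`. -/
theorem lintegral_trans_mulVec (y : Fin n → ℝ) {B : Set (Fin n → ℝ)} (hB : MeasurableSet B)
    {Φ : (Fin n → ℝ) → ℝ≥0∞} (hΦ : Measurable Φ) :
    ∫⁻ v in B, Φ ((T.trans b y).mulVec v) =
      ENNReal.ofReal |(T.trans b y).det|⁻¹ *
        ∫⁻ x, {x | (T.trans b y)⁻¹.mulVec x ∈ B}.indicator Φ x := by
  have hS : MeasurableSet {x | (T.trans b y)⁻¹.mulVec x ∈ B} :=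
    hB.preimage (by fun_prop : Continuous fun x => (T.trans b y)⁻¹.mulVec x).measurable
  have hm : Measurable (Matrix.toLin' (T.trans b y)) :=
    (LinearMap.continuous_of_finiteDimensional _).measurable
  have h := Real.map_matrix_volume_pi_eq_smul_volume_pi (T.det_trans_ne_zero hb y)
  have h1 : ∫⁻ x, {x | (T.trans b y)⁻¹.mulVec x ∈ B}.indicator Φ x
      ∂(volume.map (Matrix.toLin' (T.trans b y))) = ∫⁻ v in B, Φ ((T.trans b y).mulVec v) := by
    rw [lintegral_map (hΦ.indicator hS) hm, ← lintegral_indicator hB]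
    refine lintegral_congr fun v => ?_
    by_cases hv : v ∈ B
    · rw [indicator_of_mem hv, indicator_of_mem]
      · rfl
      · change (T.trans b y)⁻¹.mulVec ((T.trans b y).mulVec v) ∈ B
        rwa [T.trans_inv_mulVec_trans_mulVec hb]
    · rw [indicator_of_notMem hv, indicator_of_notMem]
      change ¬ (T.trans b y)⁻¹.mulVec ((T.trans b y).mulVec v) ∈ B
      rwa [T.trans_inv_mulVec_trans_mulVec hb]
  rw [← h1, h, lintegral_smul_measure, smul_eq_mul, abs_inv]

/-- The pairs `(y, x)` with `x ∈ A_y (ball e δ)`. -/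
def ballKernel (T : TAlgebra r U) (b : Module.Basis (Fin n) ℝ (selfAdjoint.submodule ℝ U))
    (δ : ℝ) : Set ((Fin n → ℝ) × (Fin n → ℝ)) :=
  {q | q.1 ∈ T.coneSet b ∧ (T.trans b q.1)⁻¹.mulVec q.2 ∈ ball (T.base b) δ}

theorem isOpen_ballKernel (δ : ℝ) : IsOpen (T.ballKernel b δ) := by
  have := (T.continuousOn_trans_inv_mulVec hb).isOpen_inter_preimage
    ((T.isOpen_coneSet hb).prod isOpen_univ) (isOpen_ball (x := T.base b) (ε := δ))
  convert this using 1
  ext q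
  simp [ballKernel]

theorem exists_of_mem_ballKernel {δ : ℝ} (hball : closedBall (T.base b) δ ⊆ T.coneSet b)
    {y x : Fin n → ℝ} (h : (y, x) ∈ T.ballKernel b δ) :
    ∃ v ∈ closedBall (T.base b) δ, v ∈ T.coneSet b ∧ x = (T.trans b y).mulVec v ∧
      T.trans b x = T.trans b y * T.trans b v := by
  have hv := ball_subset_closedBall h.2
  have hx := (T.trans_mulVec_trans_inv_mulVec hb y x).symm
  refine ⟨_, hv, hball hv, hx, ?_⟩
  conv_lhs => rw [hx]
  exact T.trans_trans_mulVec hb y (hball hv)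

theorem mem_coneSet_of_mem_ballKernel {δ : ℝ} (hball : closedBall (T.base b) δ ⊆ T.coneSet b)
    {y x : Fin n → ℝ} (h : (y, x) ∈ T.ballKernel b δ) : x ∈ T.coneSet b := by
  obtain ⟨v, _, hv, rfl, _⟩ := T.exists_of_mem_ballKernel hb hball h
  exact T.trans_mulVec_mem hb y hv

/-- Since `x = A_y v`, weight and determinant at `x` are those at `y` times those at `v`. The
constant bounds `|det A_v| / Q^α(v)` on the compact ball around the base point. -/
theorem exists_weight_le_of_mem_ballKernel (α : Fin r → ℝ) {δ : ℝ} (hδ : 0 < δ)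
    (hball : closedBall (T.base b) δ ⊆ T.coneSet b) :
    ∃ C : ℝ, 0 ≤ C ∧ ∀ y x, y ∈ T.coneSet b → (y, x) ∈ T.ballKernel b δ →
      T.Qpow α (vec b y) * |(T.trans b y).det|⁻¹ ≤
        C * (T.Qpow α (vec b x) * |(T.trans b x).det|⁻¹) := by
  obtain ⟨C, hC⟩ := (isCompact_closedBall (T.base b) δ).exists_bound_of_continuousOn
    (f := fun v => |(T.trans b v).det| / T.Qpow α (vec b v))
    (((T.continuousOn_abs_det_trans hb).mono hball).div ((T.continuousOn_Qpow hb α).mono hball)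
      fun v hv => (T.Qpow_pos α (hball hv)).ne')
  refine ⟨C, (norm_nonneg _).trans (hC _ (mem_closedBall_self hδ.le)), fun y x hy hyx => ?_⟩
  obtain ⟨v, hv, hvc, hx, hAx⟩ := T.exists_of_mem_ballKernel hb hball hyx
  have h1 := (le_abs_self _).trans (hC v hv)
  have hwv := T.Qpow_pos α hvc
  have hwy := T.Qpow_pos α hy
  have hJv : 0 < |(T.trans b v).det| := abs_pos.2 (T.det_trans_ne_zero hb v)
  have hJy : 0 < |(T.trans b y).det| := abs_pos.2 (T.det_trans_ne_zero hb y)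
  have hwx : T.Qpow α (vec b x) = T.Qpow α (vec b y) * T.Qpow α (vec b v) := by
    rw [hx, T.Qpow_trans hb α hy hvc]
  rw [hAx, hwx, Matrix.det_mul, abs_mul]
  rw [div_le_iff₀ hwv] at h1
  generalize |(T.trans b v).det| = jv at *
  generalize |(T.trans b y).det| = jy at *
  generalize T.Qpow α (vec b v) = wv at *
  generalize T.Qpow α (vec b y) = wy at *
  calc wy * jy⁻¹ = wy * jy⁻¹ * (jv * jv⁻¹) := by rw [mul_inv_cancel₀ hJv.ne', mul_one]
    _ ≤ wy * jy⁻¹ * (C * wv * jv⁻¹) := by gcongr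
    _ = _ := by rw [mul_inv]; ring

/-- From `A_x = A_y A_v` follows `y = A_y e = A_x (A_v⁻¹ e)`. The points `A_v⁻¹ e` are bounded for
`v` in the compact ball, so `y` lies in the image under `A_x` of a fixed ball. -/
theorem exists_volume_ballKernel_le {δ : ℝ}
    (hball : closedBall (T.base b) δ ⊆ T.coneSet b) :
    ∃ V : ℝ≥0∞, V ≠ ∞ ∧ ∀ x, volume {y | (y, x) ∈ T.ballKernel b δ} ≤
      ENNReal.ofReal |(T.trans b x).det| * V := by
  have hmv : Continuous fun M : Matrix (Fin n) (Fin n) ℝ => M.mulVec (T.base b) :=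
    continuous_id.matrix_mulVec continuous_const
  have hcont : ContinuousOn (fun v => (T.trans b v)⁻¹.mulVec (T.base b)) (T.coneSet b) :=
    hmv.comp_continuousOn (T.continuousOn_trans_inv hb)
  obtain ⟨R, hR⟩ := (isCompact_closedBall (T.base b) δ).exists_bound_of_continuousOn
    (f := fun v => (T.trans b v)⁻¹.mulVec (T.base b))
    (hcont.mono hball)
  refine ⟨volume (closedBall (0 : Fin n → ℝ) R), measure_closedBall_lt_top.ne, fun x => ?_⟩
  have hsub : {y | (y, x) ∈ T.ballKernel b δ} ⊆
      (Matrix.toLin' (T.trans b x)) '' closedBall 0 R := fun y hy => by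
    obtain ⟨v, hv, hvc, hx, hAx⟩ := T.exists_of_mem_ballKernel hb hball hy
    refine ⟨(T.trans b v)⁻¹.mulVec (T.base b), ?_, ?_⟩
    · rw [mem_closedBall_zero_iff]
      exact hR v hv
    · rw [Matrix.toLin'_apply, hAx, ← Matrix.mulVec_mulVec,
        T.trans_mulVec_trans_inv_mulVec hb, T.trans_mulVec_base hb hy.1]
  refine (measure_mono hsub).trans_eq ?_
  rw [Measure.addHaar_image_linearMap, LinearMap.det_toLin']

/-- Averaging over the translates of a ball is bounded on weighted `L¹`. -/
theorem exists_lintegral_lintegral_trans_le (α : Fin r → ℝ) {δ : ℝ} (hδ : 0 < δ)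
    (hball : closedBall (T.base b) δ ⊆ T.coneSet b) :
    ∃ C : ℝ≥0, ∀ Φ : (Fin n → ℝ) → ℝ≥0∞, Measurable Φ →
      ∫⁻ y in T.coneSet b, ENNReal.ofReal (T.Qpow α (vec b y)) *
        ∫⁻ v in ball (T.base b) δ, Φ ((T.trans b y).mulVec v) ≤
      C * ∫⁻ y in T.coneSet b, ENNReal.ofReal (T.Qpow α (vec b y)) * Φ y := by
  have hΩ := T.isOpen_coneSet hb
  obtain ⟨C, hC0, hC⟩ := T.exists_weight_le_of_mem_ballKernel hb α hδ hball
  obtain ⟨V, hVt, hV⟩ := T.exists_volume_ballKernel_le hb hball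
  have hJ : ∀ y, 0 < |(T.trans b y).det| := fun y => abs_pos.2 (T.det_trans_ne_zero hb y)
  have hm : Measurable ((T.coneSet b).indicator
      fun x => T.Qpow α (vec b x) * |(T.trans b x).det|⁻¹) := by
    classical
    rw [← piecewise_eq_indicator]
    exact ((T.continuousOn_Qpow hb α).mul ((T.continuousOn_abs_det_trans hb).inv₀
      fun y _ => (hJ y).ne')).measurable_piecewise continuousOn_const hΩ.measurableSet
  refine ⟨C.toNNReal * V.toNNReal, fun Φ hΦ => ?_⟩
  have h := lintegral_kernel_le hΩ.measurableSet (T.isOpen_ballKernel hb δ).measurableSet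
    (fun y hy => T.Qpow_pos α hy) hJ hm hC0 hVt
    (fun y x _ h => T.mem_coneSet_of_mem_ballKernel hb hball h) hC (fun x _ => hV x) hΦ
  rw [ENNReal.coe_mul, ENNReal.coe_toNNReal hVt]
  refine le_trans (le_of_eq ?_) h
  refine setLIntegral_congr_fun hΩ.measurableSet fun y hy => ?_
  have hset : {x | (y, x) ∈ T.ballKernel b δ} =
      {x | (T.trans b y)⁻¹.mulVec x ∈ ball (T.base b) δ} := by
    ext x
    exact ⟨fun hx => hx.2, fun hx => ⟨hy, hx⟩⟩
  rw [T.lintegral_trans_mulVec hb y measurableSet_ball hΦ, hset]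

end TAlgebra

/-- Jensen's inequality for a finite measure. -/
theorem lintegral_rpow_le {X : Type*} [MeasurableSpace X] (μ : Measure X) [IsFiniteMeasure μ]
    {q : ℝ} (hq : 1 ≤ q) {F : X → ℝ≥0∞} (hF : AEMeasurable F μ) :
    (∫⁻ x, F x ∂μ) ^ q ≤ μ Set.univ ^ (q - 1) * ∫⁻ x, F x ^ q ∂μ := by
  have hq0 : 0 < q := by linarith
  have h := eLpNorm'_le_eLpNorm'_mul_rpow_measure_univ zero_lt_one hq hF.aestronglyMeasurable
  have h2 := ENNReal.rpow_le_rpow h hq0.le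
  simp only [eLpNorm', enorm_eq_self, ENNReal.rpow_one, div_one] at h2
  rw [ENNReal.mul_rpow_of_nonneg _ _ hq0.le, ← ENNReal.rpow_mul, ← ENNReal.rpow_mul, one_div,
    inv_mul_cancel₀ hq0.ne', ENNReal.rpow_one, sub_mul, inv_mul_cancel₀ hq0.ne', one_mul,
    mul_comm] at h2
  exact h2

/-! ### The mixed norm estimates -/

namespace TAlgebra

open Set Metric

variable {r n : ℕ} {U : Type*} [NonUnitalNonAssocRing U] [Module ℝ U]
  [IsScalarTower ℝ U U] [SMulCommClass ℝ U U] [StarRing U] [StarModule ℝ U]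
  [FiniteDimensional ℝ U] {b : Module.Basis (Fin n) ℝ (selfAdjoint.submodule ℝ U)}
  (T : TAlgebra r U)

theorem sliceNorm_weightMul {p : ℝ≥0∞} (κ : Fin r → ℝ) (f : (Fin n → ℂ) → ℂ) {y : Fin n → ℝ}
    (hy : y ∈ T.coneSet b) :
    sliceNorm p (T.weightMul b κ f) y =
      ENNReal.ofReal (T.Qpow κ (vec b y)) * sliceNorm p f y := by
  have h : ∀ x, T.weightMul b κ f (cpt x y) =
      ((T.Qpow κ (vec b y) : ℂ) • f) (cpt x y) := fun x => by
    have him : (fun j => (cpt x y j).im) = y := by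
      funext j
      simp [cpt]
    rw [weightMul, him]
    rfl
  have h2 := sliceNorm_const_smul p (T.Qpow κ (vec b y) : ℂ) f y
  rw [← ofReal_norm, Complex.norm_real, Real.norm_of_nonneg (T.Qpow_pos κ hy).le] at h2
  rw [← h2]
  unfold sliceNorm
  simp only [h]

variable (hb : T.IsOrthonormal b)
include hb

theorem exists_closedBall_subset_coneSet :
    ∃ δ > 0, closedBall (T.base b) δ ⊆ T.coneSet b :=
  Metric.nhds_basis_closedBall.mem_iff.1 (T.coneSet_mem_nhds_base hb)

theorem aemeasurable_weight (α : Fin r → ℝ) :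
    AEMeasurable (fun y => ENNReal.ofReal (T.Qpow α (vec b y)))
      (volume.restrict (T.coneSet b)) :=
  ((T.continuousOn_Qpow hb α).aemeasurable (T.isOpen_coneSet hb).measurableSet).ennreal_ofReal

theorem mixedNorm_rpow {p q : ℝ≥0∞} (hq0 : q ≠ 0) (hq : q ≠ ∞) (ν : Fin r → ℝ)
    (f : (Fin n → ℂ) → ℂ) :
    T.mixedNorm b p q ν f ^ q.toReal = ∫⁻ y in T.coneSet b,
      ENNReal.ofReal (T.Qpow (fun j => ν j - T.tau j) (vec b y)) * sliceNorm p f y ^ q.toReal := by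
  have hs : q.toReal ≠ 0 := (ENNReal.toReal_pos hq0 hq).ne'
  rw [mixedNorm, eLpNorm_eq_lintegral_rpow_enorm_toReal hq0 hq, ← ENNReal.rpow_mul, one_div,
    inv_mul_cancel₀ hs, ENNReal.rpow_one, coneMeasure,
    lintegral_withDensity_eq_lintegral_mul_non_measurable₀ _ (T.aemeasurable_weight hb _)
      (ae_of_all _ fun _ => ENNReal.ofReal_lt_top)]
  rfl

/-- The `L^q` estimate, `q < ∞`. -/
theorem exists_mixedNorm_box_le {ρ : Fin r → ℝ} (hρ : T.IsIntegralVector b ρ) (k : ℕ)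
    {p q : ℝ≥0∞} (hp : 1 ≤ p) (hq1 : 1 ≤ q) (hq : q ≠ ∞) (ν : Fin r → ℝ) :
    ∃ C : ℝ≥0, ∀ f, DifferentiableOn ℂ f (T.tube b) →
      T.mixedNorm b p q (fun j => ν j + k * q.toReal * ρ j) ((T.box b hρ)^[k] f) ≤
        C * T.mixedNorm b p q ν f := by
  obtain ⟨δ, hδ, hball⟩ := T.exists_closedBall_subset_coneSet hb
  obtain ⟨C₁, hC₁⟩ := T.exists_sliceNorm_box_le hb hρ k hp hδ hball
  obtain ⟨C₂, hC₂⟩ := T.exists_lintegral_lintegral_trans_le hb (fun j => ν j - T.tau j) hδ hball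
  have hΩ := T.isOpen_coneSet hb
  have hq0 : q ≠ 0 := (zero_lt_one.trans_le hq1).ne'
  set s := q.toReal with hs
  have hs1 : 1 ≤ s := by simpa using ENNReal.toReal_mono hq hq1
  have hs0 : 0 < s := by linarith
  set V := volume (ball (T.base b) δ) with hV
  have hVt : V ≠ ∞ := measure_ball_lt_top.ne
  set K : ℝ≥0∞ := (C₁ : ℝ≥0∞) ^ s * V ^ (s - 1) * C₂ with hK
  have hKt : K ≠ ∞ := ENNReal.mul_ne_top (ENNReal.mul_ne_top
    (ENNReal.rpow_ne_top_of_nonneg hs0.le ENNReal.coe_ne_top)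
    (ENNReal.rpow_ne_top_of_nonneg (by linarith) hVt)) ENNReal.coe_ne_top
  refine ⟨(K ^ s⁻¹).toNNReal, fun f hf => ?_⟩
  rw [ENNReal.coe_toNNReal (ENNReal.rpow_ne_top_of_nonneg (by positivity) hKt)]
  -- Slice norms of the extension by zero: measurable in `y`, as Jensen and Tonelli require, and
  -- unchanged on the cone.
  set F := sliceNorm p ((T.tube b).indicator f) with hF
  have hFm : Measurable F := measurable_sliceNorm
    (measurable_indicator_tubeOver hΩ hf.continuousOn) p
  have hFeq : ∀ y ∈ T.coneSet b, F y = sliceNorm p f y := fun y hy => sliceNorm_indicator f p hy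
  have hpt : ∀ y ∈ T.coneSet b,
      ENNReal.ofReal (T.Qpow (fun j => ν j + k * s * ρ j - T.tau j) (vec b y)) *
        sliceNorm p ((T.box b hρ)^[k] f) y ^ s ≤
      ((C₁ : ℝ≥0∞) ^ s * V ^ (s - 1)) *
        (ENNReal.ofReal (T.Qpow (fun j => ν j - T.tau j) (vec b y)) *
          ∫⁻ v in ball (T.base b) δ, F ((T.trans b y).mulVec v) ^ s) := by
    intro y hy
    -- The shift of the weight by `k q ρ` is exactly the `q`-th power of the factor `Q^ρ(y)^k` in
    -- the pointwise estimate.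
    have hw : T.Qpow (fun j => ν j + k * s * ρ j - T.tau j) (vec b y) =
        T.Qpow (fun j => ν j - T.tau j) (vec b y) * (T.Qpow ρ (vec b y) ^ k) ^ s := by
      rw [← Real.rpow_natCast, ← Real.rpow_mul (T.Qpow_pos ρ hy).le, ← T.Qpow_const_mul _ _ hy,
        ← T.Qpow_add _ _ hy]
      congr 1
      funext j
      ring
    have hQk : 0 < T.Qpow ρ (vec b y) ^ k := pow_pos (T.Qpow_pos ρ hy) k
    have h1 := hC₁ f hf y hy
    have h2 : ∫⁻ v in ball (T.base b) δ, sliceNorm p f ((T.trans b y).mulVec v) =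
        ∫⁻ v in ball (T.base b) δ, F ((T.trans b y).mulVec v) :=
      setLIntegral_congr_fun measurableSet_ball fun v hv =>
        (hFeq _ (T.trans_mulVec_mem hb y (hball (ball_subset_closedBall hv)))).symm
    have hAm : Measurable fun v => F ((T.trans b y).mulVec v) :=
      hFm.comp (by fun_prop : Continuous fun v => (T.trans b y).mulVec v).measurable
    have : IsFiniteMeasure (volume.restrict (ball (T.base b) δ)) :=
      ⟨by rw [Measure.restrict_apply_univ]; exact measure_ball_lt_top⟩
    have h3 := lintegral_rpow_le (volume.restrict (ball (T.base b) δ)) hs1 hAm.aemeasurable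
    rw [Measure.restrict_apply_univ] at h3
    rw [h2] at h1
    rw [hw, ENNReal.ofReal_mul (T.Qpow_pos _ hy).le, ← ENNReal.ofReal_rpow_of_pos hQk, mul_assoc,
      ← ENNReal.mul_rpow_of_nonneg _ _ hs0.le, mul_left_comm]
    refine mul_le_mul_right ?_ _
    refine (ENNReal.rpow_le_rpow h1 hs0.le).trans ?_
    rw [ENNReal.mul_rpow_of_nonneg _ _ hs0.le, mul_assoc]
    exact mul_le_mul_right h3 _
  have hmain : T.mixedNorm b p q (fun j => ν j + k * s * ρ j) ((T.box b hρ)^[k] f) ^ s ≤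
      K * T.mixedNorm b p q ν f ^ s := by
    rw [T.mixedNorm_rpow hb hq0 hq, T.mixedNorm_rpow hb hq0 hq]
    refine (setLIntegral_mono' hΩ.measurableSet hpt).trans ?_
    rw [lintegral_const_mul' _ _ (ENNReal.mul_ne_top
      (ENNReal.rpow_ne_top_of_nonneg hs0.le ENNReal.coe_ne_top)
      (ENNReal.rpow_ne_top_of_nonneg (by linarith) hVt)), hK, mul_assoc _ (C₂ : ℝ≥0∞)]
    refine mul_le_mul_right ((hC₂ (fun y => F y ^ s) (hFm.pow_const s)).trans_eq ?_) _
    congr 1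
    refine setLIntegral_congr_fun hΩ.measurableSet fun y hy => ?_
    rw [hFeq y hy]
  calc _ = (T.mixedNorm b p q (fun j => ν j + k * s * ρ j) ((T.box b hρ)^[k] f) ^ s) ^ s⁻¹ := by
        rw [← ENNReal.rpow_mul, mul_inv_cancel₀ hs0.ne', ENNReal.rpow_one]
    _ ≤ (K * T.mixedNorm b p q ν f ^ s) ^ s⁻¹ := ENNReal.rpow_le_rpow hmain (by positivity)
    _ = _ := by
        rw [ENNReal.mul_rpow_of_nonneg _ _ (by positivity : 0 ≤ s⁻¹), ← ENNReal.rpow_mul,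
          mul_inv_cancel₀ hs0.ne', ENNReal.rpow_one]

/-- The density `Q^{ν-τ}` is positive on the cone, so its null sets there are those of Lebesgue
measure. -/
theorem ae_sliceNorm_le (p : ℝ≥0∞) (ν : Fin r → ℝ) (f : (Fin n → ℂ) → ℂ) :
    ∀ᵐ y ∂(volume.restrict (T.coneSet b)), sliceNorm p f y ≤ T.mixedNorm b p ∞ ν f := by
  have h1 : ∀ᵐ y ∂(T.coneMeasure b ν), sliceNorm p f y ≤ T.mixedNorm b p ∞ ν f := by
    have := ae_le_essSup (f := fun y => ‖sliceNorm p f y‖ₑ) (μ := T.coneMeasure b ν)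
    filter_upwards [this] with y hy
    rw [mixedNorm, eLpNorm_exponent_top]
    exact hy
  refine (withDensity_absolutelyContinuous' (T.aemeasurable_weight hb _) ?_).ae_le h1
  filter_upwards [ae_restrict_mem (T.isOpen_coneSet hb).measurableSet] with y hy
  exact (ENNReal.ofReal_pos.2 (T.Qpow_pos _ hy)).ne'

/-- The `L^∞` estimate. -/
theorem exists_mixedNorm_top_box_le {ρ : Fin r → ℝ} (hρ : T.IsIntegralVector b ρ) (k : ℕ)
    {p : ℝ≥0∞} (hp : 1 ≤ p) (ν : Fin r → ℝ) :
    ∃ C : ℝ≥0, ∀ f, DifferentiableOn ℂ f (T.tube b) →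
      T.mixedNorm b p ∞ ν (T.weightMul b (fun j => k * ρ j) ((T.box b hρ)^[k] f)) ≤
        C * T.mixedNorm b p ∞ ν f := by
  obtain ⟨δ, hδ, hball⟩ := T.exists_closedBall_subset_coneSet hb
  obtain ⟨C₁, hC₁⟩ := T.exists_sliceNorm_box_le hb hρ k hp hδ hball
  have hΩ := T.isOpen_coneSet hb
  set V := volume (ball (T.base b) δ) with hV
  have hVt : V ≠ ∞ := measure_ball_lt_top.ne
  refine ⟨C₁ * V.toNNReal, fun f hf => ?_⟩
  set M := T.mixedNorm b p ∞ ν f with hM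
  have hae := T.ae_sliceNorm_le hb p ν f
  rw [ae_restrict_iff' hΩ.measurableSet] at hae
  have hpt : ∀ y ∈ T.coneSet b,
      sliceNorm p (T.weightMul b (fun j => k * ρ j) ((T.box b hρ)^[k] f)) y ≤ C₁ * V * M := by
    intro y hy
    rw [T.sliceNorm_weightMul _ _ hy, T.Qpow_const_mul _ _ hy, Real.rpow_natCast]
    refine (hC₁ f hf y hy).trans ?_
    rw [mul_assoc]
    refine mul_le_mul_right ?_ _
    -- The bound on slices of `f` holds only outside a null set. The invertible map `A_y` pulls null
    -- sets back to null sets, so the average over the ball does not see it.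
    have hquasi : Measure.QuasiMeasurePreserving (Matrix.toLin' (T.trans b y)) volume volume := by
      refine ⟨(LinearMap.continuous_of_finiteDimensional _).measurable, ?_⟩
      rw [Real.map_matrix_volume_pi_eq_smul_volume_pi (T.det_trans_ne_zero hb y)]
      exact Measure.smul_absolutelyContinuous
    have hv : ∀ᵐ v ∂(volume.restrict (ball (T.base b) δ)),
        sliceNorm p f ((T.trans b y).mulVec v) ≤ M := by
      rw [ae_restrict_iff' measurableSet_ball]
      filter_upwards [hquasi.ae hae] with v hv hvb
      exact hv (T.trans_mulVec_mem hb y (hball (ball_subset_closedBall hvb)))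
    refine (lintegral_mono_ae hv).trans_eq ?_
    rw [setLIntegral_const, mul_comm]
  rw [ENNReal.coe_mul, ENNReal.coe_toNNReal hVt, mixedNorm, eLpNorm_exponent_top]
  refine essSup_le_of_ae_le _ ?_
  have hmem : ∀ᵐ y ∂(T.coneMeasure b ν), y ∈ T.coneSet b :=
    (withDensity_absolutelyContinuous _ _).ae_le (ae_restrict_mem hΩ.measurableSet)
  filter_upwards [hmem] with y hy
  exact hpt y hy

end TAlgebra

end

theorem proposition4p4 {r n : ℕ} {U : Type*} [NonUnitalNonAssocRing U] [Module ℝ U]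
    [IsScalarTower ℝ U U] [SMulCommClass ℝ U U] [StarRing U] [StarModule ℝ U]
    [FiniteDimensional ℝ U] (T : TAlgebra r U)
    (b : Module.Basis (Fin n) ℝ (selfAdjoint.submodule ℝ U)) (hb : T.IsOrthonormal b)
    (ρ : Fin r → ℝ) (hρ : T.IsIntegralVector b ρ) (k : ℕ)
    (p : ℝ≥0∞) (hp : 1 ≤ p) (ν : Fin r → ℝ) (hν : ∀ j, (T.m j : ℝ) / 2 < ν j) :
    (∀ q : ℝ≥0∞, 1 ≤ q → q ≠ ∞ → ∃ C : ℝ≥0, ∀ f ∈ T.bergman b p q ν,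
      (T.box b hρ)^[k] f ∈ T.bergman b p q (fun j => ν j + k * q.toReal * ρ j) ∧
      T.mixedNorm b p q (fun j => ν j + k * q.toReal * ρ j) ((T.box b hρ)^[k] f) ≤
        C * T.mixedNorm b p q ν f) ∧
    (∃ C : ℝ≥0, ∀ f ∈ T.bergman b p ∞ ν,
      DifferentiableOn ℂ ((T.box b hρ)^[k] f) (T.tube b) ∧
      T.mixedNorm b p ∞ ν (T.weightMul b (fun j => k * ρ j) ((T.box b hρ)^[k] f)) ≤
        C * T.mixedNorm b p ∞ ν f) := by
  refine ⟨fun q hq1 hq => ?_, ?_⟩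
  · obtain ⟨C, hC⟩ := T.exists_mixedNorm_box_le hb hρ k hp hq1 hq ν
    refine ⟨C, fun f hf => ⟨⟨T.differentiableOn_box_iterate hb hρ k hf.1, ?_⟩, hC f hf.1⟩⟩
    exact (hC f hf.1).trans_lt (ENNReal.mul_lt_top ENNReal.coe_lt_top hf.2)
  · obtain ⟨C, hC⟩ := T.exists_mixedNorm_top_box_le hb hρ k hp ν
    exact ⟨C, fun f hf => ⟨T.differentiableOn_box_iterate hb hρ k hf.1, hC f hf.1⟩⟩
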